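/- \textbf{Setting.} Let $\vec G=(V,A)$ be a directed graph on $V=\{1,\dots,n\}$ with arc costs $c:A\to\mathbb{R}_{\ge 0}$, and let $G=(V,E)$ be its underlying simple undirected graph ($uv\in E$ iff $u\neq v$ and $u\to v\in A$ or $v\to u\in A$). For $U\subseteq V$ let $\delta^+(U)$ be the set of arcs leaving $U$, $\delta^-(U)=\delta^+(V\setminus U)$, and $\delta(U)$ the set of edges of $G$ with exactly one endpoint in $U$. A vector $x:A\to\mathbb{R}$ is a feasible Held–Karp solution if $x\ge 0$, $x(\delta^+(U))\ge 1$ for all $\emptyset\ne U\subsetneq V$, and $x(\delta^+(\{v\}))=x(\delta^-(\{v\}))$ for all $v\in V$. For $uv\in E$ let $z(uv)=x(u\to v)+x(v\to u)$ and $c(uv)=\min\{c(u\to v),c(v\to u)\}$, where a missing arc counts as $0$ in $z$ and is ignored in the minimum. A set $W\subseteq E$ is $(\alpha,s)$-thin (with respect to $x$) if $|W\cap\delta(U)|\le\alpha\, z(\delta(U))$ for all $U\subseteq V$ and $c(W)\le s\sum_{a\in A}c(a)x(a)$. A cellular embedding of $G$ into a closed surface, orientable or non-orientable, is given by a rotation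 system with edge signatures; its Euler genus is $g=2-(|V|-|E|+|F|)$, where $F$ is the set of faces. \textbf{Lemma (Computing a thin forest).} There are absolute constants $\alpha,s>0$ and a polynomial-time algorithm which, given $\vec G$, $c$, a cellular embedding of $G$ of Euler genus $g$, and a feasible Held–Karp solution $x$, computes a spanning forest $T$ of $G$ with at most $\max\{1,g\}$ connected components that is $(\alpha,s)$-thin with respect to $x$. Here polynomial time is meant in the strong sense: on a random access machine whose only arithmetic operations are addition, subtraction and comparison, the algorithm halts after a number of steps bounded by a polynomial in $n$ (for arbitrary real data $c,x$); and there is a polynomial $q$ such that, whenever the entries of $c$ and $x$ are fractions with a common denominator $m$, and $m$, the absolute values of the numerators and the natural numbers in the input are at most $B$, all numbers in memory during the computation are natural numbers at most $B\,2^{q(n)}$ or fractions with denominator $m$ and numerators of absolute value at most $B\,2^{q(n)}$. -/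

import Mathlib

namespace ThinForest

/-! ### ATSP instances, the Held-Karp relaxation and thinness

An instance is a digraph `D` on a finite vertex set `V`, with arc costs `c`.
Functions on arcs are given as functions `V → V → ℝ`; only their values on the arcs of `D`
are ever used. -/

section HeldKarp

variable {V : Type*}

open Classical in
/-- The value at the pair `(u, v)` of a function on the arcs of `D`, read as `0` when
`u → v` is not an arc. -/
noncomputable def onArc (D : Digraph V) (f : V → V → ℝ) (u v : V) : ℝ :=
  if D.Adj u v then f u v else 0

/-- The underlying undirected simple graph `G`: `u` and `v` are adjacent iff `u ≠ v` and
`u → v` or `v → u` is an arc. -/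
abbrev underlying (D : Digraph V) : SimpleGraph V := D.toSimpleGraphInclusive

/-- The symmetrization `z(uv) = x(u → v) + x(v → u)`. -/
noncomputable def symmetrization (D : Digraph V) (x : V → V → ℝ) : Sym2 V → ℝ :=
  Sym2.lift ⟨fun u v => onArc D x u v + onArc D x v u, fun _ _ => add_comm _ _⟩

open Classical in
/-- The cost of an undirected edge `uv`: the smaller of the costs of those of the arcs
`u → v`, `v → u` that exist (and `0` when there is none). -/
noncomputable def edgeCost (D : Digraph V) (c : V → V → ℝ) : Sym2 V → ℝ :=
  Sym2.lift ⟨fun u v =>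
    if D.Adj u v then (if D.Adj v u then min (c u v) (c v u) else c u v)
    else (if D.Adj v u then c v u else 0), fun u v => by
      by_cases h1 : D.Adj u v <;> by_cases h2 : D.Adj v u <;> simp [h1, h2, min_comm]⟩

variable [Fintype V]

open Classical in
/-- `f(δ⁺(U))`, the sum of `f` over the arcs of `D` leaving `U`. -/
noncomputable def outSum (D : Digraph V) (f : V → V → ℝ) (U : Finset V) : ℝ :=
  ∑ u ∈ U, ∑ v ∈ Uᶜ, onArc D f u v

open Classical in
/-- Feasibility for the Held-Karp relaxation
`x(δ⁺(U)) ≥ 1` for all nonempty `U ⊊ V`, `x(δ⁺(v)) = x(δ⁻(v))` for all `v`, `x ≥ 0`. -/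
structure HeldKarpFeasible (D : Digraph V) (x : V → V → ℝ) : Prop where
  nonneg : ∀ u v, D.Adj u v → 0 ≤ x u v
  one_le_out : ∀ U : Finset V, U.Nonempty → U ≠ Finset.univ → 1 ≤ outSum D x U
  conservation : ∀ v, outSum D x {v} = outSum D x {v}ᶜ

open Classical in
/-- The edge set of a graph on `V`, as a finite set. -/
noncomputable def edges (H : SimpleGraph V) : Finset (Sym2 V) :=
  Finset.univ.filter fun e => e ∈ H.edgeSet

open Classical in
/-- `δ_H(U)`: the edges of `H` with one endpoint in `U` and the other one outside. -/
noncomputable def cut (H : SimpleGraph V) (U : Finset V) : Finset (Sym2 V) :=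
  (edges H).filter fun e => ∃ u ∈ U, ∃ v ∉ U, e = s(u, v)

/-- The total fractional cost `∑_{a ∈ A} c(a) x(a)`. -/
noncomputable def fractionalCost (D : Digraph V) (c x : V → V → ℝ) : ℝ :=
  ∑ u, ∑ v, onArc D c u v * onArc D x u v

open Classical in
/-- The set `W` of edges is `(α, s)`-thin with respect to `x`. -/
def IsThin (D : Digraph V) (c x : V → V → ℝ) (α s : ℝ) (W : Finset (Sym2 V)) : Prop :=
  (∀ U : Finset V, ((W ∩ cut (underlying D) U).card : ℝ)
      ≤ α * ∑ e ∈ cut (underlying D) U, symmetrization D x e) ∧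
  ∑ e ∈ W, edgeCost D c e ≤ s * fractionalCost D c x

end HeldKarp

/-! ### Cellular embeddings

A cellular embedding of a connected graph into a closed surface, orientable or not, is given
as usual by a rotation system together with a signature of the edges. -/

section Embedding

variable {V : Type*}

/-- A rotation system with a signature: for each vertex a cyclic order of the darts
leaving it, and for each edge the information whether the local orientations at its two
ends disagree along it (`twisted`; only the values on edges of `G` matter). -/
structure Embedding (G : SimpleGraph V) where
  rot : Equiv.Perm G.Dart
  sameCycle_iff : ∀ d d' : G.Dart, rot.SameCycle d d' ↔ d.fst = d'.fst
  twisted : Sym2 V → Bool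

/-- A flag is a dart `d` with one of the two sides of `d` near its start: `true` is the side
towards the dart `rot d`, `false` the side towards `rot⁻¹ d`. Two flags are linked when they
are the two sides of one corner of a face, or when they are the two ends of one side
of an edge. -/
inductive Embedding.Link {G : SimpleGraph V} (E : Embedding G) :
    G.Dart × Bool → G.Dart × Bool → Prop
  | corner (d : G.Dart) : E.Link (d, true) (E.rot d, false)
  | side (d : G.Dart) (b : Bool) :
      E.Link (d, b) (d.symm, if E.twisted d.edge then b else !b)

/-- The faces that have an edge on their boundary: the classes of flags under the
equivalence relation generated by `Link`. -/
def Embedding.Face {G : SimpleGraph V} (E : Embedding G) : Type _ := Quot E.Link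

open Classical in
/-- The number of faces; a graph without edges (a single point in the sphere) has one. -/
noncomputable def Embedding.numFaces {G : SimpleGraph V} (E : Embedding G) : ℕ :=
  if IsEmpty G.Dart then 1 else Nat.card E.Face

/-- The Euler genus `2 - χ = 2 - (|V| - |E| + |F|)` of the surface. -/
noncomputable def Embedding.eulerGenus {G : SimpleGraph V} (E : Embedding G) : ℤ :=
  2 - ((Nat.card V : ℤ) - (G.edgeSet.ncard : ℤ) + (E.numFaces : ℤ))

end Embedding

/-! ### The machine model

A random access machine with two memories, one for natural numbers and one for
real numbers. Each memory consists of two-dimensional arrays with names `0, 1, 2, …`; indices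
are computed natural numbers. The only arithmetic is addition and subtraction (truncated for
natural numbers), and numbers can be compared. There is no multiplication, division or
rounding. -/

/-- The content of the memory. -/
structure Store where
  nat : ℕ → ℕ → ℕ → ℕ
  real : ℕ → ℕ → ℕ → ℝ

/-- Expressions for natural numbers; `get a i j` reads the cell `(i, j)` of the array `a`. -/
inductive NatExp where
  | lit (k : ℕ)
  | get (a : ℕ) (i j : NatExp)
  | add (e f : NatExp)
  | sub (e f : NatExp)

/-- Expressions for real numbers. -/
inductive RealExp where
  | one
  | get (a : ℕ) (i j : NatExp)
  | add (e f : RealExp)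
  | sub (e f : RealExp)

/-- Tests. -/
inductive Test where
  | natLE (e f : NatExp)
  | realLE (e f : RealExp)
  | not (b : Test)
  | and (b b' : Test)

/-- Programs. -/
inductive Prog where
  | setNat (a : ℕ) (i j : NatExp) (e : NatExp)
  | setReal (a : ℕ) (i j : NatExp) (e : RealExp)
  | seq (P Q : Prog)
  | ite (b : Test) (P Q : Prog)
  | while (b : Test) (P : Prog)

/-- The value of an expression. -/
def NatExp.eval (σ : Store) : NatExp → ℕ
  | lit k => k
  | get a i j => σ.nat a (i.eval σ) (j.eval σ)
  | add e f => e.eval σ + f.eval σ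
  | sub e f => e.eval σ - f.eval σ

/-- The value of an expression. -/
def RealExp.eval (σ : Store) : RealExp → ℝ
  | one => 1
  | get a i j => σ.real a (i.eval σ) (j.eval σ)
  | add e f => e.eval σ + f.eval σ
  | sub e f => e.eval σ - f.eval σ

/-- The truth of a test. -/
def Test.Holds (σ : Store) : Test → Prop
  | natLE e f => e.eval σ ≤ f.eval σ
  | realLE e f => e.eval σ ≤ f.eval σ
  | not b => ¬ b.Holds σ
  | and b b' => b.Holds σ ∧ b'.Holds σ

/-- Write a natural number into the cell `(i, j)` of the array `a`. -/
def Store.setNat (σ : Store) (a i j w : ℕ) : Store where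
  nat a' i' j' := if a' = a ∧ i' = i ∧ j' = j then w else σ.nat a' i' j'
  real := σ.real

/-- Write a real number into the cell `(i, j)` of the array `a`. -/
def Store.setReal (σ : Store) (a i j : ℕ) (w : ℝ) : Store where
  nat := σ.nat
  real a' i' j' := if a' = a ∧ i' = i ∧ j' = j then w else σ.real a' i' j'

/-- A configuration: the list of programs still to be executed, and the memory. The machine
has halted when the list is empty. -/
abbrev Config := List Prog × Store

open Classical in
/-- One step of the computation. A step evaluates expressions of the program, whose size is
a constant that does not depend on the input. -/
noncomputable def step : Config → Config
  | ([], σ) => ([], σ)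
  | (.setNat a i j e :: K, σ) => (K, σ.setNat a (i.eval σ) (j.eval σ) (e.eval σ))
  | (.setReal a i j e :: K, σ) => (K, σ.setReal a (i.eval σ) (j.eval σ) (e.eval σ))
  | (.seq P Q :: K, σ) => (P :: Q :: K, σ)
  | (.ite b P Q :: K, σ) => if b.Holds σ then (P :: K, σ) else (Q :: K, σ)
  | (.while b P :: K, σ) => if b.Holds σ then (P :: .while b P :: K, σ) else (K, σ)

/-- The configuration of `P`, started on the memory `σ`, after `t` steps. -/
noncomputable def after (P : Prog) (σ : Store) (t : ℕ) : Config := step^[t] ([P], σ)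

/-- All natural numbers in the memory are at most `B`, and all real numbers in it are
fractions with the denominator `m` and a numerator of absolute value at most `B`. -/
def Store.SizeAtMost (σ : Store) (m B : ℕ) : Prop :=
  (∀ a i j, σ.nat a i j ≤ B) ∧
  ∀ a i j, ∃ k : ℤ, (m : ℝ) * σ.real a i j = k ∧ |k| ≤ (B : ℤ)

/-! ### Input and output -/

open Classical in
/-- The memory that holds an embedded instance on the vertex set `{0, …, n - 1}`
together with a vector `x`. Natural numbers: array `0` holds `n` in its cell `(0, 0)`, array `1`
the adjacency matrix of the digraph, array `2` the rotation system (for an edge `uv`, the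
cell `(u, v)` holds the neighbour of `u` that follows `v` around `u`), array `3` the signature of
the edges. Real numbers: array `0` holds the costs, array `1` the vector `x`. All other
cells are `0`. -/
noncomputable def input {n : ℕ} (D : Digraph (Fin n)) (E : Embedding (underlying D))
    (c x : Fin n → Fin n → ℝ) : Store where
  nat a i j :=
    if a = 0 then (if i = 0 ∧ j = 0 then n else 0)
    else if h : i < n ∧ j < n then
      let u : Fin n := ⟨i, h.1⟩
      let v : Fin n := ⟨j, h.2⟩
      if a = 1 then (if D.Adj u v then 1 else 0)
      else if a = 2 then
        (if huv : (underlying D).Adj u v then ((E.rot ⟨(u, v), huv⟩).snd : ℕ) else 0)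
      else if a = 3 then
        (if (underlying D).Adj u v ∧ E.twisted s(u, v) = true then 1 else 0)
      else 0
    else 0
  real a i j :=
    if h : i < n ∧ j < n then
      if a = 0 then onArc D c ⟨i, h.1⟩ ⟨j, h.2⟩
      else if a = 1 then onArc D x ⟨i, h.1⟩ ⟨j, h.2⟩
      else 0
    else 0

open Classical in
/-- The memory `σ` holds the adjacency matrix of the graph `T` in its array `4` of natural
numbers. -/
def Store.Represents {n : ℕ} (σ : Store) (T : SimpleGraph (Fin n)) : Prop :=
  ∀ u v : Fin n, σ.nat 4 u v = if T.Adj u v then 1 else 0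

end ThinForest

namespace ThinForest

/-! The forest is grown greedily. Contract the components of the current forest `T` and delete the
loops that arise; this leaves an embedded multigraph with `k` vertices, one for each component.
Edges that follow one another across faces of degree two are parallel and form chains. From each
side of an edge starts one part of its chain (its `hair`), which includes that side. An edge is
middle if both parts have `z`-weight at least 1/24, counted by edge sides, and it is a candidate if
the middle edges joining the same two components have total weight at least 1/12. A round adds a
cheapest candidate. A forest has fewer than `n` edges, so no candidate is left after `n` rounds.

Components. Let `k > max 1 g`. The cut constraints give the edge sides between components a total
weight of at least `2k`. Euler's formula bounds the number `b` of edge sides on faces of degree at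
least three by `6(k + g - 2) ≤ 12k - 18` (`card_branchEnds_le`). A hair lighter than 1/24 contains
such a side, and the light hairs containing a given one are nested, so the non-middle sides weigh at
most `b/12 < k` (`sum_not_middle_le`). There are at most `max 1 b ≤ 12k` classes of parallel edges
(`card_parClasses_le`), so without a candidate the middle sides weigh at most `k`. The total would
be below `2k`; hence a candidate exists (`exists_candidate`).

Thinness. Fix `U`. A set `P` of edge sides is maintained such that every union `Y` of faces contains
at most `2 #(P ∩ Y)` sides of forest edges leaving `U`, and `#P` is at most 48 times the weight of
the edges leaving `U` inside components. Suppose that an edge leaving `U` is added and consider one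
of its sides. If its whole hair leaves `U`, the weight of the hair is now inside a component and
pays for the side. Otherwise the hair meets a face of degree two with exactly one edge leaving `U`.
Boundaries of faces cross `U` evenly, so this face has an odd number of sides of forest edges
leaving `U`, and the even bound has a slack of one there. The face is merged with the one at the new
edge, and the slack absorbs the new side (`Embedding.Pays.addEdge`). If both sides need slack, a
parity argument provides two different odd faces (`exists_two_deviates`). Taking all faces for `Y`
gives `α = 96`.

Cost. The edge added is no more expensive than any middle edge parallel to it. These have weight at
least 1/12 and disappear inside a component in the same round, so each is charged once. This gives
`s = 24`.

Machine. A round consists of labelling equivalence classes, summing over index ranges and finding a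
minimum, all by loops bounded by `n` or `2n²`. So the time is polynomial. One step multiplies the
bound on the numbers by a constant factor at most, hence their lengths stay polynomial. -/

theorem even_card_of_involution {α : Type*} (s : Finset α) (f : α → α)
    (hmem : ∀ x ∈ s, f x ∈ s) (hinv : ∀ x ∈ s, f (f x) = x) (hne : ∀ x ∈ s, f x ≠ x) :
    Even s.card := by
  have h : ∑ _x ∈ s, (1 : ZMod 2) = 0 :=
    Finset.sum_involution (fun x _ => f x) (fun _ _ => by decide) (fun x hx _ => hne x hx)
      (fun x hx => hmem x hx) (fun x hx => hinv x hx)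
  rw [Finset.sum_const, nsmul_eq_mul, mul_one] at h
  exact (ZMod.natCast_eq_zero_iff_even).1 h

/-! ### Flags and the parity of face boundaries. -/

section Flags

set_option linter.unusedSectionVars false

open Classical Finset

variable {V : Type*} [Fintype V] [LinearOrder V] {G : SimpleGraph V}

/-- A dart with one of its two sides. -/
abbrev Flag (G : SimpleGraph V) := G.Dart × Bool

/-- The other flag at the same corner of a face. -/
def Embedding.corner (E : Embedding G) : Flag G → Flag G
  | (d, true) => (E.rot d, false)
  | (d, false) => (E.rot.symm d, true)

/-- The other end of the same side of an edge. -/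
def Embedding.side (E : Embedding G) (x : Flag G) : Flag G :=
  (x.1.symm, if E.twisted x.1.edge then x.2 else !x.2)

/-- The other side of the same dart. -/
def cross (x : Flag G) : Flag G := (x.1, !x.2)

variable (E : Embedding G)

@[simp] theorem cross_fst (x : Flag G) : (cross x).1 = x.1 := rfl

@[simp] theorem cross_cross (x : Flag G) : cross (cross x) = x := by simp [cross]

theorem cross_ne (x : Flag G) : cross x ≠ x := by
  obtain ⟨d, b⟩ := x
  cases b <;> simp [cross]

@[simp] theorem Embedding.corner_corner (x : Flag G) : E.corner (E.corner x) = x := by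
  obtain ⟨d, b⟩ := x
  cases b <;> simp [Embedding.corner]

theorem Embedding.corner_fst (x : Flag G) : (E.corner x).1.fst = x.1.fst := by
  obtain ⟨d, b⟩ := x
  cases b
  · refine ((E.sameCycle_iff _ _).1 ?_)
    exact ⟨1, by simp [Embedding.corner]⟩
  · refine ((E.sameCycle_iff _ _).1 ?_)
    exact ⟨-1, by simp [Embedding.corner]⟩

theorem Embedding.corner_ne (x : Flag G) : E.corner x ≠ x := by
  obtain ⟨d, b⟩ := x
  cases b <;> simp [Embedding.corner]

@[simp] theorem Embedding.side_fst (x : Flag G) : (E.side x).1 = x.1.symm := rfl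

@[simp] theorem Embedding.side_side (x : Flag G) : E.side (E.side x) = x := by
  obtain ⟨d, b⟩ := x
  by_cases h : E.twisted d.edge <;> simp [Embedding.side, h]

theorem Embedding.side_ne (x : Flag G) : E.side x ≠ x := fun h =>
  x.1.symm_ne (congrArg Prod.fst h)

theorem Embedding.side_cross (x : Flag G) : E.side (cross x) = cross (E.side x) := by
  obtain ⟨d, b⟩ := x
  by_cases h : E.twisted d.edge <;> simp [Embedding.side, cross, h]

theorem Embedding.link_corner_or (x : Flag G) :
    E.Link x (E.corner x) ∨ E.Link (E.corner x) x := by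
  obtain ⟨d, b⟩ := x
  cases b
  · right
    have := Embedding.Link.corner (E := E) (E.rot.symm d)
    simpa [Embedding.corner] using this
  · exact Or.inl (Embedding.Link.corner d)

theorem Embedding.link_side (x : Flag G) : E.Link x (E.side x) := Embedding.Link.side x.1 x.2

theorem Embedding.Link.eq_or {x y : Flag G} (h : E.Link x y) : y = E.corner x ∨ y = E.side x := by
  cases h with
  | corner d => exact Or.inl rfl
  | side d b => exact Or.inr rfl

theorem flag_eq_or_cross {x y : Flag G} (h : y.1 = x.1) : y = x ∨ y = cross x := by
  obtain ⟨d, b⟩ := x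
  obtain ⟨d', b'⟩ := y
  cases h
  cases b <;> cases b' <;> simp [cross]

theorem Embedding.eq_of_edge_eq {x y : Flag G} (h : y.1.edge = x.1.edge) :
    y = x ∨ y = cross x ∨ y = E.side x ∨ y = cross (E.side x) := by
  rcases (SimpleGraph.dart_edge_eq_iff _ _).1 h with h | h
  · rcases flag_eq_or_cross h with h | h <;> simp [h]
  · rcases flag_eq_or_cross (x := E.side x) h with h | h <;> simp [h]

/-- A union of faces. -/
def Embedding.FaceClosed (Y : Finset (Flag G)) : Prop :=
  (∀ x ∈ Y, E.corner x ∈ Y) ∧ ∀ x ∈ Y, E.side x ∈ Y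

variable {E}

/-- Boundaries of faces are closed walks, so they cross the boundary of `U` evenly. Formally,
`corner` pairs the flags of `Y` starting in `U`, and `side` pairs those with both ends in `U`. -/
theorem Embedding.FaceClosed.even_leaving {Y : Finset (Flag G)} (hY : E.FaceClosed Y)
    (U : Set V) : Even (#{x ∈ Y | x.1.fst ∈ U ∧ x.1.snd ∉ U}) := by
  have h1 : Even (#{x ∈ Y | x.1.fst ∈ U}) := by
    refine even_card_of_involution _ E.corner ?_ (fun x _ => E.corner_corner x)
      (fun x _ => E.corner_ne x)
    intro x hx
    rw [mem_filter] at hx ⊢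
    exact ⟨hY.1 _ hx.1, by rw [E.corner_fst]; exact hx.2⟩
  have h2 : Even (#{x ∈ Y | x.1.fst ∈ U ∧ x.1.snd ∈ U}) := by
    refine even_card_of_involution _ E.side ?_ (fun x _ => E.side_side x)
      (fun x _ => E.side_ne x)
    intro x hx
    rw [mem_filter] at hx ⊢
    exact ⟨hY.2 _ hx.1, hx.2.2, hx.2.1⟩
  have h3 := card_filter_add_card_filter_not (s := {x ∈ Y | x.1.fst ∈ U})
    (fun x => x.1.snd ∈ U)
  rw [filter_filter, filter_filter] at h3
  rw [← h3, Nat.even_add] at h1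
  exact h1.1 h2

/-- The edges with exactly one side in `Y` form a cycle modulo two and therefore meet every cut
evenly. Pairing flags by `corner`, `cross` and `side` removes everything but the flags counted here.
-/
theorem Embedding.FaceClosed.even_boundary {Y : Finset (Flag G)} (hY : E.FaceClosed Y)
    (A : Set V) : Even (#{x ∈ Y | cross x ∉ Y ∧ x.1.fst ∈ A ∧ x.1.snd ∉ A}) := by
  have h1 : Even (#{x ∈ Y | x.1.fst ∈ A}) := by
    refine even_card_of_involution _ E.corner ?_ (fun x _ => E.corner_corner x)
      (fun x _ => E.corner_ne x)
    intro x hx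
    rw [mem_filter] at hx ⊢
    exact ⟨hY.1 _ hx.1, by rw [E.corner_fst]; exact hx.2⟩
  have h2 : Even (#{x ∈ Y | x.1.fst ∈ A ∧ cross x ∈ Y}) := by
    refine even_card_of_involution _ cross ?_ (fun x _ => cross_cross x)
      (fun x _ => cross_ne x)
    intro x hx
    rw [mem_filter] at hx ⊢
    exact ⟨hx.2.2, hx.2.1, by rw [cross_cross]; exact hx.1⟩
  have h3 := card_filter_add_card_filter_not (s := {x ∈ Y | x.1.fst ∈ A})
    (fun x => cross x ∈ Y)
  rw [filter_filter, filter_filter] at h3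
  rw [← h3, Nat.even_add] at h1
  have h4 := h1.1 h2
  have h5 : Even (#{x ∈ Y | (x.1.fst ∈ A ∧ cross x ∉ Y) ∧ x.1.snd ∈ A}) := by
    refine even_card_of_involution _ E.side ?_ (fun x _ => E.side_side x)
      (fun x _ => E.side_ne x)
    intro x hx
    rw [mem_filter] at hx ⊢
    refine ⟨hY.2 _ hx.1, ⟨hx.2.2, fun hc => hx.2.1.2 ?_⟩, hx.2.1.1⟩
    rw [← E.side_cross] at hc
    simpa using hY.2 _ hc
  have h6 := card_filter_add_card_filter_not (s := {x ∈ Y | x.1.fst ∈ A ∧ cross x ∉ Y})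
    (fun x => x.1.snd ∈ A)
  rw [filter_filter, filter_filter] at h6
  rw [← h6, Nat.even_add] at h4
  have h7 := h4.1 h5
  convert h7 using 3
  tauto

end Flags

end ThinForest

namespace ThinForest

/-! ### Faces after contracting the forest and deleting loops. -/

section Classes

set_option linter.unusedSectionVars false

open Classical Finset

variable {V : Type*} [Fintype V] [LinearOrder V] {G : SimpleGraph V}

/-- The edge of the dart `d` joins two vertices of the same component of `T` without belonging
to `T`. -/
def IsLoop (T : SimpleGraph V) (d : G.Dart) : Prop :=
  ¬ T.Adj d.fst d.snd ∧ T.Reachable d.fst d.snd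

/-- Two flags are merged when they are linked or the two sides of a loop. -/
def Embedding.Merge (E : Embedding G) (T : SimpleGraph V) (x y : Flag G) : Prop :=
  E.Link x y ∨ (IsLoop T x.1 ∧ x.1.fst < x.1.snd ∧ x.2 = true ∧ y = cross x)

/-- The face of `x` in the graph in which `T` is contracted and the loops are deleted. -/
def Embedding.cl (E : Embedding G) (T : SimpleGraph V) (x : Flag G) : Quot (E.Merge T) :=
  Quot.mk _ x

/-- The flags of that face. -/
noncomputable def Embedding.cls (E : Embedding G) (T : SimpleGraph V) (x : Flag G) :
    Finset (Flag G) := {y | E.cl T y = E.cl T x}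

/-- One flag for each side of each edge joining different components of `T`. -/
noncomputable def ends (G : SimpleGraph V) (T : SimpleGraph V) : Finset (Flag G) :=
  {x | x.1.fst < x.1.snd ∧ ¬ T.Reachable x.1.fst x.1.snd}

/-- The number of edge sides on the face of `x`. -/
noncomputable def Embedding.deg (E : Embedding G) (T : SimpleGraph V) (x : Flag G) : ℕ :=
  #{y ∈ ends G T | E.cl T y = E.cl T x}

/-- `Y` is a union of faces of the graph in which `T` is contracted and the loops are
deleted. -/
def Embedding.Closed (E : Embedding G) (T : SimpleGraph V) (Y : Finset (Flag G)) : Prop :=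
  E.FaceClosed Y ∧ ∀ x ∈ Y, IsLoop T x.1 → cross x ∈ Y

/-- Exactly one end of the edge of `x` is in `U`. -/
def Cuts (U : Set V) (x : Flag G) : Prop := ¬ (x.1.fst ∈ U ↔ x.1.snd ∈ U)

/-- The edges of `x` and `y` join the same components of `T`. -/
def Par (T : SimpleGraph V) (x y : Flag G) : Prop :=
  (T.Reachable x.1.fst y.1.fst ∧ T.Reachable x.1.snd y.1.snd) ∨
  (T.Reachable x.1.fst y.1.snd ∧ T.Reachable x.1.snd y.1.fst)

variable {E : Embedding G} {T : SimpleGraph V}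

theorem mem_ends {x : Flag G} :
    x ∈ ends G T ↔ x.1.fst < x.1.snd ∧ ¬ T.Reachable x.1.fst x.1.snd := by simp [ends]

theorem cross_mem_ends {x : Flag G} : cross x ∈ ends G T ↔ x ∈ ends G T := by
  simp [mem_ends]

theorem mem_cls {x y : Flag G} : y ∈ E.cls T x ↔ E.cl T y = E.cl T x := by
  simp [Embedding.cls]

theorem IsLoop.symm {d : G.Dart} (h : IsLoop T d) : IsLoop T d.symm :=
  ⟨fun h' => h.1 h'.symm, h.2.symm⟩

theorem cl_corner (x : Flag G) : E.cl T (E.corner x) = E.cl T x := by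
  rcases E.link_corner_or x with h | h
  · exact (Quot.sound (r := E.Merge T) (Or.inl h)).symm
  · exact Quot.sound (r := E.Merge T) (Or.inl h)

theorem cl_side (x : Flag G) : E.cl T (E.side x) = E.cl T x :=
  (Quot.sound (r := E.Merge T) (Or.inl (E.link_side x))).symm

theorem cl_cross {x : Flag G} (h : IsLoop T x.1) : E.cl T (cross x) = E.cl T x := by
  have key : ∀ x : Flag G, IsLoop T x.1 → x.1.fst < x.1.snd →
      E.cl T (cross x) = E.cl T x := by
    intro x h hlt
    obtain ⟨d, b⟩ := x
    cases b
    · exact Quot.sound (r := E.Merge T) (Or.inr ⟨h, hlt, rfl, by simp [cross]⟩)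
    · exact (Quot.sound (r := E.Merge T) (Or.inr ⟨h, hlt, rfl, rfl⟩)).symm
  rcases lt_or_gt_of_ne x.1.fst_ne_snd with hlt | hlt
  · exact key x h hlt
  -- `Merge` lists a loop only in its increasing direction; the other direction is reached through
  -- `side`.
  · have := key (E.side x) h.symm hlt
    rwa [← E.side_cross, cl_side, cl_side] at this

theorem closed_cls (x : Flag G) : E.Closed T (E.cls T x) := by
  refine ⟨⟨fun y hy => ?_, fun y hy => ?_⟩, fun y hy h => ?_⟩ <;> rw [mem_cls] at hy ⊢
  · rw [cl_corner, hy]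
  · rw [cl_side, hy]
  · rw [cl_cross h, hy]

theorem closed_univ : E.Closed T univ := by
  simp [Embedding.Closed, Embedding.FaceClosed]

theorem Embedding.FaceClosed.corner_mem_iff {Y : Finset (Flag G)} (hY : E.FaceClosed Y)
    {x : Flag G} : E.corner x ∈ Y ↔ x ∈ Y :=
  ⟨fun h => by simpa using hY.1 _ h, hY.1 x⟩

theorem Embedding.FaceClosed.side_mem_iff {Y : Finset (Flag G)} (hY : E.FaceClosed Y)
    {x : Flag G} : E.side x ∈ Y ↔ x ∈ Y :=
  ⟨fun h => by simpa using hY.2 _ h, hY.2 x⟩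

theorem Embedding.Closed.cross_mem_iff {Y : Finset (Flag G)} (hY : E.Closed T Y)
    {x : Flag G} (h : IsLoop T x.1) : cross x ∈ Y ↔ x ∈ Y :=
  ⟨fun h' => by simpa using hY.2 _ h' h, fun h' => hY.2 x h' h⟩

theorem Embedding.Closed.mem_iff_of_cl_eq {Y : Finset (Flag G)} (hY : E.Closed T Y)
    {x y : Flag G} (h : E.cl T x = E.cl T y) : x ∈ Y ↔ y ∈ Y := by
  have h' : Relation.EqvGen (E.Merge T) x y := Quot.eqvGen_exact h
  clear h
  induction h' with
  | rel x y hxy =>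
    rcases hxy with hxy | ⟨hl, -, -, rfl⟩
    · rcases hxy.eq_or with rfl | rfl
      · exact hY.1.corner_mem_iff.symm
      · exact hY.1.side_mem_iff.symm
    · exact (hY.cross_mem_iff hl).symm
  | refl x => rfl
  | symm x y h ih => exact ih.symm
  | trans x y z h1 h2 ih1 ih2 => exact ih1.trans ih2

theorem Embedding.Closed.compl {Y : Finset (Flag G)} (hY : E.Closed T Y) : E.Closed T Yᶜ := by
  refine ⟨⟨fun x hx => ?_, fun x hx => ?_⟩, fun x hx h => ?_⟩ <;> rw [mem_compl] at hx ⊢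
  · rwa [hY.1.corner_mem_iff]
  · rwa [hY.1.side_mem_iff]
  · rwa [hY.cross_mem_iff h]

theorem Embedding.Closed.inter {Y Z : Finset (Flag G)} (hY : E.Closed T Y)
    (hZ : E.Closed T Z) : E.Closed T (Y ∩ Z) := by
  refine ⟨⟨fun x hx => ?_, fun x hx => ?_⟩, fun x hx h => ?_⟩ <;> rw [mem_inter] at hx ⊢
  · rwa [hY.1.corner_mem_iff, hZ.1.corner_mem_iff]
  · rwa [hY.1.side_mem_iff, hZ.1.side_mem_iff]
  · rwa [hY.cross_mem_iff h, hZ.cross_mem_iff h]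

theorem cuts_cross {U : Set V} {x : Flag G} : Cuts U (cross x) ↔ Cuts U x := Iff.rfl

theorem cuts_side {U : Set V} {x : Flag G} : Cuts U (E.side x) ↔ Cuts U x := by
  simp only [Cuts, Embedding.side_fst, SimpleGraph.Dart.symm, Prod.fst_swap, Prod.snd_swap]
  tauto

/-- An edge side has two flags, exchanged by `side`. If the edge has one end in `U`, exactly one of
them starts in `U` and exactly one is increasing, so this count equals that of `even_leaving`. -/
theorem Embedding.FaceClosed.even_cuts {Y : Finset (Flag G)} (hY : E.FaceClosed Y) (U : Set V) :
    Even (#{x ∈ Y | x.1.fst < x.1.snd ∧ Cuts U x}) := by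
  convert hY.even_leaving U using 1
  refine card_nbij' (fun x => if x.1.fst ∈ U then x else E.side x)
    (fun x => if x.1.fst < x.1.snd then x else E.side x) ?_ ?_ ?_ ?_
  · intro x hx
    rw [mem_coe, mem_filter] at hx ⊢
    obtain ⟨hx, hlt, hc⟩ := hx
    unfold Cuts at hc
    by_cases h : x.1.fst ∈ U
    · simp only [h, if_true, true_and]
      exact ⟨hx, by tauto⟩
    · simp only [h, if_false]
      refine ⟨hY.2 _ hx, ?_⟩
      simp [SimpleGraph.Dart.symm]
      tauto
  · intro x hx
    rw [mem_coe, mem_filter] at hx ⊢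
    obtain ⟨hx, hU, hU'⟩ := hx
    by_cases h : x.1.fst < x.1.snd
    · simp only [h, if_true, true_and]
      exact ⟨hx, by simp [Cuts, hU, hU']⟩
    · have := lt_of_le_of_ne (not_lt.1 h) x.1.snd_ne_fst
      simp only [h, if_false]
      exact ⟨hY.2 _ hx, this, by rw [cuts_side]; simp [Cuts, hU, hU']⟩
  · intro x hx
    rw [mem_coe, mem_filter] at hx
    obtain ⟨hx, hlt, hc⟩ := hx
    by_cases h : x.1.fst ∈ U
    · simp [h, hlt]
    · simp [h, SimpleGraph.Dart.symm, hlt.not_gt]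
  · intro x hx
    rw [mem_coe, mem_filter] at hx
    obtain ⟨hx, hU, hU'⟩ := hx
    by_cases h : x.1.fst < x.1.snd
    · simp [h, hU]
    · simp [h, SimpleGraph.Dart.symm, hU']

/-- A loop has both or none of its sides in `Y`, so loops drop out modulo two. What remains are
forest edges and edges between different components. -/
theorem Embedding.Closed.even_cuts {Y : Finset (Flag G)} (hY : E.Closed T Y) (U : Set V) :
    Even (#{x ∈ Y | x.1.fst < x.1.snd ∧ T.Adj x.1.fst x.1.snd ∧ Cuts U x} +
      #{x ∈ ends G T | x ∈ Y ∧ Cuts U x}) := by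
  have h1 := hY.1.even_cuts U
  have h2 : Even (#{x ∈ Y | (x.1.fst < x.1.snd ∧ Cuts U x) ∧ IsLoop T x.1}) := by
    refine even_card_of_involution _ cross ?_ (fun x _ => cross_cross x) (fun x _ => cross_ne x)
    intro x hx
    rw [mem_filter] at hx ⊢
    exact ⟨hY.2 _ hx.1 hx.2.2, hx.2⟩
  have h3 := card_filter_add_card_filter_not (s := {x ∈ Y | x.1.fst < x.1.snd ∧ Cuts U x})
    (fun x => IsLoop T x.1)
  rw [filter_filter, filter_filter] at h3
  rw [← h3, Nat.even_add] at h1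
  have h4 := h1.1 h2
  rw [← card_union_of_disjoint]
  · convert h4 using 2
    ext x
    rw [mem_union, mem_filter, mem_filter, mem_filter, mem_ends, IsLoop]
    have : T.Adj x.1.fst x.1.snd → T.Reachable x.1.fst x.1.snd := fun h => h.reachable
    tauto
  · rw [disjoint_left]
    intro x hx hx'
    rw [mem_filter] at hx hx'
    exact (mem_ends.1 hx'.1).2 hx.2.2.1.reachable

theorem Embedding.Closed.even_ends {Y : Finset (Flag G)} (hY : E.Closed T Y) {U : Set V}
    (hU : ∀ u v, T.Adj u v → (u ∈ U ↔ v ∈ U)) : Even (#{x ∈ ends G T | x ∈ Y ∧ Cuts U x}) := by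
  have h := hY.even_cuts U
  rw [filter_eq_empty_iff.2, card_empty, zero_add] at h
  · exact h
  · intro x _ hx
    exact hx.2.2 (hU _ _ hx.2.1)

theorem reachable_set_adj (a : V) : ∀ u v, T.Adj u v →
    (u ∈ {w | T.Reachable a w} ↔ v ∈ {w | T.Reachable a w}) := fun _ _ h =>
  ⟨fun h' => h'.trans h.reachable, fun h' => h'.trans h.symm.reachable⟩

/-- No loops are left, so no face has degree one: the face of `x` crosses the boundary of the
component of `x.1.fst` at least once, and evenly often. -/
theorem two_le_deg {x : Flag G} (hx : x ∈ ends G T) : 2 ≤ E.deg T x := by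
  have h := (closed_cls (E := E) (T := T) x).even_ends (reachable_set_adj x.1.fst)
  have hmem : x ∈ {y ∈ ends G T | y ∈ E.cls T x ∧ Cuts {w | T.Reachable x.1.fst w} y} := by
    rw [mem_filter]
    refine ⟨hx, mem_cls.2 rfl, fun h => (mem_ends.1 hx).2 (h.1 (SimpleGraph.Reachable.refl _))⟩
  have h1 : 0 < #{y ∈ ends G T | y ∈ E.cls T x ∧ Cuts {w | T.Reachable x.1.fst w} y} :=
    card_pos.2 ⟨x, hmem⟩
  have h2 : #{y ∈ ends G T | y ∈ E.cls T x ∧ Cuts {w | T.Reachable x.1.fst w} y} ≤ E.deg T x := by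
    refine card_le_card fun y hy => ?_
    rw [mem_filter] at hy ⊢
    exact ⟨hy.1, mem_cls.1 hy.2.1⟩
  obtain ⟨k, hk⟩ := h
  omega

/-- By parity, a union of components that is left by one edge of a face of degree two is left by the
other as well. Applying this to the components of the two ends of `x` locates the ends of `y`. -/
theorem par_of_deg_eq_two {x y : Flag G} (hx : x ∈ ends G T) (hy : y ∈ ends G T)
    (hne : y ≠ x) (hcl : E.cl T y = E.cl T x) (hdeg : E.deg T x = 2) : Par T x y := by
  have hset : {z ∈ ends G T | E.cl T z = E.cl T x} = {x, y} := by
    symm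
    apply eq_of_subset_of_card_le
    · intro z hz
      rw [mem_insert, mem_singleton] at hz
      rw [mem_filter]
      rcases hz with rfl | rfl
      exacts [⟨hx, rfl⟩, ⟨hy, hcl⟩]
    · rw [card_pair hne.symm]
      exact hdeg.le
  have key : ∀ U : Set V, (∀ u v, T.Adj u v → (u ∈ U ↔ v ∈ U)) → Cuts U x → Cuts U y := by
    intro U hU hxU
    by_contra hyU
    have h := (closed_cls (E := E) (T := T) x).even_ends hU
    have : {z ∈ ends G T | z ∈ E.cls T x ∧ Cuts U z} = {x} := by
      simp only [mem_cls]
      rw [← filter_filter, hset]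
      ext z
      simp only [mem_filter, mem_insert, mem_singleton]
      constructor
      · rintro ⟨rfl | rfl, h⟩
        · rfl
        · exact absurd h hyU
      · rintro rfl
        exact ⟨Or.inl rfl, hxU⟩
    rw [this] at h
    simp at h
  have hx' := (mem_ends.1 hx).2
  have h1 := key _ (reachable_set_adj x.1.fst)
    (fun h => hx' (h.1 (SimpleGraph.Reachable.refl _)))
  have h2 := key _ (reachable_set_adj x.1.snd)
    (fun h => hx' (h.2 (SimpleGraph.Reachable.refl _)).symm)
  simp only [Cuts, Set.mem_ofPred_eq] at h1 h2
  have h3 : ∀ w, T.Reachable x.1.fst w → ¬ T.Reachable x.1.snd w := fun w h h' =>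
    hx' (h.trans h'.symm)
  have h4 := h3 y.1.fst
  have h5 := h3 y.1.snd
  simp only [Par]
  tauto

/-- With `corner` and `cross` one can turn around a vertex, so `Y` contains every flag at a vertex
if it contains one; `side` leads to the neighbours, and connectedness does the rest. -/
theorem mem_of_closed_cross (hG : G.Preconnected) {Y : Finset (Flag G)} (hY : E.FaceClosed Y)
    (hc : ∀ x ∈ Y, cross x ∈ Y) {x : Flag G} (hx : x ∈ Y) (y : Flag G) : y ∈ Y := by
  have hb : ∀ (d : G.Dart) (b b' : Bool), (d, b) ∈ Y → (d, b') ∈ Y := by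
    intro d b b' h
    rcases flag_eq_or_cross (x := (d, b)) (y := (d, b')) rfl with h' | h' <;> rw [h']
    exacts [h, hc _ h]
  have hrot : ∀ (d : G.Dart) (b : Bool), (d, b) ∈ Y → (E.rot d, true) ∈ Y := by
    intro d b h
    exact hb _ _ _ (hY.1 _ (hb _ _ true h))
  have hrot' : ∀ (d : G.Dart) (b : Bool), (d, b) ∈ Y → (E.rot.symm d, true) ∈ Y := by
    intro d b h
    exact hY.1 _ (hb _ _ false h)
  have hcyc : ∀ d d' : G.Dart, d.fst = d'.fst → (d, true) ∈ Y → (d', true) ∈ Y := by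
    intro d d' h hd
    obtain ⟨i, rfl⟩ := (E.sameCycle_iff d d').2 h
    clear h
    induction i with
    | zero => simpa using hd
    | succ i ih =>
      rw [add_comm, zpow_add, Equiv.Perm.mul_apply, zpow_one]
      exact hrot _ _ ih
    | pred i ih =>
      rw [sub_eq_add_neg, add_comm, zpow_add, Equiv.Perm.mul_apply, zpow_neg_one]
      exact hrot' _ _ ih
  have hreach : ∀ v w : V, G.Reachable v w → (∀ d : G.Dart, d.fst = v → (d, true) ∈ Y) →
      ∀ d : G.Dart, d.fst = w → (d, true) ∈ Y := by
    rintro v w ⟨p⟩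
    induction p with
    | nil => exact id
    | @cons u v w h p ih =>
      intro hu
      refine ih fun d hd => ?_
      have h1 := hu ⟨(u, v), h⟩ rfl
      have h2 := hb _ _ true (hY.2 _ h1)
      exact hcyc _ _ (by simp [SimpleGraph.Dart.symm, hd]) h2
  obtain ⟨d, b⟩ := x
  obtain ⟨d', b'⟩ := y
  refine hb _ true _ (hreach _ _ (hG d.fst d'.fst) ?_ d' rfl)
  intro d'' hd''
  exact hcyc d d'' hd''.symm (hb _ _ _ hx)

/-- A forest does not separate the surface. If `Y` contained only one side of a forest edge, the
deletion of this edge would split its tree. The boundary of `Y` consists of forest edges, so it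
would meet the cut around one part in this edge alone, against `even_boundary`. -/
theorem eq_univ_of_closed_off_forest (hG : G.Preconnected) (hT : T.IsAcyclic)
    {Y : Finset (Flag G)} (hY : E.FaceClosed Y)
    (hc : ∀ x ∈ Y, ¬ T.Adj x.1.fst x.1.snd → cross x ∈ Y) {x : Flag G} (hx : x ∈ Y) :
    Y = univ := by
  rw [eq_univ_iff_forall]
  refine fun y => mem_of_closed_cross hG hY ?_ hx y
  intro x hx
  by_contra hcx
  have hadj : T.Adj x.1.fst x.1.snd := by
    by_contra h
    exact hcx (hc x hx h)
  have hbr := (SimpleGraph.isAcyclic_iff_forall_adj_isBridge.1 hT) hadj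
  rw [SimpleGraph.isBridge_iff] at hbr
  have hnr : ¬ (T \ SimpleGraph.fromEdgeSet {s(x.1.fst, x.1.snd)}).Reachable x.1.fst x.1.snd := by
    first | exact hbr.2 | exact hbr
  obtain ⟨A, hA⟩ : ∃ A : Set V, ∀ w, w ∈ A ↔
      (T \ SimpleGraph.fromEdgeSet {s(x.1.fst, x.1.snd)}).Reachable x.1.fst w :=
    ⟨{w | (T \ SimpleGraph.fromEdgeSet {s(x.1.fst, x.1.snd)}).Reachable x.1.fst w},
      fun _ => Iff.rfl⟩
  have h := hY.even_boundary A
  have : {y ∈ Y | cross y ∉ Y ∧ y.1.fst ∈ A ∧ y.1.snd ∉ A} = {x} := by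
    ext y
    rw [mem_filter, mem_singleton]
    constructor
    · rintro ⟨hy, hcy, h1, h2⟩
      have hya : T.Adj y.1.fst y.1.snd := by
        by_contra h
        exact hcy (hc y hy h)
      rw [hA] at h1 h2
      have he : s(y.1.fst, y.1.snd) = s(x.1.fst, x.1.snd) := by
        by_contra he
        refine h2 (h1.trans (SimpleGraph.Adj.reachable ?_))
        rw [SimpleGraph.sdiff_adj]
        refine ⟨hya, fun h' => he ?_⟩
        rw [SimpleGraph.fromEdgeSet_adj] at h'
        exact h'.1
      rcases Sym2.eq_iff.1 he with ⟨e1, e2⟩ | ⟨e1, e2⟩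
      · have : y.1 = x.1 := SimpleGraph.Dart.ext _ _ (Prod.ext e1 e2)
        rcases flag_eq_or_cross this with h | h
        · exact h
        · rw [h] at hy
          exact absurd hy hcx
      · rw [e1] at h1
        exact absurd h1 hnr
    · rintro rfl
      exact ⟨hx, hcx, (hA _).2 (SimpleGraph.Reachable.refl _), fun h => hnr ((hA _).1 h)⟩
  rw [this] at h
  simp at h

end Classes

end ThinForest

namespace ThinForest

/-! ### Chains of faces of degree two. -/

section Hairs

set_option linter.unusedSectionVars false

open Classical Finset

variable {V : Type*} [Fintype V] [LinearOrder V] {G : SimpleGraph V}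

/-- The other edge side on the face of `x` if there are just two, and `x` otherwise. -/
noncomputable def Embedding.mate (E : Embedding G) (T : SimpleGraph V) (x : Flag G) : Flag G :=
  if h : ∃ y ∈ ends G T, y ≠ x ∧ E.cl T y = E.cl T x ∧ E.deg T x = 2 then h.choose else x

/-- One step along a chain of parallel edges that does not cross the edge `e`. -/
def Embedding.HairStep (E : Embedding G) (T : SimpleGraph V) (e : G.Dart) (x y : Flag G) : Prop :=
  x ∈ ends G T ∧ y ∈ ends G T ∧
    ((E.cl T x = E.cl T y ∧ E.deg T x = 2) ∨ (y = cross x ∧ x.1 ≠ e))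

/-- The chain of parallel edges that starts at `x` on the side of the flag `x`. -/
noncomputable def Embedding.hair (E : Embedding G) (T : SimpleGraph V) (x : Flag G) :
    Finset (Flag G) := {y ∈ ends G T | Relation.EqvGen (E.HairStep T x.1) x y}

variable {E : Embedding G} {T : SimpleGraph V}

theorem deg_congr {x y : Flag G} (h : E.cl T x = E.cl T y) : E.deg T x = E.deg T y := by
  simp only [Embedding.deg, h]

theorem mate_mem_ends {x : Flag G} (hx : x ∈ ends G T) : E.mate T x ∈ ends G T := by
  unfold Embedding.mate
  split_ifs with h
  · exact h.choose_spec.1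
  · exact hx

theorem cl_mate (x : Flag G) : E.cl T (E.mate T x) = E.cl T x := by
  unfold Embedding.mate
  split_ifs with h
  · exact h.choose_spec.2.2.1
  · rfl

theorem mate_ne_iff {x : Flag G} : E.mate T x ≠ x ↔ E.deg T x = 2 := by
  constructor
  · intro h
    unfold Embedding.mate at h
    split_ifs at h with h'
    · exact h'.choose_spec.2.2.2
    · exact absurd rfl h
  · intro h
    have hex : ∃ y ∈ ends G T, y ≠ x ∧ E.cl T y = E.cl T x ∧ E.deg T x = 2 := by
      obtain ⟨a, b, hab, hs⟩ := card_eq_two.1 h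
      have ha : a ∈ ({y ∈ ends G T | E.cl T y = E.cl T x} : Finset (Flag G)) := by
        rw [hs]; simp
      have hb : b ∈ ({y ∈ ends G T | E.cl T y = E.cl T x} : Finset (Flag G)) := by
        rw [hs]; simp
      rw [mem_filter] at ha hb
      by_cases hax : a = x
      · exact ⟨b, hb.1, fun h => hab (hax.trans h.symm), hb.2, h⟩
      · exact ⟨a, ha.1, hax, ha.2, h⟩
    unfold Embedding.mate
    rw [dif_pos hex]
    exact hex.choose_spec.2.1

theorem eq_or_eq_mate {x y : Flag G} (hx : x ∈ ends G T) (hy : y ∈ ends G T)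
    (hcl : E.cl T y = E.cl T x) (hdeg : E.deg T x = 2) : y = x ∨ y = E.mate T x := by
  by_contra! h
  have hm := (mate_ne_iff (E := E)).2 hdeg
  have : ({x, E.mate T x, y} : Finset (Flag G)) ⊆ {y ∈ ends G T | E.cl T y = E.cl T x} := by
    intro z hz
    simp only [mem_insert, mem_singleton] at hz
    rw [mem_filter]
    rcases hz with rfl | rfl | rfl
    exacts [⟨hx, rfl⟩, ⟨mate_mem_ends hx, cl_mate _⟩, ⟨hy, hcl⟩]
  have h3 := card_le_card this
  rw [card_insert_of_notMem, card_pair h.2.symm] at h3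
  · unfold Embedding.deg at hdeg
    omega
  · simp only [mem_insert, mem_singleton, not_or]
    exact ⟨hm.symm, h.1.symm⟩

theorem mate_mate {x : Flag G} (hx : x ∈ ends G T) : E.mate T (E.mate T x) = x := by
  by_cases h : E.deg T x = 2
  · have hd : E.deg T (E.mate T x) = 2 := (deg_congr (cl_mate x)).trans h
    have hne := (mate_ne_iff (E := E)).2 hd
    rcases eq_or_eq_mate hx (mate_mem_ends (mate_mem_ends hx))
      ((cl_mate _).trans (cl_mate x)) h with h' | h'
    · exact h'
    · exact absurd h' hne
  · have : E.mate T x = x := by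
      by_contra h'
      exact h (mate_ne_iff.1 h')
    rw [this, this]

theorem Par.refl (x : Flag G) : Par T x x :=
  Or.inl ⟨SimpleGraph.Reachable.refl _, SimpleGraph.Reachable.refl _⟩

theorem Par.symm {x y : Flag G} (h : Par T x y) : Par T y x := by
  rcases h with ⟨h1, h2⟩ | ⟨h1, h2⟩
  exacts [Or.inl ⟨h1.symm, h2.symm⟩, Or.inr ⟨h2.symm, h1.symm⟩]

theorem Par.trans {x y z : Flag G} (h : Par T x y) (h' : Par T y z) : Par T x z := by
  rcases h with ⟨h1, h2⟩ | ⟨h1, h2⟩ <;> rcases h' with ⟨h3, h4⟩ | ⟨h3, h4⟩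
  exacts [Or.inl ⟨h1.trans h3, h2.trans h4⟩, Or.inr ⟨h1.trans h3, h2.trans h4⟩,
    Or.inr ⟨h1.trans h4, h2.trans h3⟩, Or.inl ⟨h1.trans h4, h2.trans h3⟩]

theorem par_cross (x : Flag G) : Par T x (cross x) := Par.refl x

theorem par_mate {x : Flag G} (hx : x ∈ ends G T) : Par T x (E.mate T x) := by
  by_cases h : E.mate T x = x
  · rw [h]
    exact Par.refl x
  · exact par_of_deg_eq_two hx (mate_mem_ends hx) h (cl_mate x) (mate_ne_iff.1 h)

theorem hair_subset (x : Flag G) : E.hair T x ⊆ ends G T := filter_subset _ _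

theorem self_mem_hair {x : Flag G} (hx : x ∈ ends G T) : x ∈ E.hair T x := by
  simp [Embedding.hair, hx, Relation.EqvGen.refl]

theorem mate_mem_hair {x y : Flag G} (hy : y ∈ E.hair T x) : E.mate T y ∈ E.hair T x := by
  by_cases h : E.mate T y = y
  · rwa [h]
  · simp only [Embedding.hair, mem_filter] at hy ⊢
    exact ⟨mate_mem_ends hy.1, hy.2.trans _ _ _ (.rel _ _ ⟨hy.1, mate_mem_ends hy.1,
      Or.inl ⟨(cl_mate y).symm, mate_ne_iff.1 h⟩⟩)⟩

theorem cross_mem_hair {x y : Flag G} (hy : y ∈ E.hair T x) (hne : y.1 ≠ x.1) :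
    cross y ∈ E.hair T x := by
  simp only [Embedding.hair, mem_filter] at hy ⊢
  have := cross_mem_ends.2 hy.1
  exact ⟨this, hy.2.trans _ _ _ (.rel _ _ ⟨hy.1, this, Or.inr ⟨rfl, hne⟩⟩)⟩

/-- The generated equivalence allows steps in both directions, but `mate` and `cross` are
involutions, so it suffices to carry the property forwards. -/
theorem hair_induction {x : Flag G} (p : Flag G → Prop) (h0 : p x)
    (hm : ∀ y ∈ E.hair T x, p y → p (E.mate T y))
    (hc : ∀ y ∈ E.hair T x, y.1 ≠ x.1 → p y → p (cross y)) {y : Flag G}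
    (hy : y ∈ E.hair T x) : p y := by
  have hx : ∀ {y z}, E.HairStep T x.1 y z → y ∈ ends G T ∧ z ∈ ends G T :=
    fun h => ⟨h.1, h.2.1⟩
  have key : ∀ y z, Relation.EqvGen (E.HairStep T x.1) y z → y ∈ E.hair T x →
      (p y ↔ p z) := by
    intro y z h
    have hmem : ∀ {y z}, Relation.EqvGen (E.HairStep T x.1) y z →
        (y ∈ E.hair T x ↔ z ∈ E.hair T x) := by
      intro y z h
      have he : ∀ {y z}, Relation.EqvGen (E.HairStep T x.1) y z →
          (y ∈ ends G T ↔ z ∈ ends G T) := by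
        intro y z h
        induction h with
        | rel y z h => simp [(hx h).1, (hx h).2]
        | refl y => rfl
        | symm y z _ ih => exact ih.symm
        | trans a b c _ _ ih1 ih2 => exact ih1.trans ih2
      simp only [Embedding.hair, mem_filter, he h]
      exact and_congr_right fun _ =>
        ⟨fun h' => h'.trans _ _ _ h, fun h' => h'.trans _ _ _ (h.symm _ _)⟩
    induction h with
    | rel y z h =>
      intro hy
      have hz := (hmem (.rel _ _ h)).1 hy
      obtain ⟨hye, hze, ⟨hcl, hd⟩ | ⟨rfl, hne⟩⟩ := h
      · rcases eq_or_eq_mate hye hze hcl.symm hd with rfl | rfl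
        · rfl
        · exact ⟨hm y hy, fun h => by simpa [mate_mate hye] using hm _ hz h⟩
      · exact ⟨hc y hy hne, fun h => by simpa using hc _ hz hne h⟩
    | refl y => exact fun _ => Iff.rfl
    | symm y z h ih => exact fun hz => (ih ((hmem h).2 hz)).symm
    | trans a b c h1 h2 ih1 ih2 => exact fun ha => (ih1 ha).trans (ih2 ((hmem h1).1 ha))
  have hy' := hy
  simp only [Embedding.hair, mem_filter] at hy'
  have hxe : x ∈ E.hair T x := by
    have he : ∀ {y z}, Relation.EqvGen (E.HairStep T x.1) y z →
        (y ∈ ends G T ↔ z ∈ ends G T) := by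
      intro y z h
      induction h with
      | rel y z h => simp [(hx h).1, (hx h).2]
      | refl y => rfl
      | symm y z _ ih => exact ih.symm
      | trans a b c _ _ ih1 ih2 => exact ih1.trans ih2
    exact self_mem_hair ((he hy'.2).2 hy'.1)
  exact (key x y hy'.2 hxe).1 h0

theorem par_of_mem_hair {x y : Flag G} (hy : y ∈ E.hair T x) : Par T x y :=
  hair_induction (E := E) (T := T) (Par T x) (Par.refl x)
    (fun _ hy h => h.trans (par_mate (hair_subset _ hy))) (fun _ _ _ h => h.trans (par_cross _)) hy

theorem cross_mem_hair_of_mem {x z : Flag G} (hz : z ∈ E.hair T x)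
    (hz' : z ∈ E.hair T (cross x)) (hx : x ∈ ends G T) : cross x ∈ E.hair T x := by
  rw [Embedding.hair, mem_filter] at *
  exact ⟨cross_mem_ends.2 hx, hz.2.trans _ _ _ (hz'.2.symm _ _)⟩

/-- A chain that returns to the other side of its first edge is a closed ring and has no end.
Alternating `mate` and `cross` walks along the chain from `x`. If the walk reached a first fixed
point of `mate`, then the flags met up to there and their mates would be the whole hair. With `cross
x` among them the walk would either fold back on itself or be periodic, and both are impossible. -/
theorem mate_ne_of_cross_mem_hair {x y : Flag G} (hx : x ∈ ends G T)
    (h : cross x ∈ E.hair T x) (hy : y ∈ E.hair T x) : E.mate T y ≠ y := by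
  set f : ℕ → Flag G := fun a => (fun y => cross (E.mate T y))^[a] x with hf
  have f0 : f 0 = x := rfl
  have fs : ∀ a, f (a + 1) = cross (E.mate T (f a)) := fun a =>
    Function.iterate_succ_apply' _ _ _
  have fadd : ∀ a b, f a = f 0 → f (a + b) = f b := by
    intro a b h
    induction b with
    | zero => exact h
    | succ b ih => rw [← add_assoc, fs, ih, fs]
  have fe : ∀ a, f a ∈ ends G T := by
    intro a
    induction a with
    | zero => exact hx
    | succ a ih => rw [fs, cross_mem_ends]; exact mate_mem_ends ih
  have fb : ∀ a, E.mate T (cross (f (a + 1))) = f a := fun a => by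
    rw [fs, cross_cross, mate_mate (fe a)]
  by_cases hfix : ∃ j, E.mate T (f j) = f j
  · exfalso
    obtain ⟨J, hJ, hmin⟩ : ∃ J, E.mate T (f J) = f J ∧ ∀ j < J, E.mate T (f j) ≠ f j :=
      ⟨Nat.find hfix, Nat.find_spec hfix, fun j hj => Nat.find_min hfix hj⟩
    have hii : ∀ a ≤ J, cross x ≠ f a := by
      intro a ha hxa
      -- Read backwards, the walk from `x` to `cross x` is the walk itself with all flags crossed.
      -- Its middle would be a fixed point of `cross` or an earlier fixed point of `mate`.
      have hrev : ∀ m k, m + k = a → f k = cross (f m) := by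
        intro m
        induction m with
        | zero =>
          intro k hk
          rw [f0, hxa, ← hk, zero_add]
        | succ m ih =>
          intro k hk
          have h1 := ih (k + 1) (by omega)
          have h2 := fb k
          rw [h1, cross_cross] at h2
          rw [← h2, fs, cross_cross]
      rcases Nat.even_or_odd' a with ⟨m, hm | hm⟩
      · exact cross_ne _ (hrev m m (by omega)).symm
      · have h1 := hrev m (m + 1) (by omega)
        rw [fs] at h1
        have h2 := congrArg cross h1
        rw [cross_cross, cross_cross] at h2
        exact hmin m (by omega) h2
    have hp : ∃ a ≤ J, cross x = f a ∨ cross x = E.mate T (f a) := by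
      refine hair_induction (E := E) (T := T) (x := x)
        (fun y => ∃ a ≤ J, y = f a ∨ y = E.mate T (f a)) ⟨0, Nat.zero_le _, Or.inl rfl⟩ ?_ ?_ h
      · rintro y - ⟨a, ha, rfl | rfl⟩
        · exact ⟨a, ha, Or.inr rfl⟩
        · exact ⟨a, ha, Or.inl (mate_mate (fe a))⟩
      · have hcase : ∀ a ≤ J, (f a).1 ≠ x.1 →
            ∃ b ≤ J, cross (f a) = f b ∨ cross (f a) = E.mate T (f b) := by
          intro a ha hne
          cases a with
          | zero => exact absurd rfl hne
          | succ a => exact ⟨a, by omega, Or.inr (by rw [fs, cross_cross])⟩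
        rintro y - hne ⟨a, ha, rfl | rfl⟩
        · exact hcase a ha hne
        · rcases ha.lt_or_eq with h' | rfl
          · exact ⟨a + 1, h', Or.inl (fs a).symm⟩
          · rw [hJ] at hne ⊢
            exact hcase a le_rfl hne
    obtain ⟨a, ha, h' | h'⟩ := hp
    · exact hii a ha h'
    · rcases ha.lt_or_eq with hlt | rfl
      · have h1 : f (a + 1) = f 0 := by rw [fs, ← h', cross_cross, f0]
        -- The walk is back at `x` after `a + 1` steps, so the fixed point at `J` already occurs `a
        -- + 1` steps earlier.
        have h2 := fadd (a + 1) (J - (a + 1)) h1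
        rw [show a + 1 + (J - (a + 1)) = J by omega] at h2
        exact hmin (J - (a + 1)) (by omega) (by rw [← h2, hJ])
      · rw [hJ] at h'
        exact hii a le_rfl h'
  · push Not at hfix
    have hp : ∃ a, y = f a ∨ y = E.mate T (f a) := by
      refine hair_induction (E := E) (T := T) (x := x)
        (fun y => ∃ a, y = f a ∨ y = E.mate T (f a)) ⟨0, Or.inl rfl⟩ ?_ ?_ hy
      · rintro y - ⟨a, rfl | rfl⟩
        · exact ⟨a, Or.inr rfl⟩
        · exact ⟨a, Or.inl (mate_mate (fe a))⟩
      · rintro y - hne ⟨a, rfl | rfl⟩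
        · cases a with
          | zero => exact absurd rfl hne
          | succ a => exact ⟨a, Or.inr (by rw [fs, cross_cross])⟩
        · exact ⟨a + 1, Or.inl (fs a).symm⟩
    obtain ⟨a, rfl | rfl⟩ := hp
    · exact hfix a
    · rw [mate_mate (fe a)]
      exact (hfix a).symm

end Hairs

end ThinForest

namespace ThinForest

/-! ### The payment scheme that keeps the forest thin. -/

section Thinness

set_option linter.unusedSectionVars false

open Classical Finset

variable {V : Type*} [Fintype V] [LinearOrder V] {G : SimpleGraph V}

/-- The weight of the chain of parallel edges that starts at `x`. -/
noncomputable def Embedding.hairWeight (E : Embedding G) (T : SimpleGraph V) (z : Sym2 V → ℝ)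
    (x : Flag G) : ℝ := ∑ y ∈ E.hair T x, z y.1.edge

/-- The edge of `x` is in the middle of a chain of parallel edges. -/
def Embedding.Middle (E : Embedding G) (T : SimpleGraph V) (z : Sym2 V → ℝ) (x : Flag G) : Prop :=
  x ∈ ends G T ∧ 1 ≤ 24 * E.hairWeight T z x ∧ 1 ≤ 24 * E.hairWeight T z (cross x)

/-- The weight of the middle edges that join the same components as the edge of `x`. -/
noncomputable def Embedding.parWeight (E : Embedding G) (T : SimpleGraph V) (z : Sym2 V → ℝ)
    (x : Flag G) : ℝ := ∑ y with E.Middle T z y ∧ Par T x y, z y.1.edge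

/-- The edges that may be added to the forest `T`. -/
def Embedding.Candidate (E : Embedding G) (T : SimpleGraph V) (z : Sym2 V → ℝ)
    (x : Flag G) : Prop := E.Middle T z x ∧ 1 ≤ 12 * E.parWeight T z x

/-- Add the edge of `x` to `T`. -/
def addEdge (T : SimpleGraph V) (x : Flag G) : SimpleGraph V :=
  T ⊔ SimpleGraph.edge x.1.fst x.1.snd

/-- The edge sides in `Y` of the edges of `T` that leave `U`. -/
noncomputable def act (T : SimpleGraph V) (U : Set V) (Y : Finset (Flag G)) : Finset (Flag G) :=
  {x ∈ Y | x.1.fst < x.1.snd ∧ T.Adj x.1.fst x.1.snd ∧ Cuts U x}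

/-- The weight of the edges leaving `U` with both ends in one component of `T`, each edge being
counted twice. -/
noncomputable def deadSum (G : SimpleGraph V) (T : SimpleGraph V) (z : Sym2 V → ℝ) (U : Set V) :
    ℝ := ∑ x : Flag G with x.1.fst < x.1.snd ∧ T.Reachable x.1.fst x.1.snd ∧ Cuts U x, z x.1.edge

/-- The set `P` of edge sides pays for the edges of `T` leaving `U`. -/
def Embedding.Pays (E : Embedding G) (T : SimpleGraph V) (U : Set V) (P : Finset (Flag G)) :
    Prop := ∀ Y, E.Closed T Y → #(act T U Y) ≤ 2 * #(P ∩ Y)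

variable {E : Embedding G} {T : SimpleGraph V} {z : Sym2 V → ℝ} {U : Set V}

theorem le_addEdge (T : SimpleGraph V) (x : Flag G) : T ≤ addEdge T x := le_sup_left

theorem addEdge_adj {x y : Flag G} : (addEdge T x).Adj y.1.fst y.1.snd ↔
    T.Adj y.1.fst y.1.snd ∨ y.1.edge = x.1.edge := by
  have := y.1.fst_ne_snd
  simp only [addEdge, SimpleGraph.sup_adj, SimpleGraph.edge_adj, SimpleGraph.Dart.edge,
    Sym2.eq_iff]
  tauto

theorem eq_of_edge_eq_of_lt {x y : Flag G} (hx : x.1.fst < x.1.snd) (hy : y.1.fst < y.1.snd)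
    (h : y.1.edge = x.1.edge) : y = x ∨ y = cross x := by
  rcases (SimpleGraph.dart_edge_eq_iff _ _).1 h with h | h
  · exact flag_eq_or_cross h
  · rw [h] at hy
    exact absurd hx hy.not_gt

theorem reachable_addEdge {x y : Flag G} (h : Par T x y) :
    (addEdge T x).Reachable y.1.fst y.1.snd := by
  have hx : (addEdge T x).Reachable x.1.fst x.1.snd :=
    (addEdge_adj.2 (Or.inr rfl)).reachable
  rcases h with ⟨h1, h2⟩ | ⟨h1, h2⟩
  · exact ((h1.mono (le_addEdge T x)).symm.trans hx).trans (h2.mono (le_addEdge T x))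
  · exact ((h2.mono (le_addEdge T x)).symm.trans hx.symm).trans (h1.mono (le_addEdge T x))

theorem IsLoop.addEdge {x : Flag G} (hx : x ∈ ends G T) {d : G.Dart} (h : IsLoop T d) :
    IsLoop (addEdge T x) d := by
  refine ⟨fun h' => ?_, h.2.mono (le_addEdge T x)⟩
  rcases (addEdge_adj (y := (d, true))).1 h' with h' | h'
  · exact h.1 h'
  · rcases (SimpleGraph.dart_edge_eq_iff _ _).1 h' with rfl | h'
    · exact (mem_ends.1 hx).2 h.2
    · have h2 := h.2
      dsimp only at h'
      rw [h'] at h2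
      exact (mem_ends.1 hx).2 h2.symm

theorem Embedding.Closed.of_addEdge {x : Flag G} (hx : x ∈ ends G T) {Y : Finset (Flag G)}
    (hY : E.Closed (addEdge T x) Y) : E.Closed T Y :=
  ⟨hY.1, fun y hy h => hY.2 y hy (h.addEdge hx)⟩

/-- The edges of a hair are parallel to its first edge. Once that edge is in the forest all the
others are loops, and a closed set extends across them. -/
theorem hair_subset_closed {x p : Flag G} (hp : p ∈ ends G T) (hpx : p.1 = x.1)
    {Y : Finset (Flag G)} (hY : E.Closed (addEdge T x) Y) (hpY : p ∈ Y) : E.hair T p ⊆ Y := by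
  have hx : x ∈ ends G T := by
    rw [mem_ends] at hp ⊢
    rwa [← hpx]
  intro y hy
  refine hair_induction (E := E) (T := T) (· ∈ Y) hpY (fun y _ h => ?_) (fun y hy hne h => ?_) hy
  · exact ((hY.of_addEdge hx).mem_iff_of_cl_eq (cl_mate y)).2 h
  · refine hY.2 _ h ⟨fun hadj => ?_, reachable_addEdge ?_⟩
    · rcases addEdge_adj.1 hadj with h' | h'
      · exact (mem_ends.1 (hair_subset _ hy)).2 h'.reachable
      · rcases eq_of_edge_eq_of_lt (mem_ends.1 hx).1 (mem_ends.1 (hair_subset _ hy)).1 h' with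
          rfl | rfl
        · exact hne hpx.symm
        · exact hne hpx.symm
    · have := par_of_mem_hair hy
      simpa only [Par, hpx] using this

/-- On the side of `x` the set of edges leaving `U` deviates at `y` from the chain of
parallel edges. -/
def Embedding.Deviates (E : Embedding G) (T : SimpleGraph V) (U : Set V) (x y : Flag G) : Prop :=
  y ∈ E.hair T x ∧ Cuts U y ∧ ¬ Cuts U (E.mate T y)

theorem exists_deviates {x : Flag G} (hc : Cuts U x)
    (h : ¬ ∀ y ∈ E.hair T x, Cuts U y) : ∃ y, E.Deviates T U x y := by
  by_contra hno
  refine h fun y hy => hair_induction (E := E) (T := T) (Cuts U) hc ?_ ?_ hy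
  · intro y hy hcy
    by_contra hm
    exact hno ⟨y, hy, hcy, hm⟩
  · exact fun y _ _ hcy => hcy

theorem Embedding.Deviates.deg {x y : Flag G} (h : E.Deviates T U x y) : E.deg T y = 2 := by
  refine mate_ne_iff.1 fun h' => h.2.2 ?_
  rw [h']
  exact h.2.1

/-- A face of degree two carries at most one deviation, since the mate of a deviating side does not
leave `U`. -/
theorem Embedding.Deviates.eq_of_cl_eq {x y x' y' : Flag G} (h : E.Deviates T U x y)
    (h' : E.Deviates T U x' y') (hcl : E.cl T y' = E.cl T y) : y' = y := by
  rcases eq_or_eq_mate (hair_subset _ h.1) (hair_subset _ h'.1) hcl h.deg with e | e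
  · exact e
  · exact absurd (e ▸ h'.2.1) h.2.2

/-- Exactly one of the two edges of this face leaves `U`, so evenness forces an odd number of sides
of forest edges leaving `U` on it. This is the source of the slack in the payment scheme. -/
theorem Embedding.Deviates.odd {x y : Flag G} (h : E.Deviates T U x y) :
    Odd (#(act T U (E.cls T y))) := by
  have h1 := (closed_cls (E := E) (T := T) y).even_cuts U
  have h2 : {w ∈ ends G T | w ∈ E.cls T y ∧ Cuts U w} = {y} := by
    ext w
    rw [mem_filter, mem_cls, mem_singleton]
    constructor
    · rintro ⟨hw, hcl, hc⟩
      rcases eq_or_eq_mate (hair_subset _ h.1) hw hcl h.deg with e | e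
      · exact e
      · exact absurd (e ▸ hc) h.2.2
    · rintro rfl
      exact ⟨hair_subset _ h.1, rfl, h.2.1⟩
  rw [h2, card_singleton] at h1
  unfold act
  exact Nat.not_even_iff_odd.1 fun h3 => by
    rw [Nat.even_add] at h1
    simpa using h1.1 h3

/-- If the chain is not a ring, the hairs on the two sides share no flag, and each supplies a
deviation. On a ring, `cross` pairs the flags of the hair that leave `U`, while with a single
deviation `y` the map `mate` would pair all of them except `y`; the two parities contradict each
other. -/
theorem exists_two_deviates {x : Flag G} (hx : x ∈ ends G T) (hc : Cuts U x)
    (h1 : ¬ ∀ y ∈ E.hair T x, Cuts U y) (h2 : ¬ ∀ y ∈ E.hair T (cross x), Cuts U y) :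
    ∃ y y', E.Deviates T U x y ∧ (E.Deviates T U (cross x) y' ∨ E.Deviates T U x y') ∧
      E.cl T y ≠ E.cl T y' := by
  obtain ⟨y, hy⟩ := exists_deviates hc h1
  by_cases hcirc : cross x ∈ E.hair T x
  · by_contra! hno
    have hone : ∀ w, E.Deviates T U x w → w = y := fun w hw =>
      hy.eq_of_cl_eq hw (hno y w hy (Or.inr hw)).symm
    have e1 : Even (#{w ∈ E.hair T x | Cuts U w}) := by
      refine even_card_of_involution _ cross ?_ (fun x _ => cross_cross x)
        (fun x _ => cross_ne x)
      intro w hw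
      rw [mem_filter] at hw ⊢
      refine ⟨?_, hw.2⟩
      by_cases hwx : w.1 = x.1
      · rcases flag_eq_or_cross hwx with rfl | rfl
        · exact hcirc
        · rw [cross_cross]
          exact self_mem_hair hx
      · exact cross_mem_hair hw.1 hwx
    have e2 : Even (#({w ∈ E.hair T x | Cuts U w}.erase y)) := by
      refine even_card_of_involution _ (E.mate T) ?_ ?_ ?_
      · intro w hw
        rw [mem_erase, mem_filter] at hw ⊢
        have hcm : Cuts U (E.mate T w) := by
          by_contra hcm
          exact hw.1 (hone w ⟨hw.2.1, hw.2.2, hcm⟩)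
        refine ⟨?_, mate_mem_hair hw.2.1, hcm⟩
        rintro rfl
        have := hy.2.2
        rw [mate_mate (hair_subset _ hw.2.1)] at this
        exact this hw.2.2
      · intro w hw
        rw [mem_erase, mem_filter] at hw
        exact mate_mate (hair_subset _ hw.2.1)
      · intro w hw
        rw [mem_erase, mem_filter] at hw
        exact mate_ne_of_cross_mem_hair hx hcirc hw.2.1
    rw [← card_erase_add_one (a := y) (by rw [mem_filter]; exact ⟨hy.1, hy.2.1⟩),
      Nat.even_add] at e1
    simpa using e1.1 e2
  · obtain ⟨y', hy'⟩ := exists_deviates (cuts_cross.2 hc) h2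
    refine ⟨y, y', hy, Or.inl hy', fun h => hcirc ?_⟩
    have := hy.eq_of_cl_eq hy' h.symm
    rw [this] at hy'
    exact cross_mem_hair_of_mem hy.1 hy'.1 hx

/-- On a face with an odd number of active sides the even bound is not attained. The marked faces
are split off `Y` one by one, and each contributes a slack of one. -/
theorem Embedding.Pays.add_card_le {P : Finset (Flag G)} (hP : E.Pays T U P)
    (S : Finset (Flag G)) : ∀ Y, E.Closed T Y →
      (∀ y ∈ S, y ∈ Y ∧ Odd (#(act T U (E.cls T y)))) →
      (∀ y ∈ S, ∀ y' ∈ S, E.cl T y = E.cl T y' → y = y') →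
      #(act T U Y) + #S ≤ 2 * #(P ∩ Y) := by
  induction S using Finset.induction_on with
  | empty => exact fun Y hY _ _ => by simpa using hP Y hY
  | insert s S hs ih =>
    intro Y hY hS hinj
    have hcl := closed_cls (E := E) (T := T) s
    have h1 := ih (Y ∩ (E.cls T s)ᶜ) (hY.inter hcl.compl) ?_
      (fun y hy y' hy' => hinj y (mem_insert_of_mem hy) y' (mem_insert_of_mem hy'))
    · have h2 := hP _ hcl
      have hodd := (hS s (mem_insert_self _ _)).2
      have hsub : E.cls T s ⊆ Y := fun w hw =>
        (hY.mem_iff_of_cl_eq (mem_cls.1 hw)).2 (hS s (mem_insert_self _ _)).1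
      have h3 : #(act T U Y) =
          #(act T U (Y ∩ (E.cls T s)ᶜ)) + #(act T U (E.cls T s)) := by
        rw [← card_union_of_disjoint]
        · congr 1
          ext w
          simp only [act, mem_union, mem_filter, mem_inter, mem_compl]
          have := @hsub w
          tauto
        · rw [disjoint_left]
          intro w hw hw'
          simp only [act, mem_filter, mem_inter, mem_compl] at hw hw'
          exact hw.1.2 hw'.1
      have h4 : #(P ∩ Y) = #(P ∩ (Y ∩ (E.cls T s)ᶜ)) + #(P ∩ E.cls T s) := by
        rw [← card_union_of_disjoint]
        · congr 1
          ext w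
          simp only [mem_union, mem_inter, mem_compl]
          have := @hsub w
          tauto
        · rw [disjoint_left]
          intro w hw hw'
          simp only [mem_inter, mem_compl] at hw hw'
          exact hw.2.2 hw'.2
      rw [card_insert_of_notMem hs]
      obtain ⟨k, hk⟩ := hodd
      omega
    · intro y hy
      have := hS y (mem_insert_of_mem hy)
      refine ⟨mem_inter.2 ⟨this.1, mem_compl.2 fun h => hs ?_⟩, this.2⟩
      rw [← hinj y (mem_insert_of_mem hy) s (mem_insert_self _ _) (mem_cls.1 h)]
      exact hy

theorem card_act_addEdge {x : Flag G} (hx : x ∈ ends G T) (hc : Cuts U x) (Y : Finset (Flag G)) :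
    #(act (addEdge T x) U Y) = #(act T U Y) + #({x, cross x} ∩ Y) := by
  rw [← card_union_of_disjoint]
  · congr 1
    ext y
    simp only [act, mem_union, mem_filter, mem_inter, mem_insert, mem_singleton]
    have h1 := addEdge_adj (T := T) (x := x) (y := y)
    have hxl := (mem_ends.1 hx).1
    constructor
    · rintro ⟨hy, hlt, hadj, hcy⟩
      rcases h1.1 hadj with h | h
      · exact Or.inl ⟨hy, hlt, h, hcy⟩
      · exact Or.inr ⟨eq_of_edge_eq_of_lt hxl hlt h, hy⟩
    · rintro (⟨hy, hlt, hadj, hcy⟩ | ⟨rfl | rfl, hy⟩)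
      · exact ⟨hy, hlt, h1.2 (Or.inl hadj), hcy⟩
      · exact ⟨hy, hxl, h1.2 (Or.inr rfl), hc⟩
      · exact ⟨hy, hxl, h1.2 (Or.inr rfl), hc⟩
  · rw [disjoint_left]
    intro y hy hy'
    simp only [act, mem_filter, mem_inter, mem_insert, mem_singleton] at hy hy'
    have := (mem_ends.1 hx).2
    rcases hy'.1 with rfl | rfl <;> exact this hy.2.2.1.reachable

theorem act_addEdge_of_not_cuts {x : Flag G} (hx : x ∈ ends G T) (hc : ¬ Cuts U x)
    (Y : Finset (Flag G)) : act (addEdge T x) U Y = act T U Y := by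
  ext y
  simp only [act, mem_filter]
  have h1 := addEdge_adj (T := T) (x := x) (y := y)
  constructor
  · rintro ⟨hy, hlt, hadj, hcy⟩
    rcases h1.1 hadj with h | h
    · exact ⟨hy, hlt, h, hcy⟩
    · rcases eq_of_edge_eq_of_lt (mem_ends.1 hx).1 hlt h with rfl | rfl <;> exact absurd hcy hc
  · rintro ⟨hy, hlt, hadj, hcy⟩
    exact ⟨hy, hlt, h1.2 (Or.inl hadj), hcy⟩

/-- The sides of the edge of `x` on which the chain of parallel edges leaves `U`
completely. -/
noncomputable def Embedding.paid (E : Embedding G) (T : SimpleGraph V) (U : Set V) (x : Flag G) :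
    Finset (Flag G) := {p ∈ {x, cross x} | ∀ y ∈ E.hair T p, Cuts U y}

/-- Only sides whose whole hair leaves `U` enter `P`. Each of the others has an odd face on its
hair, and `hair_subset_closed` puts this face into every closed set that contains the side, where
its slack absorbs the side. -/
theorem Embedding.Pays.addEdge {P : Finset (Flag G)} (hP : E.Pays T U P)
    (hPT : ∀ p ∈ P, T.Reachable p.1.fst p.1.snd) {x : Flag G} (hx : x ∈ ends G T)
    (hc : Cuts U x) : E.Pays (addEdge T x) U (P ∪ E.paid T U x) := by
  intro Y hY
  have hYT := hY.of_addEdge hx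
  have hx' := cross_mem_ends.2 hx
  rw [card_act_addEdge hx hc]
  have hdisj : Disjoint (P ∩ Y) (E.paid T U x ∩ Y) := by
    rw [disjoint_left]
    intro p hp hp'
    simp only [Embedding.paid, mem_filter, mem_inter, mem_insert, mem_singleton] at hp hp'
    have h1 := hPT p hp.1
    rcases hp'.1.1 with rfl | rfl <;> exact (mem_ends.1 hx).2 h1
  rw [union_inter_distrib_right, card_union_of_disjoint hdisj]
  have hsplit : #({x, cross x} ∩ Y) = #(E.paid T U x ∩ Y) +
      #({p ∈ ({x, cross x} : Finset (Flag G)) | ¬ ∀ y ∈ E.hair T p, Cuts U y} ∩ Y) := by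
    rw [← card_union_of_disjoint]
    · congr 1
      ext p
      simp only [Embedding.paid, mem_union, mem_filter, mem_inter]
      tauto
    · rw [disjoint_left]
      intro p hp hp'
      simp only [Embedding.paid, mem_filter, mem_inter] at hp hp'
      exact hp'.1.2 hp.1.2
  -- The sides of the new edge in `Y` that have to be absorbed by slack.
  set N := {p ∈ ({x, cross x} : Finset (Flag G)) | ¬ ∀ y ∈ E.hair T p, Cuts U y} ∩ Y with hN
  have hNmem : ∀ p, p ∈ N ↔ (p = x ∨ p = cross x) ∧ (¬ ∀ y ∈ E.hair T p, Cuts U y) ∧ p ∈ Y := by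
    intro p
    simp only [hN, mem_inter, mem_filter, mem_insert, mem_singleton, and_assoc]
  have hdev : ∀ p y, (p = x ∨ p = cross x) → p ∈ Y → E.Deviates T U p y →
      y ∈ Y ∧ Odd (#(act T U (E.cls T y))) := by
    intro p y hp hpY h
    refine ⟨?_, h.odd⟩
    rcases hp with rfl | rfl
    · exact hair_subset_closed hx rfl hY hpY h.1
    · exact hair_subset_closed hx' rfl hY hpY h.1
  have key : #(act T U Y) + #N ≤ 2 * #(P ∩ Y) := by
    by_cases hboth : x ∈ N ∧ cross x ∈ N
    · have hN2 : #N ≤ 2 := by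
        refine (card_le_card (t := {x, cross x}) fun p hp => ?_).trans card_le_two
        simpa using ((hNmem p).1 hp).1
      obtain ⟨y, y', h1, h2, hne⟩ := exists_two_deviates hx hc ((hNmem _).1 hboth.1).2.1
        ((hNmem _).1 hboth.2).2.1
      have hxY := ((hNmem _).1 hboth.1).2.2
      have hxY' := ((hNmem _).1 hboth.2).2.2
      have := hP.add_card_le {y, y'} Y hYT ?_ ?_
      · rw [card_pair (fun h => hne (by rw [h]))] at this
        omega
      · intro w hw
        rw [mem_insert, mem_singleton] at hw
        rcases hw with rfl | rfl
        · exact hdev x w (Or.inl rfl) hxY h1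
        · rcases h2 with h2 | h2
          · exact hdev _ w (Or.inr rfl) hxY' h2
          · exact hdev x w (Or.inl rfl) hxY h2
      · intro w hw w' hw' hcl
        rw [mem_insert, mem_singleton] at hw hw'
        rcases hw with rfl | rfl <;> rcases hw' with rfl | rfl
        exacts [rfl, absurd hcl hne, absurd hcl.symm hne, rfl]
    · by_cases hemp : N = ∅
      · rw [hemp, card_empty, add_zero]
        exact hP Y hYT
      · obtain ⟨p, hp⟩ := nonempty_iff_ne_empty.2 hemp
        have hN1 : #N ≤ 1 := by
          rw [card_le_one]
          intro a ha b hb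
          rcases ((hNmem a).1 ha).1 with rfl | rfl <;> rcases ((hNmem b).1 hb).1 with rfl | rfl
          exacts [rfl, absurd ⟨ha, hb⟩ hboth, absurd ⟨hb, ha⟩ hboth, rfl]
        have hp' := (hNmem p).1 hp
        have hcp : Cuts U p := by
          rcases hp'.1 with rfl | rfl
          exacts [hc, hc]
        obtain ⟨y, hy⟩ := exists_deviates hcp hp'.2.1
        have := hP.add_card_le {y} Y hYT ?_ ?_
        · rw [card_singleton] at this
          omega
        · intro w hw
          rw [mem_singleton] at hw
          subst hw
          exact hdev p w hp'.1 hp'.2.2 hy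
        · intro w hw w' hw' _
          rw [mem_singleton] at hw hw'
          rw [hw, hw']
  omega

theorem deadSum_mono (hz : ∀ e, 0 ≤ z e) {T' : SimpleGraph V} (h : T ≤ T') :
    deadSum G T z U ≤ deadSum G T' z U := by
  refine sum_le_sum_of_subset_of_nonneg (fun x hx => ?_) (fun _ _ _ => hz _)
  rw [mem_filter] at hx ⊢
  exact ⟨hx.1, hx.2.1, hx.2.2.1.mono h, hx.2.2.2⟩

/-- The edges of `T` leaving `U` are paid for by the weight of the edges leaving `U`. -/
def Embedding.ThinAt (E : Embedding G) (T : SimpleGraph V) (z : Sym2 V → ℝ) (U : Set V) : Prop :=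
  ∃ P : Finset (Flag G), (∀ p ∈ P, T.Reachable p.1.fst p.1.snd) ∧ E.Pays T U P ∧
    (#P : ℝ) ≤ 48 * deadSum G T z U

theorem thinAt_bot (hz : ∀ e, 0 ≤ z e) : E.ThinAt ⊥ z U := by
  refine ⟨∅, by simp, fun Y _ => ?_, ?_⟩
  · simp [act]
  · rw [card_empty, Nat.cast_zero]
    exact mul_nonneg (by norm_num) (sum_nonneg fun _ _ => hz _)

/-- At most two sides enter `P`. If any does, its hair, of weight at least 1/24, moves inside a
component, and `48 / 24 = 2` covers both sides. -/
theorem Embedding.ThinAt.addEdge (h : E.ThinAt T z U) (hz : ∀ e, 0 ≤ z e) {x : Flag G}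
    (hx : E.Middle T z x) : E.ThinAt (addEdge T x) z U := by
  obtain ⟨P, hPT, hP, hcard⟩ := h
  obtain ⟨hxe, hw, hw'⟩ := hx
  have hle := le_addEdge T x
  by_cases hc : Cuts U x
  · refine ⟨P ∪ E.paid T U x, ?_, hP.addEdge hPT hxe hc, ?_⟩
    · intro p hp
      rw [mem_union] at hp
      rcases hp with hp | hp
      · exact (hPT p hp).mono hle
      · simp only [Embedding.paid, mem_filter, mem_insert, mem_singleton] at hp
        rcases hp.1 with rfl | rfl
        · exact reachable_addEdge (Par.refl _)
        · exact reachable_addEdge (par_cross _)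
    · by_cases hp : (E.paid T U x).Nonempty
      · obtain ⟨p, hp⟩ := hp
        have hp2 : #(E.paid T U x) ≤ 2 :=
          (card_le_card (filter_subset _ _)).trans card_le_two
        have hu : (#(P ∪ E.paid T U x) : ℝ) ≤ #P + 2 := by
          exact_mod_cast (card_union_le _ _).trans (by omega)
        simp only [Embedding.paid, mem_filter, mem_insert, mem_singleton] at hp
        have hwp : 1 ≤ 24 * E.hairWeight T z p := by
          rcases hp.1 with rfl | rfl
          exacts [hw, hw']
        have hpar : ∀ y ∈ E.hair T p, Par T x y := by
          intro y hy
          rcases hp.1 with rfl | rfl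
          · exact par_of_mem_hair hy
          · exact (par_cross x).trans (par_of_mem_hair hy)
        have hsum : deadSum G T z U + E.hairWeight T z p ≤ deadSum G (ThinForest.addEdge T x) z U := by
          unfold deadSum Embedding.hairWeight
          rw [← sum_union]
          · refine sum_le_sum_of_subset_of_nonneg (fun y hy => ?_) (fun _ _ _ => hz _)
            rw [mem_union] at hy
            rw [mem_filter]
            rcases hy with hy | hy
            · rw [mem_filter] at hy
              exact ⟨hy.1, hy.2.1, hy.2.2.1.mono hle, hy.2.2.2⟩
            · exact ⟨mem_univ _, (mem_ends.1 (hair_subset _ hy)).1,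
                reachable_addEdge (hpar y hy), hp.2 y hy⟩
          · rw [disjoint_left]
            intro y hy hy'
            rw [mem_filter] at hy
            exact (mem_ends.1 (hair_subset _ hy')).2 hy.2.2.1
        linarith
      · rw [not_nonempty_iff_eq_empty.1 hp, union_empty]
        exact hcard.trans (mul_le_mul_of_nonneg_left (deadSum_mono hz hle) (by norm_num))
  · refine ⟨P, fun p hp => (hPT p hp).mono hle, fun Y hY => ?_, ?_⟩
    · rw [act_addEdge_of_not_cuts hxe hc]
      exact hP Y (hY.of_addEdge hxe)
    · exact hcard.trans (mul_le_mul_of_nonneg_left (deadSum_mono hz hle) (by norm_num))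

end Thinness

end ThinForest

namespace ThinForest

/-! ### Euler's formula and the weight of light hairs. -/

section Counting

set_option linter.unusedSectionVars false

open Classical Finset

/-- Identifying two more points loses at most one class. Sending the merged class to that of `b`
leaves only the class of `a` uncovered, and `none` is mapped to it. -/
theorem card_quot_le_succ {α : Type*} [Finite α] (r : α → α → Prop) (a b : α) :
    Nat.card (Quot r) ≤ Nat.card (Quot fun x y => r x y ∨ (x = a ∧ y = b)) + 1 := by
  have hf : ∀ x y, (r x y ∨ (x = a ∧ y = b)) →
      (if Quot.mk r x = Quot.mk r a then Quot.mk r b else Quot.mk r x) =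
      if Quot.mk r y = Quot.mk r a then Quot.mk r b else Quot.mk r y := by
    rintro x y (h | ⟨rfl, rfl⟩)
    · rw [Quot.sound h]
    · by_cases h : Quot.mk r y = Quot.mk r x <;> simp [h]
  rw [← Finite.card_option]
  refine Nat.card_le_card_of_surjective
    (fun o => o.elim (Quot.mk r a) (Quot.lift _ hf)) ?_
  rintro ⟨x⟩
  by_cases h : Quot.mk r x = Quot.mk r a
  · exact ⟨none, h.symm⟩
  · exact ⟨some (Quot.mk _ x), by simp [h]⟩

theorem card_quot_le_add_card {α : Type*} [Finite α] (r : α → α → Prop) (S : Finset (α × α)) :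
    Nat.card (Quot r) ≤ Nat.card (Quot fun x y => r x y ∨ (x, y) ∈ S) + #S := by
  induction S using Finset.induction_on with
  | empty => simp
  | insert p S hp ih =>
    refine ih.trans ?_
    rw [card_insert_of_notMem hp]
    have h := card_quot_le_succ (fun x y => r x y ∨ (x, y) ∈ S) p.1 p.2
    have he : (fun x y => r x y ∨ (x, y) ∈ insert p S) =
        fun x y => (r x y ∨ (x, y) ∈ S) ∨ (x = p.1 ∧ y = p.2) := by
      funext x y
      simp only [mem_insert, Prod.ext_iff]
      apply propext
      tauto
    rw [he]
    omega

variable {V : Type*} [Fintype V] [LinearOrder V] {G : SimpleGraph V}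
variable {E : Embedding G} {T : SimpleGraph V} {z : Sym2 V → ℝ}

/-- Starting from isolated vertices, each edge of `T` lowers the number of components by at most
one. -/
theorem card_le_card_component (hTG : T ≤ G) : Fintype.card V ≤
    Nat.card T.ConnectedComponent +
      #{d : G.Dart | d.fst < d.snd ∧ T.Adj d.fst d.snd} := by
  set S : Finset (V × V) := ({d : G.Dart | d.fst < d.snd ∧ T.Adj d.fst d.snd} :
    Finset G.Dart).image fun d => d.toProd with hS
  have h1 := card_quot_le_add_card (fun _ _ : V => False) S
  have h2 : #S ≤ #{d : G.Dart | d.fst < d.snd ∧ T.Adj d.fst d.snd} := card_image_le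
  have h3 : Fintype.card V ≤ Nat.card (Quot fun _ _ : V => False) := by
    rw [← Nat.card_eq_fintype_card]
    refine Nat.card_le_card_of_injective (Quot.mk _) fun x y h => ?_
    have h' := Quot.eqvGen_exact h
    clear h
    induction h' with
    | rel _ _ h => exact h.elim
    | refl => rfl
    | symm _ _ h ih => exact ih.symm
    | trans _ _ _ h1 h2 ih1 ih2 => exact ih1.trans ih2
  have h4 : Nat.card (Quot fun x y : V => False ∨ (x, y) ∈ S) ≤
      Nat.card T.ConnectedComponent := by
    have hadj : ∀ u v, T.Adj u v → Quot.mk (fun x y : V => False ∨ (x, y) ∈ S) u =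
        Quot.mk (fun x y : V => False ∨ (x, y) ∈ S) v := by
      have key : ∀ u v, u < v → T.Adj u v → Quot.mk (fun x y : V => False ∨ (x, y) ∈ S) u =
          Quot.mk (fun x y : V => False ∨ (x, y) ∈ S) v := by
        intro u v hlt h
        refine Quot.sound (Or.inr ?_)
        rw [hS, mem_image]
        exact ⟨⟨(u, v), hTG h⟩, by simp [hlt, h], rfl⟩
      intro u v h
      rcases lt_or_gt_of_ne h.ne with hlt | hlt
      · exact key u v hlt h
      · exact (key v u hlt h.symm).symm
    have hre : ∀ u v, T.Reachable u v → Quot.mk (fun x y : V => False ∨ (x, y) ∈ S) u =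
        Quot.mk (fun x y : V => False ∨ (x, y) ∈ S) v := by
      rintro u v ⟨p⟩
      induction p with
      | nil => rfl
      | cons h p ih => exact (hadj _ _ h).trans ih
    refine Nat.card_le_card_of_surjective (Quot.lift (Quot.mk _) hre) ?_
    rintro ⟨x⟩
    exact ⟨Quot.mk _ x, rfl⟩
  omega

/-- Deleting a loop lowers the number of faces by at most one. `Merge` adds just one pair for each
loop, given by the increasing dart and the side `true`. -/
theorem card_face_le : Nat.card E.Face ≤ Nat.card (Quot (E.Merge T)) +
    #{d : G.Dart | d.fst < d.snd ∧ IsLoop T d} := by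
  set S : Finset (Flag G × Flag G) := ({d : G.Dart | d.fst < d.snd ∧ IsLoop T d} :
    Finset G.Dart).image fun d => ((d, true), (d, false)) with hS
  have h1 := card_quot_le_add_card E.Link S
  have h2 : #S ≤ #{d : G.Dart | d.fst < d.snd ∧ IsLoop T d} := card_image_le
  have h3 : (fun x y => E.Link x y ∨ (x, y) ∈ S) = E.Merge T := by
    funext x y
    apply propext
    unfold Embedding.Merge
    refine or_congr_right ?_
    rw [hS, mem_image]
    constructor
    · rintro ⟨d, hd, he⟩
      rw [Prod.ext_iff] at he
      obtain ⟨rfl, rfl⟩ := he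
      rw [mem_filter] at hd
      exact ⟨hd.2.2, hd.2.1, rfl, rfl⟩
    · rintro ⟨h1, h2, h3, rfl⟩
      obtain ⟨d, b⟩ := x
      dsimp only at h3
      subst h3
      exact ⟨d, by simp only [mem_filter, mem_univ, true_and]; exact ⟨h2, h1⟩, rfl⟩
  rw [h3] at h1
  unfold Embedding.Face
  omega

theorem ncard_edgeSet : G.edgeSet.ncard = #{d : G.Dart | d.fst < d.snd} := by
  have h : G.edgeSet = ↑(({d : G.Dart | d.fst < d.snd} : Finset G.Dart).image
      fun d => d.edge) := by
    ext e
    induction e with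
    | h u v =>
      simp only [coe_image, Set.mem_image, mem_coe, mem_filter, mem_univ, true_and]
      constructor
      · intro h
        have h : G.Adj u v := h
        rcases lt_or_gt_of_ne h.ne with hlt | hlt
        · exact ⟨⟨(u, v), h⟩, hlt, rfl⟩
        · exact ⟨⟨(v, u), h.symm⟩, hlt, Sym2.eq_swap⟩
      · rintro ⟨d, -, hd⟩
        rw [← hd]
        exact d.edge_mem
  rw [h, Set.ncard_coe_finset, card_image_of_injOn]
  intro d hd d' hd' he
  rw [mem_coe, mem_filter] at hd hd'
  rcases (SimpleGraph.dart_edge_eq_iff _ _).1 he with h | h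
  · exact h
  · rw [h] at hd
    exact absurd hd.2 (not_lt_of_gt hd'.2)

theorem card_ends : #(ends G T) =
    2 * #{d : G.Dart | d.fst < d.snd ∧ ¬ T.Reachable d.fst d.snd} := by
  have : ends G T = ({d : G.Dart | d.fst < d.snd ∧ ¬ T.Reachable d.fst d.snd} :
      Finset G.Dart) ×ˢ (univ : Finset Bool) := by
    ext x
    simp [mem_ends, mem_product]
  rw [this, card_product, mul_comm]
  simp

theorem ncard_edgeSet_eq : 2 * G.edgeSet.ncard =
    2 * #{d : G.Dart | d.fst < d.snd ∧ T.Adj d.fst d.snd} +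
    2 * #{d : G.Dart | d.fst < d.snd ∧ IsLoop T d} + #(ends G T) := by
  rw [card_ends, ncard_edgeSet, ← mul_add, ← mul_add]
  congr 1
  rw [← card_union_of_disjoint, ← card_union_of_disjoint]
  · congr 1
    ext d
    have : T.Adj d.fst d.snd → T.Reachable d.fst d.snd := fun h => h.reachable
    simp only [mem_union, mem_filter, mem_univ, true_and]
    unfold IsLoop
    tauto
  · rw [disjoint_left]
    intro d hd hd'
    simp only [mem_union, mem_filter, mem_univ, true_and] at hd hd'
    rcases hd with hd | hd
    · exact hd'.2 hd.2.reachable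
    · exact hd'.2 hd.2.2
  · rw [disjoint_left]
    intro d hd hd'
    simp only [mem_filter, mem_univ, true_and] at hd hd'
    exact hd'.2.1 hd.2

/-- A set of edge sides that is closed along chains of parallel edges and contains no end of a
chain is everything. -/
theorem eq_ends_of_closed (hG : G.Preconnected) (hT : T.IsAcyclic) {H : Finset (Flag G)}
    (hH : H ⊆ ends G T) (hne : H.Nonempty) (hm : ∀ x ∈ H, E.mate T x ∈ H)
    (hc : ∀ x ∈ H, cross x ∈ H) (hfix : ∀ x ∈ H, E.mate T x ≠ x) : H = ends G T := by
  -- A face meeting `H` has degree two, and `mate` exchanges its two sides. So the faces meeting `H`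
  -- have no other edge sides, and their union is closed under crossing every edge off the forest.
  have hends : ∀ w ∈ ends G T, (∃ y ∈ H, E.cl T w = E.cl T y) → w ∈ H := by
    rintro w hw ⟨y, hy, hwy⟩
    rcases eq_or_eq_mate (hH hy) hw hwy (mate_ne_iff.1 (hfix y hy)) with rfl | rfl
    exacts [hy, hm y hy]
  obtain ⟨x, hx⟩ := hne
  have huniv : ({w | ∃ y ∈ H, E.cl T w = E.cl T y} : Finset (Flag G)) = univ := by
    refine eq_univ_of_closed_off_forest (E := E) hG hT ⟨?_, ?_⟩ ?_ (x := x) ?_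
    · intro w hw
      simp only [mem_filter, mem_univ, true_and] at hw ⊢
      rwa [cl_corner]
    · intro w hw
      simp only [mem_filter, mem_univ, true_and] at hw ⊢
      rwa [cl_side]
    · intro w hw hadj
      simp only [mem_filter, mem_univ, true_and] at hw ⊢
      by_cases hr : T.Reachable w.1.fst w.1.snd
      · rwa [cl_cross ⟨hadj, hr⟩]
      · rcases lt_or_gt_of_ne w.1.fst_ne_snd with hlt | hlt
        · exact ⟨cross w, hc _ (hends w (mem_ends.2 ⟨hlt, hr⟩) hw), rfl⟩
        · refine ⟨cross (E.side w), hc _ (hends _ (mem_ends.2 ⟨hlt, fun h => hr h.symm⟩) ?_), ?_⟩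
          · rwa [cl_side]
          · rw [← E.side_cross, cl_side]
    · simp only [mem_filter, mem_univ, true_and]
      exact ⟨x, hx, rfl⟩
  refine hH.antisymm fun w hw => hends w hw ?_
  have := mem_univ w
  rw [← huniv] at this
  simpa using this

/-- The ends of the chains of parallel edges. -/
noncomputable def Embedding.branchEnds (E : Embedding G) (T : SimpleGraph V) : Finset (Flag G) :=
  {x ∈ ends G T | E.mate T x = x}

/-- A face without edge sides between components would be closed under crossing all edges off the
forest, and would be the whole surface. -/
theorem exists_end_cl (hG : G.Preconnected) (hT : T.IsAcyclic) (hne : (ends G T).Nonempty)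
    (w : Flag G) : ∃ y ∈ ends G T, E.cl T y = E.cl T w := by
  by_contra! hno
  have hcl := closed_cls (E := E) (T := T) w
  have : E.cls T w = univ := by
    refine eq_univ_of_closed_off_forest (E := E) hG hT hcl.1 ?_ (x := w) (mem_cls.2 rfl)
    intro y hy hadj
    by_cases hr : T.Reachable y.1.fst y.1.snd
    · exact hcl.2 y hy ⟨hadj, hr⟩
    · exfalso
      rw [mem_cls] at hy
      rcases lt_or_gt_of_ne y.1.fst_ne_snd with hlt | hlt
      · exact hno y (mem_ends.2 ⟨hlt, hr⟩) hy
      · exact hno (E.side y) (mem_ends.2 ⟨hlt, fun h => hr h.symm⟩) (by rw [cl_side, hy])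
  obtain ⟨y, hy⟩ := hne
  have hyw := mem_univ y
  rw [← this, mem_cls] at hyw
  exact hno y hy hyw

/-- This is summed over the faces. A face of degree two has no branch end and `6 = 3 · 2`; a face of
degree `d ≥ 3` has at most `d` of them, and `d + 6 ≤ 3d`. -/
theorem card_branchEnds_add_le (hG : G.Preconnected) (hT : T.IsAcyclic)
    (hne : (ends G T).Nonempty) :
    #(E.branchEnds T) + 6 * Nat.card (Quot (E.Merge T)) ≤ 3 * #(ends G T) := by
  have : Fintype (Quot (E.Merge T)) := Fintype.ofFinite _
  rw [Nat.card_eq_fintype_card, ← card_univ,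
    card_eq_sum_card_fiberwise (f := E.cl T) (s := E.branchEnds T) (t := univ)
      (fun _ _ => mem_univ _),
    card_eq_sum_card_fiberwise (f := E.cl T) (s := ends G T) (t := univ) (fun _ _ => mem_univ _),
    mul_sum, mul_comm, ← smul_eq_mul, ← sum_const, ← sum_add_distrib]
  refine sum_le_sum ?_
  rintro ⟨w⟩ -
  obtain ⟨y, hy, hyw⟩ := exists_end_cl (E := E) hG hT hne w
  have hw : Quot.mk (E.Merge T) w = E.cl T y := hyw.symm
  rw [hw]
  have h2 := two_le_deg (E := E) hy
  have h3 : #{x ∈ ends G T | E.cl T x = E.cl T y} = E.deg T y := rfl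
  rw [h3]
  by_cases hd : E.deg T y = 2
  · have : #{x ∈ E.branchEnds T | E.cl T x = E.cl T y} = 0 := by
      rw [card_eq_zero, filter_eq_empty_iff]
      intro x hx hcl
      rw [Embedding.branchEnds, mem_filter] at hx
      exact mate_ne_iff.2 ((deg_congr hcl).trans hd) hx.2
    omega
  · have : #{x ∈ E.branchEnds T | E.cl T x = E.cl T y} ≤ E.deg T y := by
      refine card_le_card fun x hx => ?_
      rw [Embedding.branchEnds, mem_filter, mem_filter] at hx
      rw [mem_filter]
      exact ⟨hx.1.1, hx.2⟩
    omega

/-- Let `k` be the number of components, `m` the number of edges between them and `g` the Euler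
genus. The bounds for contracting `T` and deleting loops leave at least `m - k + 2 - g` faces. Since
`ends G T` has `2m` elements, the preceding count gives the claim. -/
theorem card_branchEnds_le (hG : G.Preconnected) (hTG : T ≤ G) (hT : T.IsAcyclic)
    (hne : (ends G T).Nonempty) : (#(E.branchEnds T) : ℤ) ≤
      6 * (Nat.card T.ConnectedComponent + E.eulerGenus - 2) := by
  have h1 := card_branchEnds_add_le (E := E) hG hT hne
  have h2 := card_face_le (E := E) (T := T)
  have h3 := card_le_card_component hTG
  have h4 := ncard_edgeSet_eq (G := G) (T := T)
  have h5 : E.numFaces = Nat.card E.Face := by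
    unfold Embedding.numFaces
    obtain ⟨x, -⟩ := hne
    rw [if_neg (fun h => h.elim x.1)]
  unfold Embedding.eulerGenus
  rw [h5, Nat.card_eq_fintype_card (α := V)]
  omega

/-- Without a branch end, `mate` pairs the flags of the hair. If `cross x` were missing, `cross`
would pair all of them but `x`, so it is present. The hair is then closed under both maps and
consists of all edge sides, against the weight assumption. -/
theorem exists_branchEnd_mem_hair (hG : G.Preconnected) (hT : T.IsAcyclic) {x : Flag G}
    (hx : x ∈ ends G T) (hlt : E.hairWeight T z x < ∑ y ∈ ends G T, z y.1.edge) :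
    ∃ b ∈ E.branchEnds T, b ∈ E.hair T x := by
  by_contra! hno
  have hfix : ∀ y ∈ E.hair T x, E.mate T y ≠ y := fun y hy h =>
    hno y (mem_filter.2 ⟨hair_subset _ hy, h⟩) hy
  have e1 : Even (#(E.hair T x)) :=
    even_card_of_involution _ (E.mate T) (fun y hy => mate_mem_hair hy)
      (fun y hy => mate_mate (hair_subset _ hy)) hfix
  have hcross : cross x ∈ E.hair T x := by
    by_contra hcx
    have e2 : Even (#((E.hair T x).erase x)) := by
      refine even_card_of_involution _ cross ?_ (fun x _ => cross_cross x) (fun x _ => cross_ne x)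
      intro y hy
      rw [mem_erase] at hy ⊢
      have hyx : y.1 ≠ x.1 := by
        intro h
        rcases flag_eq_or_cross h with rfl | rfl
        · exact hy.1 rfl
        · exact hcx hy.2
      exact ⟨fun h => hyx (by rw [← h]; rfl), cross_mem_hair hy.2 hyx⟩
    rw [← card_erase_add_one (self_mem_hair hx), Nat.even_add] at e1
    simpa using e1.1 e2
  have h := eq_ends_of_closed hG hT (hair_subset x) ⟨x, self_mem_hair hx⟩
    (fun y hy => mate_mem_hair hy) (fun y hy => ?_) hfix
  · unfold Embedding.hairWeight at hlt
    rw [h] at hlt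
    exact lt_irrefl _ hlt
  · by_cases hyx : y.1 = x.1
    · rcases flag_eq_or_cross hyx with rfl | rfl
      · exact hcross
      · rw [cross_cross]
        exact self_mem_hair hx
    · exact cross_mem_hair hy hyx

/-- The starting sides of all light hairs containing `b` lie on the largest of these hairs, whose
weight is below 1/24. -/
theorem sum_light_at_le (hz : ∀ e, 0 ≤ z e) (b : Flag G) :
    ∑ x ∈ ends G T with 24 * E.hairWeight T z x < 1 ∧ b ∈ E.hair T x, z x.1.edge ≤ 1 / 24 := by
  set L : Finset (Flag G) := {x ∈ ends G T | 24 * E.hairWeight T z x < 1 ∧ b ∈ E.hair T x} with hL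
  rcases L.eq_empty_or_nonempty with h | h
  · rw [h, sum_empty]
    norm_num
  · obtain ⟨w, hw, hmax⟩ := exists_max_image L (fun x => #(E.hair T x)) h
    have hwL := hw
    rw [hL, mem_filter] at hwL
    have hsub : L ⊆ E.hair T w := by
      intro x hx
      have hxL := hx
      rw [hL, mem_filter] at hxL
      by_contra hxw
      have hxw' : x.1 ≠ w.1 := by
        intro h
        rcases flag_eq_or_cross h with rfl | rfl
        · exact hxw (self_mem_hair hwL.1)
        · exact hxw (cross_mem_hair_of_mem hwL.2.2 hxL.2.2 hwL.1)
      have hcx : cross x ∉ E.hair T w := fun h => hxw (by simpa using cross_mem_hair h hxw')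
      have hne : ∀ y ∈ E.hair T w, y.1 ≠ x.1 := by
        intro y hy h
        rcases flag_eq_or_cross h with rfl | rfl
        exacts [hxw hy, hcx hy]
      -- The hair of `w` does not meet the edge of `x`, so all its steps are permitted in the hair
      -- of `x` too.
      have hgen : ∀ y ∈ E.hair T w, Relation.EqvGen (E.HairStep T x.1) w y := by
        intro y hy
        refine hair_induction (E := E) (T := T) (Relation.EqvGen (E.HairStep T x.1) w)
          (.refl _) ?_ ?_ hy
        · intro y hy h
          by_cases hm : E.mate T y = y
          · rwa [hm]
          · exact h.trans _ _ _ (.rel _ _ ⟨hair_subset _ hy, mate_mem_ends (hair_subset _ hy),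
              Or.inl ⟨(cl_mate y).symm, mate_ne_iff.1 hm⟩⟩)
        · intro y hy _ h
          exact h.trans _ _ _ (.rel _ _ ⟨hair_subset _ hy, cross_mem_ends.2 (hair_subset _ hy),
              Or.inr ⟨rfl, hne y hy⟩⟩)
      have hxw2 : Relation.EqvGen (E.HairStep T x.1) x w := by
        have := hxL.2.2
        rw [Embedding.hair, mem_filter] at this
        exact this.2.trans _ _ _ ((hgen b hwL.2.2).symm _ _)
      have hss : E.hair T w ⊂ E.hair T x := by
        refine Finset.ssubset_iff_subset_ne.2 ⟨fun y hy => ?_, fun h => hxw ?_⟩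
        · rw [Embedding.hair, mem_filter]
          exact ⟨hair_subset _ hy, hxw2.trans _ _ _ (hgen y hy)⟩
        · rw [h]
          exact self_mem_hair hxL.1
      exact absurd (card_lt_card hss) (not_lt.2 (hmax x hx))
    have h1 : ∑ x ∈ L, z x.1.edge ≤ E.hairWeight T z w :=
      sum_le_sum_of_subset_of_nonneg hsub fun _ _ _ => hz _
    have h2 := hwL.2.1
    linarith

/-- As the total weight is at least 1, a light hair is not everything and contains a branch end. The
light sides are distributed among the branch ends, each of which receives at most 1/24. -/
theorem sum_light_le (hG : G.Preconnected) (hT : T.IsAcyclic) (hz : ∀ e, 0 ≤ z e)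
    (hZ : 1 ≤ ∑ y ∈ ends G T, z y.1.edge) :
    ∑ x ∈ ends G T with 24 * E.hairWeight T z x < 1, z x.1.edge ≤ #(E.branchEnds T) / 24 := by
  set L : Finset (Flag G) := {x ∈ ends G T | 24 * E.hairWeight T z x < 1} with hL
  have h1 : ∑ x ∈ L, z x.1.edge ≤
      ∑ x ∈ L, ∑ b ∈ E.branchEnds T, if b ∈ E.hair T x then z x.1.edge else 0 := by
    refine sum_le_sum fun x hx => ?_
    rw [hL, mem_filter] at hx
    obtain ⟨b, hb, hbx⟩ := exists_branchEnd_mem_hair (z := z) hG hT hx.1 (by linarith [hx.2])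
    refine le_trans (by rw [if_pos hbx]) (single_le_sum (f := fun b =>
      if b ∈ E.hair T x then z x.1.edge else 0) (fun b _ => ?_) hb)
    split_ifs
    exacts [hz _, le_rfl]
  rw [sum_comm] at h1
  refine h1.trans ((sum_le_sum (g := fun _ => 1 / 24) fun b _ => ?_).trans (le_of_eq ?_))
  · rw [← sum_filter, hL, filter_filter]
    exact sum_light_at_le hz b
  · rw [sum_const, nsmul_eq_mul]
    ring

end Counting

end ThinForest

namespace ThinForest

/-! ### Existence of a candidate, and the invariant of the rounds. -/

section Existence

set_option linter.unusedSectionVars false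

open Classical Finset

variable {V : Type*} [Fintype V] [LinearOrder V] {G : SimpleGraph V}
variable {E : Embedding G} {T : SimpleGraph V} {z κ : Sym2 V → ℝ}

/-- An edge fails to be middle only if one of its two sides starts a light hair. Counting the light
sides together with their opposites doubles the bound. -/
theorem sum_not_middle_le (hG : G.Preconnected) (hT : T.IsAcyclic) (hz : ∀ e, 0 ≤ z e)
    (hZ : 1 ≤ ∑ y ∈ ends G T, z y.1.edge) :
    ∑ x ∈ ends G T with ¬ E.Middle T z x, z x.1.edge ≤ #(E.branchEnds T) / 12 := by
  have h1 := sum_light_le (E := E) hG hT hz hZ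
  set L : Finset (Flag G) := {x ∈ ends G T | 24 * E.hairWeight T z x < 1} with hL
  have h2 : ∑ x ∈ L.image cross, z x.1.edge = ∑ x ∈ L, z x.1.edge :=
    sum_image fun x _ y _ h => by simpa using congrArg cross h
  have h3 : ({x ∈ ends G T | ¬ E.Middle T z x} : Finset (Flag G)) ⊆ L ∪ L.image cross := by
    intro x hx
    rw [mem_filter] at hx
    rw [mem_union]
    by_cases hw : 1 ≤ 24 * E.hairWeight T z x
    · refine Or.inr (mem_image.2 ⟨cross x, ?_, cross_cross x⟩)
      rw [hL, mem_filter]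
      exact ⟨cross_mem_ends.2 hx.1, not_le.1 fun h => hx.2 ⟨hx.1, hw, h⟩⟩
    · exact Or.inl (mem_filter.2 ⟨hx.1, not_le.1 hw⟩)
  have h4 := sum_le_sum_of_subset_of_nonneg (f := fun x : Flag G => z x.1.edge) h3
    fun _ _ _ => hz _
  have h5 := sum_union_inter (s₁ := L) (s₂ := L.image cross) (f := fun x : Flag G => z x.1.edge)
  have h6 : 0 ≤ ∑ x ∈ L ∩ L.image cross, z x.1.edge := sum_nonneg fun _ _ => hz _
  linarith

/-- Joining the same components of `T` is an equivalence relation. -/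
def parSetoid (G : SimpleGraph V) (T : SimpleGraph V) : Setoid (Flag G) :=
  ⟨Par T, Par.refl, Par.symm, Par.trans⟩

/-- A class of parallel edges is closed under `mate` and `cross`, so it contains a branch end unless
it is everything (`eq_ends_of_closed`). -/
theorem card_parClasses_le (E : Embedding G) (hG : G.Preconnected) (hT : T.IsAcyclic) :
    #((ends G T).image (Quotient.mk (parSetoid G T))) ≤ max 1 (#(E.branchEnds T)) := by
  by_cases h : ∃ x ∈ ends G T, ∀ y ∈ ends G T, Par T x y → E.mate T y ≠ y
  · obtain ⟨x, hx, hfix⟩ := h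
    have hH := eq_ends_of_closed (E := E) hG hT (H := {y ∈ ends G T | Par T x y})
      (filter_subset _ _) ⟨x, mem_filter.2 ⟨hx, Par.refl x⟩⟩
      (fun y hy => ?_) (fun y hy => ?_) (fun y hy => ?_)
    · refine le_max_of_le_left (card_le_one.2 ?_)
      have key : ∀ a ∈ (ends G T).image (Quotient.mk (parSetoid G T)),
          a = Quotient.mk (parSetoid G T) x := by
        intro a ha
        obtain ⟨y, hy, rfl⟩ := mem_image.1 ha
        rw [← hH, mem_filter] at hy
        exact (Quotient.sound (s := parSetoid G T) hy.2).symm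
      intro a ha b hb
      rw [key a ha, key b hb]
    · rw [mem_filter] at hy ⊢
      exact ⟨mate_mem_ends hy.1, hy.2.trans (par_mate hy.1)⟩
    · rw [mem_filter] at hy ⊢
      exact ⟨cross_mem_ends.2 hy.1, hy.2.trans (par_cross y)⟩
    · rw [mem_filter] at hy
      exact hfix y hy.1 hy.2
  · push Not at h
    refine le_max_of_le_right ((card_le_card fun a ha => ?_).trans
      (card_image_le (s := E.branchEnds T) (f := Quotient.mk (parSetoid G T))))
    obtain ⟨x, hx, rfl⟩ := mem_image.1 ha
    obtain ⟨y, hy, hp, hm⟩ := h x hx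
    exact mem_image.2 ⟨y, mem_filter.2 ⟨hy, hm⟩,
      (Quotient.sound (s := parSetoid G T) hp).symm⟩

/-- If there were no candidate, each parallel class would contribute at most 1/12 in middle sides,
at most `k` altogether, where `k` is the number of components. The other sides weigh at most `(12k -
18)/12`, which is less than `k`, and the total would be below `2k`. -/
theorem exists_candidate (hG : G.Preconnected) (hTG : T ≤ G) (hT : T.IsAcyclic)
    (hz : ∀ e, 0 ≤ z e) (hk : 1 ≤ Nat.card T.ConnectedComponent)
    (hZ : 2 * (Nat.card T.ConnectedComponent : ℝ) ≤ ∑ y ∈ ends G T, z y.1.edge)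
    (hg : E.eulerGenus < Nat.card T.ConnectedComponent) : ∃ x, E.Candidate T z x := by
  by_contra! hno
  have hkR : (1 : ℝ) ≤ Nat.card T.ConnectedComponent := by exact_mod_cast hk
  have hne : (ends G T).Nonempty := by
    rw [nonempty_iff_ne_empty]
    intro h
    rw [h, sum_empty] at hZ
    linarith
  have h1 := sum_not_middle_le (E := E) hG hT hz (by linarith)
  have h2 := card_branchEnds_le (E := E) hG hTG hT hne
  have h3 := card_parClasses_le E hG hT
  have h4 := sum_filter_add_sum_filter_not (ends G T) (E.Middle T z) fun x => z x.1.edge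
  have h5 : ∑ x ∈ ends G T with E.Middle T z x, z x.1.edge ≤
      ∑ _a ∈ (ends G T).image (Quotient.mk (parSetoid G T)), (1 / 12 : ℝ) := by
    rw [← sum_fiberwise_of_maps_to (t := (ends G T).image (Quotient.mk (parSetoid G T)))
      (g := Quotient.mk (parSetoid G T))
      (fun x hx => mem_image_of_mem _ (mem_filter.1 hx).1)]
    refine sum_le_sum fun a ha => ?_
    rcases Finset.eq_empty_or_nonempty
      ({x ∈ {x ∈ ends G T | E.Middle T z x} | Quotient.mk (parSetoid G T) x = a}) with he | ⟨x, hx⟩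
    · rw [he, sum_empty]
      norm_num
    · rw [mem_filter, mem_filter] at hx
      have h6 : ¬ 1 ≤ 12 * E.parWeight T z x := fun h => hno x ⟨hx.1.2, h⟩
      have h7 : ∑ y ∈ {x ∈ ends G T | E.Middle T z x} with Quotient.mk (parSetoid G T) y = a,
          z y.1.edge = E.parWeight T z x := by
        unfold Embedding.parWeight
        refine sum_congr ?_ fun _ _ => rfl
        ext y
        rw [mem_filter, mem_filter, mem_filter]
        constructor
        · rintro ⟨⟨_, hm⟩, hy⟩
          exact ⟨mem_univ _, hm, Par.symm (Quotient.exact (s := parSetoid G T) (hy.trans hx.2.symm))⟩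
        · rintro ⟨_, hm, hp⟩
          exact ⟨⟨hm.1, hm⟩, (Quotient.sound (s := parSetoid G T) hp.symm).trans hx.2⟩
      rw [h7]
      linarith
  rw [sum_const, nsmul_eq_mul] at h5
  -- The genus is an integer below the number `k` of components, so `6(k + g - 2) ≤ 6(2k - 3)`.
  have h8 : (#(E.branchEnds T) : ℝ) ≤ 12 * Nat.card T.ConnectedComponent - 18 := by
    have : (#(E.branchEnds T) : ℤ) ≤ 12 * Nat.card T.ConnectedComponent - 18 := by omega
    exact_mod_cast this
  have h9 : (#((ends G T).image (Quotient.mk (parSetoid G T))) : ℝ) ≤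
      max 1 (#(E.branchEnds T) : ℝ) := by exact_mod_cast h3
  have h10 : max 1 (#(E.branchEnds T) : ℝ) ≤ 12 * Nat.card T.ConnectedComponent :=
    max_le (by linarith) (by linarith)
  linarith

theorem mem_edges {H : SimpleGraph V} {e : Sym2 V} : e ∈ edges H ↔ e ∈ H.edgeSet := by
  simp [edges]

theorem sum_darts_eq (f : Sym2 V → ℝ) :
    ∑ d : G.Dart with d.fst < d.snd, f d.edge = ∑ e ∈ edges G, f e := by
  refine sum_nbij (fun d => d.edge) ?_ ?_ ?_ fun _ _ => rfl
  · intro d _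
    exact mem_edges.2 d.edge_mem
  · intro d hd d' hd' he
    rw [mem_coe, mem_filter] at hd hd'
    rcases (SimpleGraph.dart_edge_eq_iff _ _).1 he with h | h
    · exact h
    · rw [h] at hd
      exact absurd hd.2 (not_lt_of_gt hd'.2)
  · intro e he
    rw [mem_coe, mem_edges] at he
    induction e with
    | h u v =>
      have h : G.Adj u v := he
      rcases lt_or_gt_of_ne h.ne with hlt | hlt
      · exact ⟨⟨(u, v), h⟩, by simpa using hlt, rfl⟩
      · exact ⟨⟨(v, u), h.symm⟩, by simpa using hlt, Sym2.eq_swap⟩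

theorem sum_flags_eq (f : Sym2 V → ℝ) :
    ∑ x : Flag G with x.1.fst < x.1.snd, f x.1.edge = 2 * ∑ e ∈ edges G, f e := by
  have h1 : ({x : Flag G | x.1.fst < x.1.snd} : Finset (Flag G)) =
      ({d : G.Dart | d.fst < d.snd} : Finset G.Dart) ×ˢ (univ : Finset Bool) := by
    ext x
    simp [mem_product]
  rw [h1, sum_product]
  simp only [Fintype.sum_bool, ← two_mul, ← mul_sum, sum_darts_eq]

theorem mem_cut {U : Finset V} {e : Sym2 V} :
    e ∈ cut G U ↔ e ∈ edges G ∧ ∃ u ∈ U, ∃ v ∉ U, e = s(u, v) := by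
  simp only [cut, mem_filter]

theorem mem_cut_iff {U : Finset V} {x : Flag G} :
    x.1.edge ∈ cut G U ↔ Cuts (U : Set V) x := by
  rw [mem_cut]
  constructor
  · rintro ⟨-, u, hu, v, hv, h⟩
    simp only [Cuts, mem_coe]
    rcases Sym2.eq_iff.1 h with ⟨rfl, rfl⟩ | ⟨rfl, rfl⟩ <;> tauto
  · intro h
    refine ⟨mem_edges.2 x.1.edge_mem, ?_⟩
    simp only [Cuts, mem_coe] at h
    by_cases h1 : x.1.fst ∈ U
    · exact ⟨_, h1, _, fun h2 => h (by tauto), rfl⟩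
    · exact ⟨x.1.snd, by tauto, _, h1, Sym2.eq_swap⟩

theorem cut_subset (U : Finset V) : cut G U ⊆ edges G := fun _ h => (mem_cut.1 h).1

theorem mem_edges_iff_adj {x : Flag G} : x.1.edge ∈ edges T ↔ T.Adj x.1.fst x.1.snd := by
  rw [mem_edges]
  rfl

/-- Take all flags for `Y`. Each forest edge in the cut has two sides, hence twice their number is
at most `2 · 48` times the dead weight, which counts each edge of the cut at most twice. -/
theorem Embedding.ThinAt.card_le (hz : ∀ e, 0 ≤ z e) {U : Finset V}
    (h : E.ThinAt T z (U : Set V)) :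
    (#(edges T ∩ cut G U) : ℝ) ≤ 96 * ∑ e ∈ cut G U, z e := by
  obtain ⟨P, -, hP, hcard⟩ := h
  have h1 : (#(act T U (univ : Finset (Flag G))) : ℝ) = 2 * #(edges T ∩ cut G U) := by
    have h2 := sum_flags_eq (G := G) (fun e => if e ∈ edges T ∩ cut G U then 1 else 0)
    rw [sum_ite_mem, inter_eq_right.2 (inter_subset_right.trans (cut_subset U)), sum_const, nsmul_eq_mul, mul_one,
      ← sum_filter, filter_filter, sum_const, nsmul_eq_mul, mul_one] at h2
    rw [← h2]
    congr 2
    unfold act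
    ext x
    simp only [mem_filter, mem_inter, mem_cut_iff, mem_edges_iff_adj]
  have h3 : deadSum G T z U ≤ 2 * ∑ e ∈ cut G U, z e := by
    have h2 := sum_flags_eq (G := G) (fun e => if e ∈ cut G U then z e else 0)
    rw [sum_ite_mem, inter_eq_right.2 (cut_subset U), ← sum_filter, filter_filter] at h2
    rw [← h2]
    refine sum_le_sum_of_subset_of_nonneg (fun x hx => ?_) fun _ _ _ => hz _
    simp only [mem_filter, mem_cut_iff] at hx ⊢
    exact ⟨hx.1, hx.2.1, hx.2.2.2⟩
  have h4 : (#(act T U (univ : Finset (Flag G))) : ℝ) ≤ 2 * #P := by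
    have := hP univ closed_univ
    rw [inter_univ] at this
    exact_mod_cast this
  linarith

/-- The cost of the edges with both ends in one component of `T`, each edge being counted
twice. -/
noncomputable def deadCost (G : SimpleGraph V) (T : SimpleGraph V) (z κ : Sym2 V → ℝ) : ℝ :=
  ∑ x : Flag G with x.1.fst < x.1.snd ∧ T.Reachable x.1.fst x.1.snd, κ x.1.edge * z x.1.edge

/-- One round of the algorithm: add a cheapest candidate, if there is one. -/
def Embedding.Round (E : Embedding G) (z κ : Sym2 V → ℝ) (T T' : SimpleGraph V) : Prop :=
  (∃ x, E.Candidate T z x ∧ (∀ y, E.Candidate T z y → κ x.1.edge ≤ κ y.1.edge) ∧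
    T' = addEdge T x) ∨ ((∀ x, ¬ E.Candidate T z x) ∧ T' = T)

/-- The invariant of the algorithm. -/
structure Embedding.Good (E : Embedding G) (z κ : Sym2 V → ℝ) (T : SimpleGraph V) : Prop where
  le : T ≤ G
  acyclic : T.IsAcyclic
  thin : ∀ U, E.ThinAt T z U
  cost : ∑ e ∈ edges T, κ e ≤ 12 * deadCost G T z κ

theorem good_bot (hz : ∀ e, 0 ≤ z e) (hκ : ∀ e, 0 ≤ κ e) : E.Good z κ ⊥ where
  le := bot_le
  acyclic := SimpleGraph.isAcyclic_bot
  thin _ := thinAt_bot hz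
  cost := by
    have : edges (⊥ : SimpleGraph V) = ∅ := by
      ext e
      simp [mem_edges]
    rw [this, sum_empty]
    exact mul_nonneg (by norm_num) (sum_nonneg fun _ _ => mul_nonneg (hκ _) (hz _))

theorem edges_addEdge (x : Flag G) : edges (addEdge T x) = insert x.1.edge (edges T) := by
  ext e
  induction e with
  | h u v =>
    have := x.1.fst_ne_snd
    simp only [mem_edges, mem_insert, SimpleGraph.mem_edgeSet, addEdge, SimpleGraph.sup_adj,
      SimpleGraph.edge_adj, SimpleGraph.Dart.edge, Sym2.eq_iff]
    constructor
    · tauto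
    · rintro ((⟨rfl, rfl⟩ | ⟨rfl, rfl⟩) | h)
      · exact Or.inr ⟨Or.inl ⟨rfl, rfl⟩, this⟩
      · exact Or.inr ⟨Or.inr ⟨rfl, rfl⟩, this.symm⟩
      · exact Or.inl h

theorem Embedding.Good.round (h : E.Good z κ T) (hz : ∀ e, 0 ≤ z e) (hκ : ∀ e, 0 ≤ κ e)
    {T' : SimpleGraph V} (hr : E.Round z κ T T') : E.Good z κ T' := by
  rcases hr with ⟨x, hx, hmin, rfl⟩ | ⟨-, rfl⟩
  swap
  · exact h
  obtain ⟨hxe, -, -⟩ := hx.1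
  refine ⟨sup_le h.le ?_, h.acyclic.sup_edge_of_not_reachable (mem_ends.1 hxe).2,
    fun U => (h.thin U).addEdge hz hx.1, ?_⟩
  · intro u v huv
    rw [SimpleGraph.edge_adj] at huv
    rcases huv.1 with ⟨rfl, rfl⟩ | ⟨rfl, rfl⟩
    exacts [x.1.adj, x.1.adj.symm]
  · rw [edges_addEdge, sum_insert]
    -- All middle edges parallel to `x` are candidates as well, since `parWeight` is constant on the
    -- class. So they cost at least as much as `x`, and their weight is at least 1/12.
    · have h1 : κ x.1.edge ≤ 12 * ∑ y with E.Middle T z y ∧ Par T x y, κ y.1.edge * z y.1.edge := by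
        have h2 : κ x.1.edge * E.parWeight T z x ≤
            ∑ y with E.Middle T z y ∧ Par T x y, κ y.1.edge * z y.1.edge := by
          unfold Embedding.parWeight
          rw [mul_sum]
          refine sum_le_sum fun y hy => mul_le_mul_of_nonneg_right (hmin y ?_) (hz _)
          rw [mem_filter] at hy
          refine ⟨hy.2.1, ?_⟩
          have : E.parWeight T z y = E.parWeight T z x := by
            unfold Embedding.parWeight
            refine sum_congr ?_ fun _ _ => rfl
            ext w
            rw [mem_filter, mem_filter]
            exact ⟨fun h => ⟨h.1, h.2.1, hy.2.2.trans h.2.2⟩,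
              fun h => ⟨h.1, h.2.1, hy.2.2.symm.trans h.2.2⟩⟩
          rw [this]
          exact hx.2
        have h3 := mul_le_mul_of_nonneg_left hx.2 (hκ x.1.edge)
        linarith
      -- The edges charged here join different components of `T` and have both ends in one component
      -- afterwards, so nothing is charged twice.
      have h4 : deadCost G T z κ + ∑ y with E.Middle T z y ∧ Par T x y, κ y.1.edge * z y.1.edge ≤
          deadCost G (ThinForest.addEdge T x) z κ := by
        unfold deadCost
        rw [← sum_union]
        · refine sum_le_sum_of_subset_of_nonneg (fun y hy => ?_)
            fun _ _ _ => mul_nonneg (hκ _) (hz _)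
          rw [mem_union, mem_filter, mem_filter] at hy
          rw [mem_filter]
          rcases hy with ⟨-, hlt, hre⟩ | ⟨-, hm, hp⟩
          · exact ⟨mem_univ _, hlt, hre.mono (le_addEdge T x)⟩
          · exact ⟨mem_univ _, (mem_ends.1 hm.1).1, reachable_addEdge hp⟩
        · rw [disjoint_left]
          intro y hy hy'
          rw [mem_filter] at hy hy'
          exact (mem_ends.1 hy'.2.1.1).2 hy.2.2
      have h5 := h.cost
      linarith
    · rw [mem_edges_iff_adj]
      exact fun h => (mem_ends.1 hxe).2 h.reachable

theorem deadCost_le (hz : ∀ e, 0 ≤ z e) (hκ : ∀ e, 0 ≤ κ e) :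
    deadCost G T z κ ≤ 2 * ∑ e ∈ edges G, κ e * z e := by
  rw [← sum_flags_eq]
  refine sum_le_sum_of_subset_of_nonneg (fun x hx => ?_) fun _ _ _ => mul_nonneg (hκ _) (hz _)
  rw [mem_filter] at hx ⊢
  exact ⟨hx.1, hx.2.1⟩

theorem card_edges_lt [Nonempty V] (hT : T.IsAcyclic) : #(edges T) < Fintype.card V := by
  obtain ⟨F, hTF, -, hF, hre⟩ :=
    SimpleGraph.exists_isAcyclic_reachable_eq_le_of_le_of_isAcyclic
      (le_top : T ≤ (⊤ : SimpleGraph V)) hT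
  have htree : F.IsTree := by
    refine ⟨⟨fun u v => ?_⟩, hF⟩
    rw [hre]
    exact SimpleGraph.connected_top.preconnected u v
  have h1 := htree.card_edgeFinset
  have h2 : #(edges T) ≤ #F.edgeFinset := by
    refine card_le_card fun e he => ?_
    rw [SimpleGraph.mem_edgeFinset]
    exact SimpleGraph.edgeSet_mono hTF (mem_edges.1 he)
  omega

/-- After `i` rounds either no candidate is left or the forest has at least `i` edges. A forest has
fewer edges than vertices, so the first alternative holds at the end. -/
theorem good_of_rounds (hz : ∀ e, 0 ≤ z e) (hκ : ∀ e, 0 ≤ κ e) {F : ℕ → SimpleGraph V}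
    (h0 : F 0 = ⊥) (hF : ∀ i < Fintype.card V, E.Round z κ (F i) (F (i + 1))) :
    E.Good z κ (F (Fintype.card V)) ∧ ∀ x, ¬ E.Candidate (F (Fintype.card V)) z x := by
  have key : ∀ i ≤ Fintype.card V, E.Good z κ (F i) ∧
      ((∀ x, ¬ E.Candidate (F i) z x) ∨ i ≤ #(edges (F i))) := by
    intro i
    induction i with
    | zero =>
      intro _
      rw [h0]
      exact ⟨good_bot hz hκ, Or.inr (Nat.zero_le _)⟩
    | succ i ih =>
      intro hi
      obtain ⟨h1, h2⟩ := ih (by omega)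
      have hr := hF i hi
      refine ⟨h1.round hz hκ hr, ?_⟩
      rcases hr with ⟨x, hx, -, hT'⟩ | ⟨hno, hT'⟩
      · rcases h2 with h2 | h2
        · exact absurd hx (h2 x)
        · right
          rw [hT', edges_addEdge, card_insert_of_notMem]
          · omega
          · rw [mem_edges_iff_adj]
            exact fun h => (mem_ends.1 hx.1.1).2 h.reachable
      · rw [hT']
        exact Or.inl hno
  obtain ⟨h1, h2⟩ := key _ le_rfl
  refine ⟨h1, fun x => ?_⟩
  have : Nonempty V := ⟨x.1.fst⟩
  exact h2.resolve_right (fun h => absurd (card_edges_lt h1.acyclic) (not_lt.2 h)) x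

end Existence

end ThinForest

namespace ThinForest

/-! ### Consequences of the Held–Karp constraints. -/

section Feasible

set_option linter.unusedSectionVars false

open Classical Finset

variable {V : Type*} [Fintype V] [LinearOrder V] {D : Digraph V} {c x : V → V → ℝ}

theorem onArc_nonneg {f : V → V → ℝ} (hf : ∀ u v, D.Adj u v → 0 ≤ f u v) (u v : V) :
    0 ≤ onArc D f u v := by
  unfold onArc
  split_ifs with h
  exacts [hf u v h, le_rfl]

theorem symmetrization_mk (u v : V) :
    symmetrization D x s(u, v) = onArc D x u v + onArc D x v u := rfl

theorem symmetrization_nonneg (hx : HeldKarpFeasible D x) (e : Sym2 V) :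
    0 ≤ symmetrization D x e := by
  induction e with
  | h u v => exact add_nonneg (onArc_nonneg hx.nonneg u v) (onArc_nonneg hx.nonneg v u)

theorem edgeCost_nonneg (hc : ∀ u v, D.Adj u v → 0 ≤ c u v) (e : Sym2 V) :
    0 ≤ edgeCost D c e := by
  induction e with
  | h u v =>
    simp only [edgeCost, Sym2.lift_mk]
    split_ifs with h1 h2 h2
    exacts [le_min (hc _ _ h1) (hc _ _ h2), hc _ _ h1, hc _ _ h2, le_rfl]

theorem underlying_adj {u v : V} : (underlying D).Adj u v ↔ u ≠ v ∧ (D.Adj u v ∨ D.Adj v u) := by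
  simp [underlying, Digraph.toSimpleGraphInclusive, SimpleGraph.fromRel_adj]

theorem onArc_eq_zero {f : V → V → ℝ} {u v : V} (hne : u ≠ v) (h : ¬ (underlying D).Adj u v) :
    onArc D f u v = 0 := by
  unfold onArc
  rw [if_neg]
  exact fun h' => h (underlying_adj.2 ⟨hne, Or.inl h'⟩)

theorem edgeCost_mul_le (hx : HeldKarpFeasible D x) (u v : V) :
    edgeCost D c s(u, v) * symmetrization D x s(u, v) ≤
      onArc D c u v * onArc D x u v + onArc D c v u * onArc D x v u := by
  simp only [edgeCost, Sym2.lift_mk, symmetrization_mk, onArc]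
  by_cases h1 : D.Adj u v <;> by_cases h2 : D.Adj v u <;> simp only [h1, h2, if_true, if_false]
  · rw [mul_add]
    exact add_le_add (mul_le_mul_of_nonneg_right (min_le_left _ _) (hx.nonneg _ _ h1))
      (mul_le_mul_of_nonneg_right (min_le_right _ _) (hx.nonneg _ _ h2))
  all_goals simp

/-- Each edge is bounded by its two arcs, and different edges have different arcs; the remaining
pairs only contribute nonnegative terms. -/
theorem sum_edgeCost_mul_le (hc : ∀ u v, D.Adj u v → 0 ≤ c u v) (hx : HeldKarpFeasible D x) :
    ∑ e ∈ edges (underlying D), edgeCost D c e * symmetrization D x e ≤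
      fractionalCost D c x := by
  set h : V × V → ℝ := fun p => onArc D c p.1 p.2 * onArc D x p.1 p.2 with hh
  have h0 : ∀ p, 0 ≤ h p := fun p =>
    mul_nonneg (onArc_nonneg hc _ _) (onArc_nonneg hx.nonneg _ _)
  have h1 : fractionalCost D c x = ∑ p, h p := by
    rw [Fintype.sum_prod_type]
    rfl
  rw [h1, ← sum_darts_eq]
  have h2 : ∑ d : (underlying D).Dart with d.fst < d.snd,
      edgeCost D c d.edge * symmetrization D x d.edge ≤
      ∑ d : (underlying D).Dart with d.fst < d.snd, (h d.toProd + h d.toProd.swap) :=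
    sum_le_sum fun d _ => edgeCost_mul_le hx d.fst d.snd
  refine h2.trans ?_
  rw [sum_add_distrib]
  have e1 : ∑ d : (underlying D).Dart with d.fst < d.snd, h d.toProd =
      ∑ p ∈ ({d : (underlying D).Dart | d.fst < d.snd} : Finset _).image (fun d => d.toProd), h p :=
    (sum_image fun d _ d' _ h => SimpleGraph.Dart.ext _ _ h).symm
  have e2 : ∑ d : (underlying D).Dart with d.fst < d.snd, h d.toProd.swap =
      ∑ p ∈ ({d : (underlying D).Dart | d.fst < d.snd} : Finset _).image
        (fun d => d.toProd.swap), h p :=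
    (sum_image fun d _ d' _ h => SimpleGraph.Dart.ext _ _ (Prod.swap_injective h)).symm
  rw [e1, e2, ← sum_union]
  · exact sum_le_sum_of_subset_of_nonneg (subset_univ _) fun _ _ _ => h0 _
  · rw [disjoint_left]
    intro p hp hp'
    obtain ⟨d, hd, rfl⟩ := mem_image.1 hp
    obtain ⟨d', hd', he⟩ := mem_image.1 hp'
    rw [mem_filter] at hd hd'
    have h3 : d'.snd = d.fst := congrArg Prod.fst he
    have h4 : d'.fst = d.snd := congrArg Prod.snd he
    have := hd'.2
    rw [h3, h4] at this
    exact absurd hd.2 this.not_gt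

/-- The cut constraints for `U` and for its complement are added. -/
theorem two_le_sum_cut (hx : HeldKarpFeasible D x) {U : Finset V} (h1 : U.Nonempty)
    (h2 : U ≠ univ) : 2 ≤ ∑ u ∈ U, ∑ v ∈ Uᶜ, symmetrization D x s(u, v) := by
  have e1 := hx.one_le_out U h1 h2
  have e2 := hx.one_le_out Uᶜ (by
    rw [nonempty_iff_ne_empty, ne_eq, compl_eq_empty_iff]; exact h2) (by
    rw [ne_eq, compl_eq_univ_iff]; exact h1.ne_empty)
  simp only [symmetrization_mk, sum_add_distrib]
  unfold outSum at e1 e2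
  rw [sum_comm] at e2
  -- The complement in `outSum` uses classical decidable equality, the one in the statement that of
  -- the linear order; both are the same set.
  have e3 : ∀ s : Finset V, @compl _ (@BooleanAlgebra.toCompl _
      (@Finset.booleanAlgebra V _ (fun a b => Classical.propDecidable (a = b)))) s = sᶜ := by
    intro s
    ext v
    simp only [mem_compl]
  simp only [e3, compl_compl] at e1 e2
  linarith

/-- Otherwise the set of vertices reachable from `u` would be a cut of weight zero. -/
theorem underlying_preconnected (hx : HeldKarpFeasible D x) : (underlying D).Preconnected := by
  intro u v
  by_contra h
  have h1 := two_le_sum_cut hx (U := {w | (underlying D).Reachable u w})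
    ⟨u, by simp⟩ (fun h' => h (by simpa using (eq_univ_iff_forall.1 h') v))
  rw [sum_eq_zero] at h1
  · norm_num at h1
  · intro a ha
    refine sum_eq_zero fun b hb => ?_
    simp only [mem_filter, mem_univ, true_and, mem_compl] at ha hb
    have hne : a ≠ b := by
      rintro rfl
      exact hb ha
    have hadj : ¬ (underlying D).Adj a b := fun hadj => hb (ha.trans hadj.reachable)
    rw [symmetrization_mk, onArc_eq_zero hne hadj,
      onArc_eq_zero hne.symm (fun h => hadj h.symm), add_zero]

/-- With at least two components, each of them is a proper subset and its cut weighs at least 2. The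
sum over the components counts an edge once for each end, just as `ends` counts it once for each
side. -/
theorem two_mul_card_component_le (hx : HeldKarpFeasible D x) (T : SimpleGraph V)
    (hk : 2 ≤ Nat.card T.ConnectedComponent) : 2 * (Nat.card T.ConnectedComponent : ℝ) ≤
      ∑ y ∈ ends (underlying D) T, symmetrization D x y.1.edge := by
  have : Fintype T.ConnectedComponent := Fintype.ofFinite _
  set cc : V → T.ConnectedComponent := T.connectedComponentMk with hcc
  set f : V → V → ℝ := fun u v =>
    if T.Reachable u v then 0 else symmetrization D x s(u, v) with hf
  have hfs : ∀ u v, f u v = f v u := by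
    intro u v
    simp only [hf, SimpleGraph.reachable_comm (u := u) (v := v), Sym2.eq_swap (a := u) (b := v)]
  have h1 : 2 * (Nat.card T.ConnectedComponent : ℝ) ≤ ∑ u, ∑ v, f u v := by
    rw [← sum_fiberwise (s := univ) (g := cc), Nat.card_eq_fintype_card, mul_comm,
      ← nsmul_eq_mul, ← card_univ, ← sum_const]
    refine sum_le_sum fun C _ => ?_
    obtain ⟨u0, hu0⟩ : ∃ u0, cc u0 = C := Quot.exists_rep C
    refine (two_le_sum_cut hx (U := {u | cc u = C}) ⟨u0, by simp [hu0]⟩ ?_).trans ?_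
    · intro h
      have h3 : ∀ C', C' = C := by
        intro C'
        obtain ⟨v, hv⟩ : ∃ v, cc v = C' := Quot.exists_rep C'
        have := (eq_univ_iff_forall.1 h) v
        rw [mem_filter] at this
        rw [← hv]
        exact this.2
      have : Nat.card T.ConnectedComponent ≤ 1 := by
        rw [Nat.card_eq_fintype_card]
        exact Fintype.card_le_one_iff.2 fun a b => (h3 a).trans (h3 b).symm
      omega
    · refine sum_le_sum fun u hu => ?_
      rw [mem_filter] at hu
      refine (le_of_eq (sum_congr rfl fun v hv => ?_)).trans
        (sum_le_sum_of_subset_of_nonneg (subset_univ ({u | cc u = C} : Finset V)ᶜ) fun v _ _ => ?_)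
      · rw [mem_compl, mem_filter] at hv
        have : ¬ T.Reachable u v := fun h => hv ⟨mem_univ _, by
          rw [← hu.2]; exact (SimpleGraph.ConnectedComponent.sound h).symm⟩
        simp only [hf, this, if_false]
      · simp only [hf]
        split_ifs
        exacts [le_rfl, symmetrization_nonneg hx _]
  have h2 : ∑ u, ∑ v, f u v = ∑ y ∈ ends (underlying D) T, symmetrization D x y.1.edge := by
    have h3 : ∑ u, ∑ v, f u v = 2 * ∑ p : V × V with p.1 < p.2, f p.1 p.2 := by
      rw [← Fintype.sum_prod_type', ← sum_filter_add_sum_filter_not univ fun p : V × V => p.1 < p.2,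
        two_mul]
      congr 1
      have h4 : ∑ p : V × V with p.2 < p.1, f p.1 p.2 = ∑ p : V × V with p.1 < p.2, f p.1 p.2 := by
        refine sum_nbij' Prod.swap Prod.swap ?_ ?_ ?_ ?_ ?_
        · intro p hp
          simpa using hp
        · intro p hp
          simpa using hp
        · intro p _
          exact p.swap_swap
        · intro p _
          exact p.swap_swap
        · intro p _
          exact hfs _ _
      rw [← h4]
      symm
      refine sum_subset (fun p hp => ?_) fun p hp hp' => ?_
      · rw [mem_filter] at hp ⊢
        exact ⟨hp.1, hp.2.not_gt⟩
      · rw [mem_filter] at hp hp'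
        have : p.1 = p.2 := le_antisymm (not_lt.1 fun h => hp' ⟨mem_univ _, h⟩) (not_lt.1 hp.2)
        simp [hf, this]
    rw [h3]
    have h5 : ∑ y ∈ ends (underlying D) T, symmetrization D x y.1.edge =
        2 * ∑ d : (underlying D).Dart with d.fst < d.snd ∧ ¬ T.Reachable d.fst d.snd,
          symmetrization D x d.edge := by
      have : ends (underlying D) T = ({d : (underlying D).Dart |
          d.fst < d.snd ∧ ¬ T.Reachable d.fst d.snd} : Finset _) ×ˢ (univ : Finset Bool) := by
        ext y
        simp [mem_ends, mem_product]
      rw [this, sum_product]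
      simp only [Fintype.sum_bool, ← two_mul, ← mul_sum]
    rw [h5]
    congr 1
    have h6 : ∑ d : (underlying D).Dart with d.fst < d.snd ∧ ¬ T.Reachable d.fst d.snd,
        symmetrization D x d.edge = ∑ p ∈ ({d : (underlying D).Dart | d.fst < d.snd ∧
          ¬ T.Reachable d.fst d.snd} : Finset _).image (fun d => d.toProd), f p.1 p.2 := by
      rw [sum_image fun d _ d' _ h => SimpleGraph.Dart.ext _ _ h]
      refine sum_congr rfl fun d hd => ?_
      rw [mem_filter] at hd
      simp only [hf, hd.2.2, if_false]
      rfl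
    rw [h6]
    symm
    refine sum_subset (fun p hp => ?_) fun p hp hp' => ?_
    · obtain ⟨d, hd, rfl⟩ := mem_image.1 hp
      rw [mem_filter] at hd ⊢
      exact ⟨mem_univ _, hd.2.1⟩
    · rw [mem_filter] at hp
      by_cases hr : T.Reachable p.1 p.2
      · simp only [hf, hr, if_true]
      · have hadj : ¬ (underlying D).Adj p.1 p.2 := fun h =>
          hp' (mem_image.2 ⟨⟨p, h⟩, by rw [mem_filter]; exact ⟨mem_univ _, hp.2, hr⟩, rfl⟩)
        simp only [hf, hr, if_false]
        rw [symmetrization_mk, onArc_eq_zero hp.2.ne hadj,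
          onArc_eq_zero hp.2.ne' (fun h => hadj h.symm), add_zero]
  exact h1.trans_eq h2

theorem thin_of_rounds (hc : ∀ u v, D.Adj u v → 0 ≤ c u v) (hx : HeldKarpFeasible D x)
    (E : Embedding (underlying D)) {F : ℕ → SimpleGraph V} (h0 : F 0 = ⊥)
    (hF : ∀ i < Fintype.card V,
      E.Round (symmetrization D x) (edgeCost D c) (F i) (F (i + 1))) :
    F (Fintype.card V) ≤ underlying D ∧ (F (Fintype.card V)).IsAcyclic ∧
      (Nat.card (F (Fintype.card V)).ConnectedComponent : ℤ) ≤ max 1 E.eulerGenus ∧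
      IsThin D c x 96 24 (edges (F (Fintype.card V))) := by
  have hz := symmetrization_nonneg hx
  have hκ := edgeCost_nonneg hc
  obtain ⟨hgood, hno⟩ := good_of_rounds hz hκ h0 hF
  refine ⟨hgood.le, hgood.acyclic, ?_, fun U => ?_, ?_⟩
  · by_contra! h
    have hk : 1 < Nat.card (F (Fintype.card V)).ConnectedComponent := by
      exact_mod_cast (le_max_left 1 E.eulerGenus).trans_lt h
    obtain ⟨y, hy⟩ := exists_candidate (underlying_preconnected hx) hgood.le hgood.acyclic hz
      hk.le (two_mul_card_component_le hx _ hk) ((le_max_right 1 E.eulerGenus).trans_lt h)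
    exact hno y hy
  · have := (hgood.thin U).card_le hz
    convert this using 3
    ext e
    simp only [mem_inter]
  · have h1 := hgood.cost
    have h2 := deadCost_le (G := underlying D) (T := F (Fintype.card V)) hz hκ
    have h3 := sum_edgeCost_mul_le hc hx
    linarith

end Feasible

end ThinForest

namespace ThinForest

/-! ### Programs with bounded loops -/

/-- Programs with bounded loops: `loop k b P` executes `P` for the values `0, 1, …` of the cell
`(0, 0)` of the array `k` that are smaller than the content of the cell `(0, 0)` of the
array `b`. -/
inductive Cmd where
  | setNat (a : ℕ) (i j : NatExp) (e : NatExp)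
  | setReal (a : ℕ) (i j : NatExp) (e : RealExp)
  | seq (P Q : Cmd)
  | ite (b : Test) (P Q : Cmd)
  | loop (k b : ℕ) (P : Cmd)

/-- The cell `(0, 0)` of the array `a`. -/
def cell (a : ℕ) : NatExp := .get a (.lit 0) (.lit 0)

namespace Cmd

open Classical in
/-- The memory after the execution of a program. -/
noncomputable def run : Cmd → Store → Store
  | setNat a i j e, σ => σ.setNat a (i.eval σ) (j.eval σ) (e.eval σ)
  | setReal a i j e, σ => σ.setReal a (i.eval σ) (j.eval σ) (e.eval σ)
  | seq P Q, σ => Q.run (P.run σ)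
  | ite b P Q, σ => if b.Holds σ then P.run σ else Q.run σ
  | loop k b P, σ => (fun τ => (P.run τ).setNat k 0 0 ((P.run τ).nat k 0 0 + 1))^[σ.nat b 0 0]
      (σ.setNat k 0 0 0)

/-- The translation into the machine language. -/
def compile : Cmd → Prog
  | setNat a i j e => .setNat a i j e
  | setReal a i j e => .setReal a i j e
  | seq P Q => .seq P.compile Q.compile
  | ite b P Q => .ite b P.compile Q.compile
  | loop k b P => .seq (.setNat k (.lit 0) (.lit 0) (.lit 0))
      (.while (.not (.natLE (cell b) (cell k)))
        (.seq P.compile (.setNat k (.lit 0) (.lit 0) (.add (cell k) (.lit 1)))))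

/-- The arrays of natural numbers that may be changed. -/
def natWrites : Cmd → List ℕ
  | setNat a _ _ _ => [a]
  | setReal _ _ _ _ => []
  | seq P Q => P.natWrites ++ Q.natWrites
  | ite _ P Q => P.natWrites ++ Q.natWrites
  | loop k _ P => k :: P.natWrites

/-- The arrays of real numbers that may be changed. -/
def realWrites : Cmd → List ℕ
  | setNat _ _ _ _ => []
  | setReal a _ _ _ => [a]
  | seq P Q => P.realWrites ++ Q.realWrites
  | ite _ P Q => P.realWrites ++ Q.realWrites
  | loop _ _ P => P.realWrites

/-- The bounds of the loops are in arrays of the list `S`, which are never changed, and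
the loop counters are changed only by their loops. -/
def WF (S : List ℕ) : Cmd → Prop
  | setNat a _ _ _ => a ∉ S
  | setReal _ _ _ _ => True
  | seq P Q => P.WF S ∧ Q.WF S
  | ite _ P Q => P.WF S ∧ Q.WF S
  | loop k b P => b ∈ S ∧ k ∉ S ∧ k ∉ P.natWrites ∧ P.WF S

instance decidableWF (S : List ℕ) : (P : Cmd) → Decidable (P.WF S)
  | setNat a _ _ _ => inferInstanceAs (Decidable (a ∉ S))
  | setReal _ _ _ _ => inferInstanceAs (Decidable True)
  | seq P Q => @instDecidableAnd _ _ (decidableWF S P) (decidableWF S Q)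
  | ite _ P Q => @instDecidableAnd _ _ (decidableWF S P) (decidableWF S Q)
  | loop k b P => @instDecidableAnd _ _ (inferInstanceAs (Decidable (b ∈ S)))
      (@instDecidableAnd _ _ (inferInstanceAs (Decidable (k ∉ S)))
        (@instDecidableAnd _ _ (inferInstanceAs (Decidable (k ∉ P.natWrites))) (decidableWF S P)))

/-- A bound for the number of steps in terms of the loop bounds. -/
noncomputable def time : Cmd → Polynomial ℕ
  | setNat _ _ _ _ => 1
  | setReal _ _ _ _ => 1
  | seq P Q => 1 + P.time + Q.time
  | ite _ P Q => 1 + P.time + Q.time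
  -- Outside the passes: unfolding the sequence, resetting the counter and the final failing test.
  -- In each pass besides the body: the test, unfolding the sequence and the increment. The variable
  -- bounds all loop bounds at once.
  | loop _ _ P => 3 + Polynomial.X * (P.time + 3)

end Cmd

@[simp] theorem Store.nat_setNat_self (σ : Store) (a i j w : ℕ) :
    (σ.setNat a i j w).nat a i j = w := by simp [Store.setNat]

theorem Store.nat_setNat (σ : Store) (a i j w i' j' : ℕ) :
    (σ.setNat a i j w).nat a i' j' = if i' = i ∧ j' = j then w else σ.nat a i' j' := by
  simp [Store.setNat]

theorem Store.nat_setNat_of_ne (σ : Store) {a b : ℕ} (h : b ≠ a) (i j w : ℕ) :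
    (σ.setNat a i j w).nat b = σ.nat b := by
  funext i' j'
  simp [Store.setNat, h]

@[simp] theorem Store.real_setNat (σ : Store) (a i j w : ℕ) :
    (σ.setNat a i j w).real = σ.real := rfl

@[simp] theorem Store.nat_setReal (σ : Store) (a i j : ℕ) (w : ℝ) :
    (σ.setReal a i j w).nat = σ.nat := rfl

theorem Store.real_setReal (σ : Store) (a i j : ℕ) (w : ℝ) (i' j' : ℕ) :
    (σ.setReal a i j w).real a i' j' = if i' = i ∧ j' = j then w else σ.real a i' j' := by
  simp [Store.setReal]

theorem Store.real_setReal_of_ne (σ : Store) {a b : ℕ} (h : b ≠ a) (i j : ℕ) (w : ℝ) :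
    (σ.setReal a i j w).real b = σ.real b := by
  funext i' j'
  simp [Store.setReal, h]

namespace Cmd

theorem nat_run_of_notMem {a : ℕ} : ∀ (P : Cmd) (σ : Store), a ∉ P.natWrites →
    (P.run σ).nat a = σ.nat a
  | setNat b i j e, σ, h => by
    simp only [natWrites, List.mem_singleton] at h
    exact Store.nat_setNat_of_ne σ h _ _ _
  | setReal b i j e, σ, h => rfl
  | seq P Q, σ, h => by
    simp only [natWrites, List.mem_append, not_or] at h
    rw [run, nat_run_of_notMem Q _ h.2, nat_run_of_notMem P _ h.1]
  | ite b P Q, σ, h => by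
    simp only [natWrites, List.mem_append, not_or] at h
    rw [run]
    split_ifs
    exacts [nat_run_of_notMem P _ h.1, nat_run_of_notMem Q _ h.2]
  | loop k b P, σ, h => by
    simp only [natWrites, List.mem_cons, not_or] at h
    rw [run]
    have : ∀ m, ((fun τ => (P.run τ).setNat k 0 0 ((P.run τ).nat k 0 0 + 1))^[m]
        (σ.setNat k 0 0 0)).nat a = σ.nat a := by
      intro m
      induction m with
      | zero => exact Store.nat_setNat_of_ne σ h.1 _ _ _
      | succ m ih =>
        rw [Function.iterate_succ_apply', Store.nat_setNat_of_ne _ h.1,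
          nat_run_of_notMem P _ h.2, ih]
    exact this _

theorem real_run_of_notMem {a : ℕ} : ∀ (P : Cmd) (σ : Store), a ∉ P.realWrites →
    (P.run σ).real a = σ.real a
  | setNat b i j e, σ, h => rfl
  | setReal b i j e, σ, h => by
    simp only [realWrites, List.mem_singleton] at h
    exact Store.real_setReal_of_ne σ h _ _ _
  | seq P Q, σ, h => by
    simp only [realWrites, List.mem_append, not_or] at h
    rw [run, real_run_of_notMem Q _ h.2, real_run_of_notMem P _ h.1]
  | ite b P Q, σ, h => by
    simp only [realWrites, List.mem_append, not_or] at h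
    rw [run]
    split_ifs
    exacts [real_run_of_notMem P _ h.1, real_run_of_notMem Q _ h.2]
  | loop k b P, σ, h => by
    simp only [realWrites] at h
    rw [run]
    have : ∀ m, ((fun τ => (P.run τ).setNat k 0 0 ((P.run τ).nat k 0 0 + 1))^[m]
        (σ.setNat k 0 0 0)).real a = σ.real a := by
      intro m
      induction m with
      | zero => rfl
      | succ m ih =>
        rw [Function.iterate_succ_apply', Store.real_setNat, real_run_of_notMem P _ h, ih]
    exact this _

theorem WF.notMem_natWrites {S : List ℕ} {a : ℕ} (ha : a ∈ S) :
    ∀ {P : Cmd}, P.WF S → a ∉ P.natWrites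
  | setNat b i j e, h => by
    simp only [natWrites, List.mem_singleton]
    rintro rfl
    exact h ha
  | setReal b i j e, h => by simp [natWrites]
  | seq P Q, h => by
    simp only [natWrites, List.mem_append, not_or]
    exact ⟨h.1.notMem_natWrites ha, h.2.notMem_natWrites ha⟩
  | ite b P Q, h => by
    simp only [natWrites, List.mem_append, not_or]
    exact ⟨h.1.notMem_natWrites ha, h.2.notMem_natWrites ha⟩
  | loop k b P, h => by
    simp only [natWrites, List.mem_cons, not_or]
    refine ⟨?_, h.2.2.2.notMem_natWrites ha⟩
    rintro rfl
    exact h.2.1 ha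

/-- The rule for proving properties of loops by invariants. -/
theorem run_loop {k b : ℕ} {P : Cmd} {σ : Store} (hk : k ∉ P.natWrites) (I : ℕ → Store → Prop)
    (hI : ∀ i τ w, I i τ → I i (τ.setNat k 0 0 w)) (h0 : I 0 σ)
    (hs : ∀ i < σ.nat b 0 0, ∀ τ : Store,
      (∀ a, a ∉ (loop k b P).natWrites → τ.nat a = σ.nat a) →
      (∀ a, a ∉ (loop k b P).realWrites → τ.real a = σ.real a) →
      τ.nat k 0 0 = i → I i τ → I (i + 1) (P.run τ)) :
    I (σ.nat b 0 0) ((loop k b P).run σ) := by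
  rw [run]
  have : ∀ m ≤ σ.nat b 0 0, ∀ τ, τ = ((fun τ => (P.run τ).setNat k 0 0 ((P.run τ).nat k 0 0 + 1))^[m]
      (σ.setNat k 0 0 0)) → (∀ a, a ∉ (loop k b P).natWrites → τ.nat a = σ.nat a) ∧
      (∀ a, a ∉ (loop k b P).realWrites → τ.real a = σ.real a) ∧ τ.nat k 0 0 = m ∧ I m τ := by
    intro m
    induction m with
    | zero =>
      rintro - τ rfl
      refine ⟨fun a ha => Store.nat_setNat_of_ne _ ?_ _ _ _, fun a _ => rfl, by simp, hI _ _ _ h0⟩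
      rintro rfl
      simp [natWrites] at ha
    | succ m ih =>
      rintro hm τ rfl
      obtain ⟨h1, h2, h3, h4⟩ := ih (by omega) _ rfl
      rw [Function.iterate_succ_apply']
      set τ := ((fun τ => (P.run τ).setNat k 0 0 ((P.run τ).nat k 0 0 + 1))^[m]
        (σ.setNat k 0 0 0)) with hτ
      refine ⟨fun a ha => ?_, fun a ha => ?_, ?_, hI _ _ _ (hs m (by omega) τ h1 h2 h3 h4)⟩
      · have ha' := ha
        simp only [natWrites, List.mem_cons, not_or] at ha'
        rw [Store.nat_setNat_of_ne _ ha'.1, nat_run_of_notMem P _ ha'.2, h1 a ha]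
      · rw [Store.real_setNat, real_run_of_notMem P _ ha, h2 a ha]
      · rw [Store.nat_setNat_self, nat_run_of_notMem P _ hk, h3]
  exact (this _ le_rfl _ rfl).2.2.2

theorem iterate_step_seq (P Q : Prog) (K : List Prog) (σ : Store) :
    step (.seq P Q :: K, σ) = (P :: Q :: K, σ) := rfl

/-- The machine executes the translation of a program within the stated time. -/
theorem exists_iterate_step {S : List ℕ} : ∀ (P : Cmd), P.WF S → ∀ (σ : Store) (B : ℕ),
    (∀ a ∈ S, σ.nat a 0 0 ≤ B) → ∀ K : List Prog,
      ∃ t ≤ P.time.eval B, step^[t] (P.compile :: K, σ) = (K, P.run σ)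
  | setNat a i j e, _, σ, B, _, K => ⟨1, by simp [time], rfl⟩
  | setReal a i j e, _, σ, B, _, K => ⟨1, by simp [time], rfl⟩
  | seq P Q, h, σ, B, hB, K => by
    obtain ⟨t1, ht1, h1⟩ := exists_iterate_step P h.1 σ B hB (Q.compile :: K)
    obtain ⟨t2, ht2, h2⟩ := exists_iterate_step Q h.2 (P.run σ) B (fun a ha => by
      rw [nat_run_of_notMem P σ (h.1.notMem_natWrites ha)]; exact hB a ha) K
    refine ⟨t2 + (t1 + 1), ?_, ?_⟩
    · simp only [time, Polynomial.eval_add, Polynomial.eval_one]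
      omega
    · rw [Function.iterate_add_apply, Function.iterate_succ_apply]
      change step^[t2] (step^[t1] (P.compile :: Q.compile :: K, σ)) = _
      rw [h1, h2]
      rfl
  | ite b P Q, h, σ, B, hB, K => by
    obtain ⟨t1, ht1, h1⟩ := exists_iterate_step P h.1 σ B hB K
    obtain ⟨t2, ht2, h2⟩ := exists_iterate_step Q h.2 σ B hB K
    by_cases hb : b.Holds σ
    · refine ⟨t1 + 1, ?_, ?_⟩
      · simp only [time, Polynomial.eval_add, Polynomial.eval_one]
        omega
      · have : step ((ite b P Q).compile :: K, σ) = (P.compile :: K, σ) := by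
          simp only [compile, step, hb, if_true]
        rw [Function.iterate_succ_apply, this, h1, run, if_pos hb]
    · refine ⟨t2 + 1, ?_, ?_⟩
      · simp only [time, Polynomial.eval_add, Polynomial.eval_one]
        omega
      · have : step ((ite b P Q).compile :: K, σ) = (Q.compile :: K, σ) := by
          simp only [compile, step, hb, if_false]
        rw [Function.iterate_succ_apply, this, h2, run, if_neg hb]
  | loop k b P, h, σ, B, hB, K => by
    obtain ⟨hb, hk, hkP, hP⟩ := h
    set f : Store → Store := fun τ => (P.run τ).setNat k 0 0 ((P.run τ).nat k 0 0 + 1) with hf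
    set W : Prog := .while (.not (.natLE (cell b) (cell k)))
      (.seq P.compile (.setNat k (.lit 0) (.lit 0) (.add (cell k) (.lit 1)))) with hW
    -- The bound never changes and the counter equals the number of completed passes, so the `while`
    -- loop makes exactly as many passes as `run`.
    have hfr : ∀ m, (∀ a ∈ S, (f^[m] (σ.setNat k 0 0 0)).nat a = σ.nat a) ∧
        (f^[m] (σ.setNat k 0 0 0)).nat k 0 0 = m := by
      intro m
      induction m with
      | zero =>
        refine ⟨fun a ha => Store.nat_setNat_of_ne _ ?_ _ _ _, by simp⟩
        rintro rfl
        exact hk ha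
      | succ m ih =>
        rw [Function.iterate_succ_apply']
        refine ⟨fun a ha => ?_, ?_⟩
        · have hak : a ≠ k := by
            rintro rfl
            exact hk ha
          rw [hf]
          dsimp only
          rw [Store.nat_setNat_of_ne _ hak, nat_run_of_notMem P _ (hP.notMem_natWrites ha),
            ih.1 a ha]
        · rw [hf]
          dsimp only
          rw [Store.nat_setNat_self, nat_run_of_notMem P _ hkP, ih.2]
    have hloop : ∀ m ≤ σ.nat b 0 0, ∃ t ≤ m * (P.time.eval B + 3),
        step^[t] (W :: K, σ.setNat k 0 0 0) = (W :: K, f^[m] (σ.setNat k 0 0 0)) := by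
      intro m
      induction m with
      | zero => exact fun _ => ⟨0, by simp, rfl⟩
      | succ m ih =>
        intro hm
        obtain ⟨t, ht, h1⟩ := ih (by omega)
        set τ := f^[m] (σ.setNat k 0 0 0) with hτ
        obtain ⟨t', ht', h2⟩ := exists_iterate_step P hP τ B
          (fun a ha => by rw [(hfr m).1 a ha]; exact hB a ha)
          (.setNat k (.lit 0) (.lit 0) (.add (cell k) (.lit 1)) :: W :: K)
        have h3 : step (W :: K, τ) = (.seq P.compile (.setNat k (.lit 0) (.lit 0)
            (.add (cell k) (.lit 1))) :: W :: K, τ) := by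
          have : ¬ τ.nat b 0 0 ≤ τ.nat k 0 0 := by
            rw [(hfr m).1 b hb, (hfr m).2]
            omega
          simp only [hW, step, Test.Holds, cell, NatExp.eval, this, not_false_eq_true, if_true]
        refine ⟨1 + (t' + (1 + (1 + t))), ?_, ?_⟩
        · have : (m + 1) * (P.time.eval B + 3) =
              m * (P.time.eval B + 3) + (P.time.eval B + 3) := by ring
          omega
        · rw [Function.iterate_add_apply, Function.iterate_add_apply, Function.iterate_add_apply,
            Function.iterate_add_apply, h1, Function.iterate_one, h3, iterate_step_seq, h2,
            Function.iterate_succ_apply']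
          rfl
    obtain ⟨t, ht, h1⟩ := hloop _ le_rfl
    refine ⟨1 + (t + (1 + 1)), ?_, ?_⟩
    · simp only [time, Polynomial.eval_add, Polynomial.eval_mul, Polynomial.eval_X,
        Polynomial.eval_ofNat]
      have : σ.nat b 0 0 * (P.time.eval B + 3) ≤ B * (P.time.eval B + 3) :=
        Nat.mul_le_mul_right _ (hB b hb)
      omega
    · have h2 : step^[1 + 1] ((loop k b P).compile :: K, σ) = (W :: K, σ.setNat k 0 0 0) := rfl
      have h3 : step (W :: K, f^[σ.nat b 0 0] (σ.setNat k 0 0 0)) =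
          (K, f^[σ.nat b 0 0] (σ.setNat k 0 0 0)) := by
        set τ := f^[σ.nat b 0 0] (σ.setNat k 0 0 0) with hτ
        have : τ.nat b 0 0 ≤ τ.nat k 0 0 := by
          rw [hτ, (hfr _).1 b hb, (hfr _).2]
        simp only [hW, step, Test.Holds, cell, NatExp.eval, this, not_true_eq_false, if_false]
      rw [Function.iterate_add_apply, Function.iterate_add_apply, h2, h1, Function.iterate_one, h3]
      rfl

end Cmd

/-! ### The size of the numbers -/

/-- The length of an expression. -/
def NatExp.len : NatExp → ℕ
  -- The length is the exponent of two by which a bound on the memory has to be multiplied; a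
  -- constant `k` is at most `2 ^ k`.
  | lit k => k
  | get _ _ _ => 0
  | add e f => e.len + f.len + 1
  | sub e _ => e.len

/-- The length of an expression. -/
def RealExp.len : RealExp → ℕ
  | one => 0
  | get _ _ _ => 0
  | add e f => e.len + f.len + 1
  | sub e f => e.len + f.len + 1

/-- The total length of the expressions assigned in a program. -/
def Prog.len : Prog → ℕ
  | setNat _ _ _ e => e.len
  | setReal _ _ _ e => e.len
  | seq P Q => P.len + Q.len
  | ite _ P Q => P.len + Q.len
  | .while _ P => P.len

theorem two_pow_add_le (a b M : ℕ) : 2 ^ a * M + 2 ^ b * M ≤ 2 ^ (a + b + 1) * M := by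
  have h1 : 2 ^ a ≤ 2 ^ (a + b) := Nat.pow_le_pow_right (by norm_num) (by omega)
  have h2 : 2 ^ b ≤ 2 ^ (a + b) := Nat.pow_le_pow_right (by norm_num) (by omega)
  rw [pow_succ, ← add_mul]
  exact Nat.mul_le_mul_right _ (by omega)

theorem NatExp.eval_le {σ : Store} {m M : ℕ} (h : σ.SizeAtMost m M) (hM : 1 ≤ M) :
    ∀ e : NatExp, e.eval σ ≤ 2 ^ e.len * M
  | lit k => by
    have := (Nat.lt_two_pow_self (n := k)).le
    exact this.trans (Nat.le_mul_of_pos_right _ hM)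
  | get a i j => by
    simpa [eval, len] using h.1 a _ _
  | add e f => (Nat.add_le_add (e.eval_le h hM) (f.eval_le h hM)).trans (two_pow_add_le _ _ _)
  | sub e f => (Nat.sub_le _ _).trans (e.eval_le h hM)

theorem RealExp.eval_eq {σ : Store} {m M : ℕ} (h : σ.SizeAtMost m M) (hM : m ≤ M) :
    ∀ e : RealExp, ∃ k : ℤ, (m : ℝ) * e.eval σ = k ∧ |k| ≤ ((2 ^ e.len * M : ℕ) : ℤ)
  | one => ⟨m, by simp [eval], by simpa [len] using hM⟩
  | get a i j => by
    simpa [eval, len] using h.2 a (i.eval σ) (j.eval σ)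
  | add e f => by
    obtain ⟨k1, h1, h1'⟩ := e.eval_eq h hM
    obtain ⟨k2, h2, h2'⟩ := f.eval_eq h hM
    refine ⟨k1 + k2, by rw [eval, mul_add, h1, h2]; push_cast; ring, ?_⟩
    refine (abs_add_le _ _).trans ((add_le_add h1' h2').trans ?_)
    exact_mod_cast two_pow_add_le e.len f.len M
  | sub e f => by
    obtain ⟨k1, h1, h1'⟩ := e.eval_eq h hM
    obtain ⟨k2, h2, h2'⟩ := f.eval_eq h hM
    refine ⟨k1 - k2, by rw [eval, mul_sub, h1, h2]; push_cast; ring, ?_⟩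
    refine (abs_sub _ _).trans ((add_le_add h1' h2').trans ?_)
    exact_mod_cast two_pow_add_le e.len f.len M

theorem Store.SizeAtMost.mono {σ : Store} {m M M' : ℕ} (h : σ.SizeAtMost m M) (hM : M ≤ M') :
    σ.SizeAtMost m M' := by
  refine ⟨fun a i j => (h.1 a i j).trans hM, fun a i j => ?_⟩
  obtain ⟨k, h1, h2⟩ := h.2 a i j
  exact ⟨k, h1, h2.trans (by exact_mod_cast hM)⟩

/-- A step writes at most one cell, with an expression of length at most `L`, and it only puts
subprograms of a pending program on the list, so the bound on the lengths persists. -/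
theorem step_sizeAtMost {c : Config} {m M L : ℕ} (hlen : ∀ P ∈ c.1, P.len ≤ L)
    (h : c.2.SizeAtMost m M) (hM : 1 ≤ M) (hmM : m ≤ M) :
    (∀ P ∈ (step c).1, P.len ≤ L) ∧ (step c).2.SizeAtMost m (2 ^ L * M) := by
  have hle : ∀ l ≤ L, 2 ^ l * M ≤ 2 ^ L * M := fun l hl =>
    Nat.mul_le_mul_right _ (Nat.pow_le_pow_right (by norm_num) hl)
  have h' : c.2.SizeAtMost m (2 ^ L * M) := h.mono (by simpa using hle 0 (Nat.zero_le _))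
  obtain ⟨K, σ⟩ := c
  cases K with
  | nil => exact ⟨hlen, h'⟩
  | cons P K =>
    have hK : ∀ Q ∈ K, Q.len ≤ L := fun Q hQ => hlen Q (List.mem_cons_of_mem _ hQ)
    have hPL : P.len ≤ L := hlen P (List.mem_cons_self)
    cases P with
    | setNat a i j e =>
      refine ⟨hK, fun a' i' j' => ?_, h'.2⟩
      simp only [step, Store.setNat]
      split_ifs
      · exact (e.eval_le h hM).trans (hle _ hPL)
      · exact h'.1 _ _ _
    | setReal a i j e =>
      refine ⟨hK, h'.1, fun a' i' j' => ?_⟩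
      simp only [step, Store.setReal]
      split_ifs
      · obtain ⟨k, h1, h2⟩ := e.eval_eq h hmM
        exact ⟨k, h1, h2.trans (by exact_mod_cast hle _ hPL)⟩
      · exact h'.2 _ _ _
    | seq P Q =>
      have hPL : P.len + Q.len ≤ L := hPL
      refine ⟨?_, h'⟩
      intro R hR
      simp only [step, List.mem_cons] at hR
      rcases hR with rfl | rfl | hR
      exacts [by omega, by omega, hK R hR]
    | ite b P Q =>
      have hPL : P.len + Q.len ≤ L := hPL
      by_cases hb : b.Holds σ
      · simp only [step, hb, if_true]
        refine ⟨?_, h'⟩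
        intro R hR
        rcases List.mem_cons.1 hR with rfl | hR
        exacts [by omega, hK R hR]
      · simp only [step, hb, if_false]
        refine ⟨?_, h'⟩
        intro R hR
        rcases List.mem_cons.1 hR with rfl | hR
        exacts [by omega, hK R hR]
    | _ b P =>
      have hPL' : P.len ≤ L := hPL
      by_cases hb : b.Holds σ
      · simp only [step, hb, if_true]
        refine ⟨?_, h'⟩
        intro R hR
        rcases List.mem_cons.1 hR with rfl | hR
        exacts [hPL', hlen R hR]
      · simp only [step, hb, if_false]
        exact ⟨hK, h'⟩

/-- The factor per step depends on the program alone, so the number of bits grows at most linearly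
with the time. -/
theorem after_sizeAtMost (P : Prog) {σ : Store} {m M : ℕ} (h : σ.SizeAtMost m M) (hM : 1 ≤ M)
    (hmM : m ≤ M) (t : ℕ) : (after P σ t).2.SizeAtMost m (M * 2 ^ (P.len * t)) := by
  have key : (∀ Q ∈ (after P σ t).1, Q.len ≤ P.len) ∧
      (after P σ t).2.SizeAtMost m (M * 2 ^ (P.len * t)) := by
    induction t with
    | zero =>
      refine ⟨fun Q hQ => ?_, by simpa [after] using h⟩
      simp only [after, Function.iterate_zero, id, List.mem_singleton] at hQ
      rw [hQ]
    | succ t ih =>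
      have hpow : 1 ≤ 2 ^ (P.len * t) := Nat.one_le_two_pow
      have h1 := step_sizeAtMost ih.1 ih.2 (by nlinarith) (by nlinarith)
      have h2 : after P σ (t + 1) = step (after P σ t) := Function.iterate_succ_apply' _ _ _
      rw [h2]
      refine ⟨h1.1, ?_⟩
      convert h1.2 using 1
      rw [mul_add, pow_add, mul_one]
      ring
  exact key.2

end ThinForest

namespace ThinForest

/-! ### Subroutines -/

/-- The entry `i` of the vector in the array `a`. -/
def NatExp.vec (a : ℕ) (i : NatExp) : NatExp := .get a i (.lit 0)

/-- The entry `i` of the vector in the array `a`. -/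
def RealExp.vec (a : ℕ) (i : NatExp) : RealExp := .get a i (.lit 0)

/-- Equality of natural numbers. -/
def Test.eq (e f : NatExp) : Test := .and (.natLE e f) (.natLE f e)

/-- Strict inequality of natural numbers. -/
def Test.lt (e f : NatExp) : Test := .not (.natLE f e)

/-- The natural number is not `0`. -/
def Test.pos (e : NatExp) : Test := .natLE (.lit 1) e

/-- Disjunction. -/
def Test.or (b b' : Test) : Test := .not (.and (.not b) (.not b'))

section Eval

variable (σ : Store)

@[simp] theorem NatExp.eval_lit (k : ℕ) : (NatExp.lit k).eval σ = k := rfl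

@[simp] theorem NatExp.eval_get (a : ℕ) (i j : NatExp) :
    (NatExp.get a i j).eval σ = σ.nat a (i.eval σ) (j.eval σ) := rfl

@[simp] theorem NatExp.eval_add (e f : NatExp) :
    (NatExp.add e f).eval σ = e.eval σ + f.eval σ := rfl

@[simp] theorem NatExp.eval_vec (a : ℕ) (i : NatExp) :
    (NatExp.vec a i).eval σ = σ.nat a (i.eval σ) 0 := rfl

@[simp] theorem eval_cell (a : ℕ) : (cell a).eval σ = σ.nat a 0 0 := rfl

@[simp] theorem RealExp.eval_one : RealExp.one.eval σ = 1 := rfl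

@[simp] theorem RealExp.eval_get (a : ℕ) (i j : NatExp) :
    (RealExp.get a i j).eval σ = σ.real a (i.eval σ) (j.eval σ) := rfl

@[simp] theorem RealExp.eval_add (e f : RealExp) :
    (RealExp.add e f).eval σ = e.eval σ + f.eval σ := rfl

@[simp] theorem RealExp.eval_sub (e f : RealExp) :
    (RealExp.sub e f).eval σ = e.eval σ - f.eval σ := rfl

@[simp] theorem RealExp.eval_vec (a : ℕ) (i : NatExp) :
    (RealExp.vec a i).eval σ = σ.real a (i.eval σ) 0 := rfl

@[simp] theorem Test.holds_natLE (e f : NatExp) :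
    (Test.natLE e f).Holds σ ↔ e.eval σ ≤ f.eval σ := Iff.rfl

@[simp] theorem Test.holds_realLE (e f : RealExp) :
    (Test.realLE e f).Holds σ ↔ e.eval σ ≤ f.eval σ := Iff.rfl

@[simp] theorem Test.holds_not (b : Test) : (Test.not b).Holds σ ↔ ¬ b.Holds σ := Iff.rfl

@[simp] theorem Test.holds_and (b b' : Test) :
    (Test.and b b').Holds σ ↔ b.Holds σ ∧ b'.Holds σ := Iff.rfl

@[simp] theorem Test.holds_or (b b' : Test) :
    (Test.or b b').Holds σ ↔ b.Holds σ ∨ b'.Holds σ := by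
  simp only [Test.or, Test.holds_not, Test.holds_and]
  tauto

@[simp] theorem Test.holds_eq (e f : NatExp) :
    (Test.eq e f).Holds σ ↔ e.eval σ = f.eval σ := by
  simp only [Test.eq, Test.holds_and, Test.holds_natLE]
  omega

@[simp] theorem Test.holds_lt (e f : NatExp) :
    (Test.lt e f).Holds σ ↔ e.eval σ < f.eval σ := by
  simp only [Test.lt, Test.holds_not, Test.holds_natLE]
  omega

@[simp] theorem Test.holds_pos (e : NatExp) : (Test.pos e).Holds σ ↔ 1 ≤ e.eval σ := Iff.rfl

end Eval

/-- The memories agree except for the listed arrays. -/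
def Store.Agree (L L' : List ℕ) (σ τ : Store) : Prop :=
  (∀ a ∉ L, τ.nat a = σ.nat a) ∧ ∀ a ∉ L', τ.real a = σ.real a

theorem Store.Agree.mono {L₁ L₁' L₂ L₂' : List ℕ} {σ τ : Store} (h : Store.Agree L₁ L₁' σ τ)
    (h1 : L₁ ⊆ L₂) (h2 : L₁' ⊆ L₂') : Store.Agree L₂ L₂' σ τ :=
  ⟨fun a ha => h.1 a fun h' => ha (h1 h'), fun a ha => h.2 a fun h' => ha (h2 h')⟩

theorem Store.Agree.trans {L L' : List ℕ} {σ τ ρ : Store} (h : Store.Agree L L' σ τ)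
    (h' : Store.Agree L L' τ ρ) : Store.Agree L L' σ ρ :=
  ⟨fun a ha => (h'.1 a ha).trans (h.1 a ha), fun a ha => (h'.2 a ha).trans (h.2 a ha)⟩

theorem Store.Agree.refl (L L' : List ℕ) (σ : Store) : Store.Agree L L' σ σ :=
  ⟨fun _ _ => rfl, fun _ _ => rfl⟩

theorem Store.Agree.setNat {L L' : List ℕ} {σ τ : Store} (h : Store.Agree L L' σ τ) {a : ℕ}
    (ha : a ∈ L) (i j w : ℕ) : Store.Agree L L' σ (τ.setNat a i j w) := by
  refine ⟨fun a' ha' => ?_, h.2⟩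
  rw [Store.nat_setNat_of_ne _ (by rintro rfl; exact ha' ha), h.1 a' ha']

theorem Store.Agree.setReal {L L' : List ℕ} {σ τ : Store} (h : Store.Agree L L' σ τ) {a : ℕ}
    (ha : a ∈ L') (i j : ℕ) (w : ℝ) : Store.Agree L L' σ (τ.setReal a i j w) := by
  refine ⟨h.1, fun a' ha' => ?_⟩
  rw [Store.real_setReal_of_ne _ (by rintro rfl; exact ha' ha), h.2 a' ha']

namespace Cmd

theorem agree_run (P : Cmd) (σ : Store) : Store.Agree P.natWrites P.realWrites σ (P.run σ) :=
  ⟨fun _ ha => P.nat_run_of_notMem σ ha, fun _ ha => P.real_run_of_notMem σ ha⟩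

/-- A version of the rule for loops with explicit lists of arrays. -/
theorem run_loop_agree {k b : ℕ} {P : Cmd} {σ : Store} {L L' : List ℕ} (hk : k ∉ P.natWrites)
    (hL : (loop k b P).natWrites ⊆ L) (hL' : P.realWrites ⊆ L') (I : ℕ → Store → Prop)
    (hI : ∀ i τ w, I i τ → I i (τ.setNat k 0 0 w)) (h0 : I 0 σ)
    (hs : ∀ i < σ.nat b 0 0, ∀ τ : Store, Store.Agree L L' σ τ →
      τ.nat k 0 0 = i → I i τ → I (i + 1) (P.run τ)) :
    I (σ.nat b 0 0) ((loop k b P).run σ) :=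
  run_loop hk I hI h0 fun i hi τ h1 h2 =>
    hs i hi τ ⟨fun a ha => h1 a fun h => ha (hL h), fun a ha => h2 a fun h => ha (hL' h)⟩

/-- Do nothing. -/
def skip : Cmd := setNat 29 (.lit 0) (.lit 0) (.lit 0)

@[simp] theorem run_skip (σ : Store) : skip.run σ = σ.setNat 29 0 0 0 := rfl

@[simp] theorem run_setNat (a : ℕ) (i j e : NatExp) (σ : Store) :
    (setNat a i j e).run σ = σ.setNat a (i.eval σ) (j.eval σ) (e.eval σ) := rfl

@[simp] theorem run_setReal (a : ℕ) (i j : NatExp) (e : RealExp) (σ : Store) :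
    (setReal a i j e).run σ = σ.setReal a (i.eval σ) (j.eval σ) (e.eval σ) := rfl

@[simp] theorem run_seq (P Q : Cmd) (σ : Store) : (seq P Q).run σ = Q.run (P.run σ) := rfl

theorem run_ite (b : Test) (P Q : Cmd) (σ : Store) [Decidable (b.Holds σ)] :
    (ite b P Q).run σ = if b.Holds σ then P.run σ else Q.run σ := by
  rw [run]
  congr

theorem run_ite_pos {b : Test} {σ : Store} (h : b.Holds σ) (P Q : Cmd) :
    (ite b P Q).run σ = P.run σ := if_pos h

theorem run_ite_neg {b : Test} {σ : Store} (h : ¬ b.Holds σ) (P Q : Cmd) :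
    (ite b P Q).run σ = Q.run σ := if_neg h

/-- A loop whose passes establish independent properties establishes all of them. -/
theorem run_loop_forall {k b : ℕ} {P : Cmd} {σ : Store} {L L' : List ℕ} (hk : k ∉ P.natWrites)
    (hL : (loop k b P).natWrites ⊆ L) (hL' : P.realWrites ⊆ L') (Q : ℕ → Store → Prop)
    (hQ : ∀ i τ w, Q i τ → Q i (τ.setNat k 0 0 w))
    (hs : ∀ i < σ.nat b 0 0, ∀ τ : Store, Store.Agree L L' σ τ →
      τ.nat k 0 0 = i → Q i (P.run τ) ∧ ∀ j < i, Q j τ → Q j (P.run τ)) :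
    ∀ i < σ.nat b 0 0, Q i ((loop k b P).run σ) := by
  refine run_loop_agree (L := L) (L' := L') hk hL hL' (fun m τ => ∀ i < m, Q i τ)
    (fun i τ w h j hj => hQ _ _ _ (h j hj)) (by simp) fun i hi τ h1 h2 h3 j hj => ?_
  obtain ⟨h4, h5⟩ := hs i hi τ h1 h2
  rcases Nat.lt_succ_iff_lt_or_eq.1 hj with h | rfl
  · exact h5 j h (h3 j h)
  · exact h4

/-! #### Characteristic vectors -/

/-- Write the truth values of `t` for the values of the counter `20` into the array `a`. -/
def fill (a b : ℕ) (t : Test) : Cmd :=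
  loop 20 b (ite t (setNat a (cell 20) (.lit 0) (.lit 1)) (setNat a (cell 20) (.lit 0) (.lit 0)))

theorem run_fill {a b : ℕ} {t : Test} {σ : Store} (ha : a ≠ 20) {p : ℕ → Prop}
    (ht : ∀ τ : Store, Store.Agree [20, a] [] σ τ → τ.nat 20 0 0 < σ.nat b 0 0 →
      (t.Holds τ ↔ p (τ.nat 20 0 0))) :
    ∀ i < σ.nat b 0 0, (1 ≤ ((fill a b t).run σ).nat a i 0 ↔ p i) := by
  refine run_loop_forall (L := [20, a]) (L' := []) ?_ ?_ ?_
    (fun i τ => 1 ≤ τ.nat a i 0 ↔ p i) ?_ ?_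
  · simpa [natWrites] using ha.symm
  · intro; simp [natWrites]
  · intro; simp [realWrites]
  · intro i τ w h
    rwa [Store.nat_setNat_of_ne _ ha]
  · intro i hi τ hag hk
    subst hk
    have h := ht τ hag hi
    by_cases hp : p (τ.nat 20 0 0)
    · rw [run_ite_pos (h.2 hp)]
      refine ⟨by simpa using hp, fun j hj h' => ?_⟩
      rw [run_setNat, Store.nat_setNat, if_neg (by simp; omega)]
      exact h'
    · rw [run_ite_neg (fun h' => hp (h.1 h'))]
      refine ⟨by simpa using hp, fun j hj h' => ?_⟩
      rw [run_setNat, Store.nat_setNat, if_neg (by simp; omega)]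
      exact h'

/-! #### Sums -/

/-- Write the sum of the values of `e` over those values of the counter `20` for which the test
`t` holds into the entry `i` of the array `a`. -/
def sumAt (a : ℕ) (i : NatExp) (b : ℕ) (t : Test) (e : RealExp) : Cmd :=
  -- The only real constant of the machine is `1`, so zero is produced as a difference.
  seq (setReal a i (.lit 0) (.sub .one .one))
    (loop 20 b (ite t (setReal a i (.lit 0) (.add (.vec a i) e)) skip))

open Classical in
-- Since `code` is injective, a pass adds either the term of the unique index coded by the counter
-- or nothing; the test rejects values that are not codes.
theorem run_sumAt {α : Type*} [Fintype α] {code : α → ℕ} (hinj : Function.Injective code)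
    {a b j : ℕ} {i : NatExp} {t : Test} {e : RealExp} {σ : Store}
    (hcode : ∀ x, code x < σ.nat b 0 0) {q : α → Prop} [DecidablePred q] {g : α → ℝ}
    (hi : ∀ τ : Store, Store.Agree [20, 29] [a] σ τ → i.eval τ = j)
    (ht : ∀ τ : Store, Store.Agree [20, 29] [a] σ τ → τ.nat 20 0 0 < σ.nat b 0 0 →
      (t.Holds τ ↔ ∃ x, code x = τ.nat 20 0 0 ∧ q x))
    (he : ∀ τ : Store, Store.Agree [20, 29] [a] σ τ → ∀ x, q x → code x = τ.nat 20 0 0 →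
      e.eval τ = g x) :
    ((sumAt a i b t e).run σ).real a j 0 = ∑ x with q x, g x := by
  have hag0 : Store.Agree [20, 29] [a] σ (σ.setReal a j 0 0) :=
    (Store.Agree.refl _ _ _).setReal (by simp) _ _ _
  have key := run_loop_agree (k := 20) (b := b) (σ := σ.setReal a j 0 0)
    (P := ite t (setReal a i (.lit 0) (.add (.vec a i) e)) skip) (L := [20, 29]) (L' := [a])
    (by simp [natWrites, skip]) (by intro; simp [natWrites, skip])
    (by intro; simp [realWrites, skip])
    (fun m τ => τ.real a j 0 = ∑ x with q x ∧ code x < m, g x)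
    (fun i τ w h => h) (by simp [Store.real_setReal]) ?_
  · have hN : (σ.setReal a j 0 0).nat b 0 0 = σ.nat b 0 0 := rfl
    have hrun : (sumAt a i b t e).run σ = (loop 20 b (ite t (setReal a i (.lit 0)
        (.add (.vec a i) e)) skip)).run (σ.setReal a j 0 0) := by
      simp only [sumAt, run_seq, run_setReal, NatExp.eval_lit, RealExp.eval_sub, sub_self,
        hi σ (Store.Agree.refl _ _ _)]
    rw [hrun]
    refine key.trans ?_
    refine Finset.sum_congr ?_ fun _ _ => rfl
    ext x
    rw [Finset.mem_filter, Finset.mem_filter]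
    exact and_congr_right fun _ => and_iff_left (hcode x)
  · intro m hm τ hag hk h1
    have hag' := hag0.trans hag
    subst hk
    by_cases h : ∃ x, code x = τ.nat 20 0 0 ∧ q x
    · obtain ⟨x, hx, hqx⟩ := h
      rw [run_ite_pos ((ht τ hag' hm).2 ⟨x, hx, hqx⟩), run_setReal, hi τ hag', RealExp.eval_add,
        RealExp.eval_vec, hi τ hag', he τ hag' x hqx hx]
      have hS : (Finset.univ.filter fun y => q y ∧ code y < τ.nat 20 0 0 + 1) =
          insert x (Finset.univ.filter fun y => q y ∧ code y < τ.nat 20 0 0) := by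
        ext y
        simp only [Finset.mem_filter, Finset.mem_univ, true_and, Finset.mem_insert]
        constructor
        · rintro ⟨h3, h4⟩
          rcases Nat.lt_succ_iff_lt_or_eq.1 h4 with h5 | h5
          · exact Or.inr ⟨h3, h5⟩
          · exact Or.inl (hinj (h5.trans hx.symm))
        · rintro (rfl | ⟨h3, h4⟩)
          · exact ⟨hqx, by omega⟩
          · exact ⟨h3, by omega⟩
      simp only [NatExp.eval_lit, Store.real_setReal, and_self, if_true]
      rw [hS, Finset.sum_insert (by simp [hx]), h1, add_comm]
    · rw [run_ite_neg (fun h' => h ((ht τ hag' hm).1 h')), run_skip]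
      rw [Store.real_setNat, h1]
      refine Finset.sum_congr ?_ fun _ _ => rfl
      ext y
      simp only [Finset.mem_filter, Finset.mem_univ, true_and]
      refine ⟨fun ⟨h3, h4⟩ => ⟨h3, by omega⟩, fun ⟨h3, h4⟩ => ⟨h3, ?_⟩⟩
      rcases Nat.lt_succ_iff_lt_or_eq.1 h4 with h5 | h5
      · exact h5
      · exact absurd ⟨y, h5, h3⟩ h

theorem real_run_sumAt_of_ne {a b j : ℕ} {i : NatExp} {t : Test} {e : RealExp} {σ : Store}
    (hi : ∀ τ : Store, Store.Agree [20, 29] [a] σ τ → i.eval τ = j) {j' : ℕ} (hj : j' ≠ j) :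
    ((sumAt a i b t e).run σ).real a j' 0 = σ.real a j' 0 := by
  have hag0 : Store.Agree [20, 29] [a] σ (σ.setReal a j 0 0) :=
    (Store.Agree.refl _ _ _).setReal (by simp) _ _ _
  have key := run_loop_agree (k := 20) (b := b) (σ := σ.setReal a j 0 0)
    (P := ite t (setReal a i (.lit 0) (.add (.vec a i) e)) skip) (L := [20, 29]) (L' := [a])
    (by simp [natWrites, skip]) (by intro; simp [natWrites, skip])
    (by intro; simp [realWrites, skip])
    (fun m τ => τ.real a j' 0 = σ.real a j' 0) (fun i τ w h => h)
    (by rw [Store.real_setReal, if_neg (by simpa using hj)]) ?_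
  · have hrun : (sumAt a i b t e).run σ = (loop 20 b (ite t (setReal a i (.lit 0)
        (.add (.vec a i) e)) skip)).run (σ.setReal a j 0 0) := by
      simp only [sumAt, run_seq, run_setReal, NatExp.eval_lit, RealExp.eval_sub, sub_self,
        hi σ (Store.Agree.refl _ _ _)]
    rw [hrun]
    exact key
  · intro m hm τ hag hk h
    by_cases ht : t.Holds τ
    · rw [run_ite_pos ht, run_setReal, hi τ (hag0.trans hag), Store.real_setReal,
        if_neg (by simpa using hj), h]
    · rw [run_ite_neg ht, run_skip]
      exact h

/-- Rows computed one after the other by passes of a loop that leave the other rows alone. -/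
theorem run_rows {α : Type*} {code : α → ℕ} {a b k : ℕ} {P : Cmd} {σ : Store} {L L' : List ℕ}
    (hcode : ∀ x, code x < σ.nat b 0 0) (hk : k ∉ P.natWrites)
    (hL : (loop k b P).natWrites ⊆ L) (hL' : P.realWrites ⊆ L') {f : α → ℝ}
    (h1 : ∀ x, ∀ τ : Store, Store.Agree L L' σ τ → τ.nat k 0 0 = code x →
      (P.run τ).real a (code x) 0 = f x)
    (h2 : ∀ τ : Store, Store.Agree L L' σ τ → ∀ j ≠ τ.nat k 0 0,
      (P.run τ).real a j 0 = τ.real a j 0) (x : α) :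
    ((loop k b P).run σ).real a (code x) 0 = f x := by
  refine run_loop_forall (L := L) (L' := L') hk hL hL'
    (fun i τ => ∀ x, code x = i → τ.real a (code x) 0 = f x) (fun i τ w h => h) ?_
    (code x) (hcode x) x rfl
  intro i hi τ hag hi'
  refine ⟨fun x hx => h1 x τ hag (hi'.trans hx.symm), fun j hj hQ x hx => ?_⟩
  rw [h2 τ hag _ (by omega)]
  exact hQ x hx

/-! #### Minima -/

/-- Find a value of the counter `20` for which `t` holds and the entry of the array `a` is
minimal: it is written into the cell `28`, and the cell `27` tells whether it exists. -/
def cheapest (a b : ℕ) (t : Test) : Cmd :=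
  seq (setNat 27 (.lit 0) (.lit 0) (.lit 0))
    (loop 20 b (ite (.and t (.or (.eq (cell 27) (.lit 0))
        (.not (.realLE (.vec a (cell 28)) (.vec a (cell 20))))))
      (seq (setNat 28 (.lit 0) (.lit 0) (cell 20)) (setNat 27 (.lit 0) (.lit 0) (.lit 1))) skip))

theorem run_cheapest {α : Type*} {code : α → ℕ} (hinj : Function.Injective code)
    {a b : ℕ} {t : Test} {σ : Store} (hb : b ∉ [20, 27, 28, 29])
    (hcode : ∀ x, code x < σ.nat b 0 0) {q : α → Prop} {κ : α → ℝ}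
    (ht : ∀ τ : Store, Store.Agree [20, 27, 28, 29] [] σ τ → τ.nat 20 0 0 < σ.nat b 0 0 →
      (t.Holds τ ↔ ∃ x, code x = τ.nat 20 0 0 ∧ q x))
    (hκ : ∀ x, σ.real a (code x) 0 = κ x) :
    (((cheapest a b t).run σ).nat 27 0 0 = 0 ∧ ∀ x, ¬ q x) ∨
    (((cheapest a b t).run σ).nat 27 0 0 = 1 ∧ ∃ x, q x ∧ (∀ y, q y → κ x ≤ κ y) ∧
      ((cheapest a b t).run σ).nat 28 0 0 = code x) := by
  have hag0 : Store.Agree [20, 27, 28, 29] [] σ (σ.setNat 27 0 0 0) :=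
    (Store.Agree.refl _ _ _).setNat (by simp) _ _ _
  have hb27 : b ≠ 27 := by
    rintro rfl
    simp at hb
  have hN : (σ.setNat 27 0 0 0).nat b 0 0 = σ.nat b 0 0 := by
    rw [Store.nat_setNat_of_ne _ hb27]
  have key := run_loop_agree (k := 20) (b := b) (σ := σ.setNat 27 0 0 0)
    (P := ite (.and t (.or (.eq (cell 27) (.lit 0))
        (.not (.realLE (.vec a (cell 28)) (.vec a (cell 20))))))
      (seq (setNat 28 (.lit 0) (.lit 0) (cell 20)) (setNat 27 (.lit 0) (.lit 0) (.lit 1))) skip)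
    (L := [20, 27, 28, 29]) (L' := [])
    (by simp [natWrites, skip]) (by intro; simp [natWrites, skip]; tauto)
    (by intro; simp [realWrites, skip])
    (fun m τ => (τ.nat 27 0 0 = 0 ∧ ∀ x, q x → m ≤ code x) ∨
      (τ.nat 27 0 0 = 1 ∧ ∃ x, q x ∧ (∀ y, q y → code y < m → κ x ≤ κ y) ∧
      τ.nat 28 0 0 = code x)) ?_ (Or.inl ⟨by simp, by simp⟩) ?_
  · rw [hN] at key
    rcases key with ⟨h1, h2⟩ | ⟨h1, x, h2, h3, h4⟩
    · exact Or.inl ⟨h1, fun x hx => absurd (hcode x) (not_lt.2 (h2 x hx))⟩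
    · exact Or.inr ⟨h1, x, h2, fun y hy => h3 y hy (hcode y), h4⟩
  · intro m τ w h
    rwa [Store.nat_setNat_of_ne _ (by norm_num), Store.nat_setNat_of_ne _ (by norm_num)]
  · intro m hm τ hag hk hI
    have hag' := hag0.trans hag
    rw [hN] at hm
    subst hk
    have hcost : ∀ x, τ.real a (code x) 0 = κ x := fun x => by
      rw [hag'.2 a (by simp), hκ]
    have ht' := ht τ hag' hm
    by_cases hq : ∃ x, code x = τ.nat 20 0 0 ∧ q x
    · obtain ⟨x, hx, hqx⟩ := hq
      by_cases hbetter : τ.nat 27 0 0 = 0 ∨ ¬ τ.real a (τ.nat 28 0 0) 0 ≤ κ x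
      · rw [run_ite_pos (by
          simp only [Test.holds_and, Test.holds_or, Test.holds_eq, eval_cell, NatExp.eval_lit,
            Test.holds_not, Test.holds_realLE, RealExp.eval_vec, ← hx, hcost]
          exact ⟨ht'.2 ⟨x, hx, hqx⟩, hbetter⟩)]
        right
        refine ⟨by simp, x, hqx, fun y hy hlt => ?_, ?_⟩
        · rcases Nat.lt_succ_iff_lt_or_eq.1 hlt with h5 | h5
          · rcases hI with ⟨-, h6⟩ | ⟨h6, x', -, h7, h8⟩
            · exact absurd h5 (not_lt.2 (h6 y hy))
            · rcases hbetter with h9 | h9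
              · omega
              · rw [h8, hcost] at h9
                exact (not_le.1 h9).le.trans (h7 y hy h5)
          · rw [hinj (h5.trans hx.symm)]
        · rw [run_seq, run_setNat, Store.nat_setNat_of_ne _ (by norm_num)]
          simp [hx]
      · rw [run_ite_neg (by
          simp only [Test.holds_and, Test.holds_or, Test.holds_eq, eval_cell, NatExp.eval_lit,
            Test.holds_not, Test.holds_realLE, RealExp.eval_vec, ← hx, hcost]
          exact fun h => hbetter (And.right h)), run_skip, Store.nat_setNat_of_ne _ (by norm_num),
          Store.nat_setNat_of_ne _ (by norm_num)]
        push Not at hbetter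
        rcases hI with ⟨h6, -⟩ | ⟨h6, x', h6', h7, h8⟩
        · exact absurd h6 hbetter.1
        · refine Or.inr ⟨h6, x', h6', fun y hy hlt => ?_, h8⟩
          rcases Nat.lt_succ_iff_lt_or_eq.1 hlt with h5 | h5
          · exact h7 y hy h5
          · rw [hinj (h5.trans hx.symm), ← hcost x', ← h8]
            exact hbetter.2
    · rw [run_ite_neg (fun h => hq (ht'.1 ((Test.holds_and _ _ _).1 h).1)), run_skip,
        Store.nat_setNat_of_ne _ (by norm_num), Store.nat_setNat_of_ne _ (by norm_num)]
      rcases hI with ⟨h6, h7⟩ | ⟨h6, x', h6', h7, h8⟩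
      · refine Or.inl ⟨h6, fun x hx => ?_⟩
        rcases (h7 x hx).eq_or_lt with h | h
        · exact absurd ⟨x, h.symm, hx⟩ hq
        · exact h
      · refine Or.inr ⟨h6, x', h6', fun y hy hlt => ?_, h8⟩
        rcases Nat.lt_succ_iff_lt_or_eq.1 hlt with h5 | h5
        · exact h7 y hy h5
        · exact absurd ⟨y, h5, hy⟩ hq

/-! #### Classes of an equivalence relation -/

/-- Replace the label in the cell `25` by the one in the cell `26`. -/
def relabel (b lab : ℕ) : Cmd :=
  loop 22 b (ite (.eq (.vec lab (cell 22)) (cell 25)) (setNat lab (cell 22) (.lit 0) (cell 26))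
    skip)

/-- The old and the new label are read from separate cells, which stay fixed while the entries of
`lab` are overwritten. -/
theorem run_relabel {b lab : ℕ} (hlab : lab ∉ [20, 21, 22, 25, 26, 29]) (σ : Store) :
    ∀ i < σ.nat b 0 0, ((relabel b lab).run σ).nat lab i 0 =
      if σ.nat lab i 0 = σ.nat 25 0 0 then σ.nat 26 0 0 else σ.nat lab i 0 := by
  simp only [List.mem_cons, List.not_mem_nil, or_false, not_or] at hlab
  obtain ⟨h20, h21, h22, h25, h26, h29⟩ := hlab
  have key := run_loop_agree (k := 22) (b := b) (σ := σ)
    (P := ite (.eq (.vec lab (cell 22)) (cell 25)) (setNat lab (cell 22) (.lit 0) (cell 26)) skip)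
    (L := [22, lab, 29]) (L' := []) (by simp [natWrites, skip]; tauto)
    (by intro; simp [natWrites, skip]) (by intro; simp [realWrites, skip])
    (fun m τ => ∀ i, τ.nat lab i 0 = if i < m ∧ σ.nat lab i 0 = σ.nat 25 0 0 then σ.nat 26 0 0
      else σ.nat lab i 0) ?_ (by simp) ?_
  · intro i hi
    exact (key i).trans (by simp [hi])
  · intro m τ w h i
    rw [Store.nat_setNat_of_ne _ h22, h i]
  · intro m hm τ hag hk hI i
    have h25' : τ.nat 25 = σ.nat 25 := hag.1 25 (by simp; omega)
    have h26' : τ.nat 26 = σ.nat 26 := hag.1 26 (by simp; omega)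
    have hm' : τ.nat lab m 0 = σ.nat lab m 0 := by simp [hI m]
    by_cases h : σ.nat lab m 0 = σ.nat 25 0 0
    · rw [run_ite_pos (by simp [hk, hm', h, h25']), run_setNat, Store.nat_setNat]
      simp only [eval_cell, NatExp.eval_lit, and_true, hk, h26']
      by_cases him : i = m
      · simp [him, h]
      · rw [if_neg him, hI i]
        have : i < m + 1 ↔ i < m := by omega
        simp only [this]
    · rw [run_ite_neg (by simp [hk, hm', h, h25']), run_skip, Store.nat_setNat_of_ne _ h29, hI i]
      by_cases him : i = m
      · simp [him, h]
      · have : i < m + 1 ↔ i < m := by omega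
        simp only [this]

/-- Label the classes of the equivalence relation generated by the pairs of values of
the counters `20` and `21` for which the test `t` holds. -/
def labels (b lab : ℕ) (t : Test) : Cmd :=
  seq (loop 20 b (setNat lab (cell 20) (.lit 0) (cell 20)))
    (loop 20 b (loop 21 b (ite t
      (seq (setNat 25 (.lit 0) (.lit 0) (.vec lab (cell 20)))
        (seq (setNat 26 (.lit 0) (.lit 0) (.vec lab (cell 21))) (relabel b lab))) skip)))

/-- Equal labels always imply equivalence, equal labels stay equal because relabelling acts on
values, and the pass for a generating pair makes its labels equal. After all pairs, the labels
distinguish exactly the classes. -/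
theorem run_labels {α : Type*} {code : α → ℕ} (hinj : Function.Injective code)
    {b lab : ℕ} {t : Test} {σ : Store} (hlab : lab ∉ [20, 21, 22, 25, 26, 29])
    (hb : b ∉ [20, 21, 22, 25, 26, 29, lab])
    (hcode : ∀ x, code x < σ.nat b 0 0) {s : α → α → Prop}
    (ht : ∀ τ : Store, Store.Agree [20, 21, 22, 25, 26, 29, lab] [] σ τ →
      τ.nat 20 0 0 < σ.nat b 0 0 → τ.nat 21 0 0 < σ.nat b 0 0 →
      (t.Holds τ ↔ ∃ x y, code x = τ.nat 20 0 0 ∧ code y = τ.nat 21 0 0 ∧ s x y)) (x y : α) :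
    ((labels b lab t).run σ).nat lab (code x) 0 = ((labels b lab t).run σ).nat lab (code y) 0 ↔
      Relation.EqvGen s x y := by
  have hlab' := hlab
  simp only [List.mem_cons, List.not_mem_nil, or_false, not_or] at hlab'
  obtain ⟨h20, h21, h22, h25, h26, h29⟩ := hlab'
  set N := σ.nat b 0 0 with hN
  set P1 : Cmd := loop 20 b (setNat lab (cell 20) (.lit 0) (cell 20)) with hP1
  set M : Cmd := seq (setNat 25 (.lit 0) (.lit 0) (.vec lab (cell 20)))
        (seq (setNat 26 (.lit 0) (.lit 0) (.vec lab (cell 21))) (relabel b lab)) with hM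
  set L : List ℕ := [20, 21, 22, 25, 26, 29, lab] with hL
  set Q : Store → Prop := fun τ => ∀ x y, τ.nat lab (code x) 0 = τ.nat lab (code y) 0 →
    Relation.EqvGen s x y with hQ
  have hbL : ∀ τ, Store.Agree L [] σ τ → τ.nat b 0 0 = N := fun τ h => by rw [h.1 b hb]
  -- the effect of a merging step
  have hmerge : ∀ τ : Store, Store.Agree L [] σ τ → ∀ x, (M.run τ).nat lab (code x) 0 =
      if τ.nat lab (code x) 0 = τ.nat lab (τ.nat 20 0 0) 0 then τ.nat lab (τ.nat 21 0 0) 0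
        else τ.nat lab (code x) 0 := by
    intro τ hag x
    rw [hM, run_seq, run_seq, run_setNat, run_setNat, run_relabel hlab]
    · simp only [eval_cell, NatExp.eval_lit, NatExp.eval_vec,
        Store.nat_setNat_self, Store.nat_setNat_of_ne _ (show 21 ≠ 25 by norm_num),
        Store.nat_setNat_of_ne _ (show 25 ≠ 26 by norm_num), Store.nat_setNat_of_ne _ h25,
        Store.nat_setNat_of_ne _ h26]
    · have : ∀ ρ, Store.Agree L [] σ ρ → code x < ρ.nat b 0 0 := fun ρ h => by
        rw [hbL ρ h]; exact hcode x
      exact this _ ((hag.setNat (by simp [hL]) _ _ _).setNat (by simp [hL]) _ _ _)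
  set R : Cmd := ite t M skip with hR
  have hRw : R.natWrites ⊆ L := by
    intro a
    simp [hR, hM, natWrites, skip, relabel, hL]
    tauto
  have hRr : R.realWrites ⊆ [] := by
    intro a
    simp [hR, hM, realWrites, skip, relabel]
  have hQset : ∀ τ a w, a ≠ lab → Q τ → Q (τ.setNat a 0 0 w) := by
    intro τ a w ha h x y
    rw [Store.nat_setNat_of_ne _ (Ne.symm ha)]
    exact h x y
  -- a step is sound, keeps equal labels equal and makes the labels of the pair equal
  have hstep : ∀ τ : Store, Store.Agree L [] σ τ → τ.nat 20 0 0 < N → τ.nat 21 0 0 < N →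
      (Q τ → Q (R.run τ)) ∧
      (∀ x y, τ.nat lab (code x) 0 = τ.nat lab (code y) 0 →
        (R.run τ).nat lab (code x) 0 = (R.run τ).nat lab (code y) 0) ∧
      (∀ x y, code x = τ.nat 20 0 0 → code y = τ.nat 21 0 0 → s x y →
        (R.run τ).nat lab (code x) 0 = (R.run τ).nat lab (code y) 0) := by
    intro τ hag hk hl
    have ht' := ht τ hag hk hl
    by_cases h : ∃ x y, code x = τ.nat 20 0 0 ∧ code y = τ.nat 21 0 0 ∧ s x y
    · obtain ⟨x0, y0, hx0, hy0, hs⟩ := h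
      rw [hR, run_ite_pos (ht'.2 ⟨x0, y0, hx0, hy0, hs⟩)]
      have hm := hmerge τ hag
      rw [← hx0, ← hy0] at hm
      refine ⟨fun hq x y => ?_, fun x y hxy => ?_, fun x y hx hy _ => ?_⟩
      · rw [hm x, hm y]
        have e := Relation.EqvGen.rel _ _ hs
        split_ifs with h1 h2 h2
        · exact fun _ => .trans _ _ _ (hq _ _ h1) (.symm _ _ (hq _ _ h2))
        · exact fun h3 => .trans _ _ _ (hq _ _ h1) (.trans _ _ _ e (hq _ _ h3))
        · exact fun h3 => .trans _ _ _ (hq _ _ h3)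
            (.trans _ _ _ (.symm _ _ e) (.symm _ _ (hq _ _ h2)))
        · exact fun h3 => hq _ _ h3
      · rw [hm x, hm y, hxy]
      · rw [hm x, hm y, hinj (hx.trans hx0.symm), hinj (hy.trans hy0.symm)]
        simp
    · rw [hR, run_ite_neg (fun h' => h (ht'.1 h')), run_skip]
      have e : (τ.setNat 29 0 0 0).nat lab = τ.nat lab := Store.nat_setNat_of_ne _ h29 _ _ _
      rw [e]
      exact ⟨hQset _ _ _ (Ne.symm h29), fun x y h => h, fun x y h1 h2 h3 =>
        absurd ⟨x, y, h1, h2, h3⟩ h⟩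
  -- initially all labels are different
  have hinit : ∀ i < N, (P1.run σ).nat lab i 0 = i := by
    refine run_loop_forall (L := [20, lab]) (L' := []) ?_ ?_ ?_
      (fun i τ => τ.nat lab i 0 = i) ?_ ?_
    · simpa [natWrites] using Ne.symm h20
    · intro; simp [natWrites]
    · intro; simp [realWrites]
    · intro i τ w h
      rwa [Store.nat_setNat_of_ne _ h20]
    · intro i hi τ hag hk
      refine ⟨by simp [hk], fun j hj h' => ?_⟩
      rw [run_setNat, Store.nat_setNat, if_neg (by simp; omega)]
      exact h'
  set ρ := P1.run σ with hρ
  have hρag : Store.Agree L [] σ ρ := (P1.agree_run σ).mono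
    (by intro a; simp [hP1, natWrites, hL]; tauto) (by intro a; simp [hP1, realWrites])
  have hQ0 : Q ρ := by
    intro x y
    rw [hinit _ (hcode x), hinit _ (hcode y)]
    intro h
    rw [hinj h]
    exact .refl _
  have hinner : ∀ τ : Store, Store.Agree L [] σ τ → τ.nat 20 0 0 < N →
      (Q τ → Q ((loop 21 b R).run τ)) ∧
      (∀ x y, τ.nat lab (code x) 0 = τ.nat lab (code y) 0 →
        ((loop 21 b R).run τ).nat lab (code x) 0 = ((loop 21 b R).run τ).nat lab (code y) 0) ∧
      (∀ x y, code x = τ.nat 20 0 0 → s x y →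
        ((loop 21 b R).run τ).nat lab (code x) 0 = ((loop 21 b R).run τ).nat lab (code y) 0) := by
    intro τ hag hk
    have key := run_loop_agree (k := 21) (b := b) (σ := τ) (P := R)
      (L := L) (L' := []) (by simp [hR, hM, natWrites, skip, relabel]; tauto)
      (by intro a; simp only [natWrites, List.mem_cons]
          rintro (rfl | h)
          exacts [by simp [hL], hRw h]) hRr
      (fun m τ' => (τ'.nat 20 0 0 = τ.nat 20 0 0) ∧ (Q τ → Q τ') ∧
        (∀ x y, τ.nat lab (code x) 0 = τ.nat lab (code y) 0 →
          τ'.nat lab (code x) 0 = τ'.nat lab (code y) 0) ∧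
        (∀ x y, code x = τ.nat 20 0 0 → code y < m → s x y →
          τ'.nat lab (code x) 0 = τ'.nat lab (code y) 0))
      (fun m τ' w h => by
        rw [Store.nat_setNat_of_ne _ h21, Store.nat_setNat_of_ne _ (by norm_num)]
        exact ⟨h.1, fun h' => hQset _ _ _ (Ne.symm h21) (h.2.1 h'), h.2.2⟩)
      ⟨rfl, fun h => h, fun x y h => h, fun x y _ h => absurd h (Nat.not_lt_zero _)⟩ ?_
    · rw [hbL τ hag] at key
      exact ⟨key.2.1, key.2.2.1, fun x y hx h => key.2.2.2 x y hx (hcode y) h⟩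
    · intro m hm τ' hag' hl ⟨h1, h2, h3, h4⟩
      rw [hbL τ hag] at hm
      obtain ⟨g1, g2, g3⟩ := hstep τ' (hag.trans hag') (by rwa [h1]) (by rwa [hl])
      refine ⟨?_, fun h => g1 (h2 h), fun x y h => g2 _ _ (h3 x y h), fun x y hx hy h => ?_⟩
      · rw [nat_run_of_notMem, h1]
        simp [hR, hM, natWrites, skip, relabel]
        tauto
      · rcases Nat.lt_succ_iff_lt_or_eq.1 hy with h5 | h5
        · exact g2 _ _ (h4 x y hx h5 h)
        · exact g3 x y (hx.trans h1.symm) (h5.trans hl.symm) h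
  have hw21 : (loop 21 b R).natWrites ⊆ L := by
    intro a
    simp only [natWrites, List.mem_cons]
    rintro (rfl | h)
    exacts [by simp [hL], hRw h]
  have key := run_loop_agree (k := 20) (b := b) (σ := ρ) (P := loop 21 b R)
    (L := L) (L' := []) (by simp [hR, hM, natWrites, skip, relabel]; tauto)
    (by intro a; simp only [natWrites, List.mem_cons]
        rintro (rfl | rfl | h)
        exacts [by simp [hL], by simp [hL], hRw h]) hRr
    (fun m τ => Q τ ∧ ∀ x y, code x < m → s x y →
      τ.nat lab (code x) 0 = τ.nat lab (code y) 0)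
    (fun m τ w h => ⟨hQset _ _ _ (Ne.symm h20) h.1, by
      rw [Store.nat_setNat_of_ne _ h20]; exact h.2⟩)
    ⟨hQ0, fun x y h => absurd h (Nat.not_lt_zero _)⟩ ?_
  · rw [hbL ρ hρag] at key
    refine ⟨key.1 x y, fun h => ?_⟩
    change ((loop 20 b (loop 21 b R)).run ρ).nat lab (code x) 0 = _
    induction h with
    | rel x y h => exact key.2 x y (hcode x) h
    | refl x => rfl
    | symm x y _ ih => exact ih.symm
    | trans x y z _ _ ih1 ih2 => exact ih1.trans ih2
  · intro m hm τ hag hk ⟨h1, h2⟩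
    rw [hbL ρ hρag] at hm
    obtain ⟨g1, g2, g3⟩ := hinner τ (hρag.trans hag) (by rwa [hk])
    refine ⟨g1 h1, fun x y hx h => ?_⟩
    rcases Nat.lt_succ_iff_lt_or_eq.1 hx with h5 | h5
    · exact g2 _ _ (h2 x y h5 h)
    · exact g3 x y (h5.trans hk.symm) h

end Cmd

end ThinForest

namespace ThinForest

/-! ### Numbering of the flags, and correctness of a round on the machine. -/

section Encoding

set_option linter.unusedSectionVars false

open Classical Finset Cmd

variable {V : Type*} [Fintype V] [LinearOrder V] {G : SimpleGraph V} {n : ℕ} (ν : V ≃o Fin n)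

/-- The number of a flag. -/
def code (x : Flag G) : ℕ := 2 * (n * ν x.1.fst + ν x.1.snd) + x.2.toNat

theorem mul_add_inj {a b c d : ℕ} (hb : b < n) (hd : d < n) (h : n * a + b = n * c + d) :
    a = c ∧ b = d := by
  have h1 := congrArg (· / n) h
  have h2 := congrArg (· % n) h
  have hn : 0 < n := by omega
  simp only [Nat.mul_add_div hn, Nat.div_eq_of_lt hb, Nat.div_eq_of_lt hd, Nat.mul_add_mod,
    Nat.mod_eq_of_lt hb, Nat.mod_eq_of_lt hd] at h1 h2
  exact ⟨by omega, h2⟩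

theorem mul_add_lt {a b : ℕ} (ha : a < n) (hb : b < n) : n * a + b < n * n := by
  have : n * (a + 1) ≤ n * n := Nat.mul_le_mul_left _ ha
  rw [mul_add] at this
  omega

theorem code_lt (x : Flag G) : code ν x < 2 * (n * n) := by
  have := mul_add_lt (ν x.1.fst).2 (ν x.1.snd).2
  have hb := Bool.toNat_le x.2
  simp only [code]
  omega

theorem num_inj {u v : V} : (ν u : ℕ) = ν v ↔ u = v := by
  rw [Fin.val_inj, ν.injective.eq_iff]

theorem num_injective : Function.Injective fun v : V => (ν v : ℕ) := fun _ _ h => (num_inj ν).1 h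

theorem num_lt {u v : V} : (ν u : ℕ) < ν v ↔ u < v := by
  rw [Fin.val_fin_lt, ν.lt_iff_lt]

theorem toNat_inj {a b : Bool} : a.toNat = b.toNat ↔ a = b := by
  cases a <;> cases b <;> simp

theorem dart_eq_iff {d d' : G.Dart} : d = d' ↔ d.fst = d'.fst ∧ d.snd = d'.snd := by
  rw [SimpleGraph.Dart.ext_iff, Prod.ext_iff]

theorem code_injective : Function.Injective (code ν : Flag G → ℕ) := by
  intro x y h
  have hx := Bool.toNat_le x.2
  have hy := Bool.toNat_le y.2
  simp only [code] at h
  obtain ⟨h1, h2⟩ := mul_add_inj (ν x.1.snd).2 (ν y.1.snd).2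
    (show n * (ν x.1.fst : ℕ) + ν x.1.snd = n * ν y.1.fst + ν y.1.snd by omega)
  exact Prod.ext (dart_eq_iff.2 ⟨(num_inj ν).1 h1, (num_inj ν).1 h2⟩) (toNat_inj.1 (by omega))

variable (E : Embedding G) (z κ : Sym2 V → ℝ) (T : SimpleGraph V) (σ : Store)

/-- The memory holds the number of vertices, the embedding, and tables that describe
the flags. -/
structure Tables : Prop where
  size : σ.nat 0 0 0 = n
  count : σ.nat 5 0 0 = 2 * (n * n)
  rot : ∀ d : G.Dart, σ.nat 2 (ν d.fst) (ν d.snd) = ν (E.rot d).snd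
  twisted : ∀ d : G.Dart, 1 ≤ σ.nat 3 (ν d.fst) (ν d.snd) ↔ E.twisted d.edge = true
  fst : ∀ x : Flag G, σ.nat 6 (code ν x) 0 = ν x.1.fst
  snd : ∀ x : Flag G, σ.nat 7 (code ν x) 0 = ν x.1.snd
  bit : ∀ x : Flag G, σ.nat 8 (code ν x) 0 = x.2.toNat
  cross : ∀ x : Flag G, σ.nat 9 (code ν x) 0 = code ν (cross x)
  dart : ∀ a < 2 * (n * n), 1 ≤ σ.nat 10 a 0 ↔ ∃ x : Flag G, code ν x = a
  weight : ∀ x : Flag G, σ.real 2 (code ν x) 0 = z x.1.edge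
  cost : ∀ x : Flag G, σ.real 3 (code ν x) 0 = κ x.1.edge

variable {ν E z κ σ} in
theorem Tables.agree (h : Tables ν E z κ σ) {L L' : List ℕ} {τ : Store}
    (hag : Store.Agree L L' σ τ) (hL : ∀ a ∈ [0, 2, 3, 5, 6, 7, 8, 9, 10], a ∉ L)
    (hL' : ∀ a ∈ [2, 3], a ∉ L') : Tables ν E z κ τ := by
  have h1 : ∀ a ∈ [0, 2, 3, 5, 6, 7, 8, 9, 10], τ.nat a = σ.nat a := fun a ha => hag.1 a (hL a ha)
  have h2 : ∀ a ∈ [2, 3], τ.real a = σ.real a := fun a ha => hag.2 a (hL' a ha)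
  constructor
  · rw [h1 0 (by decide)]; exact h.size
  · rw [h1 5 (by decide)]; exact h.count
  · rw [h1 2 (by decide)]; exact h.rot
  · rw [h1 3 (by decide)]; exact h.twisted
  · rw [h1 6 (by decide)]; exact h.fst
  · rw [h1 7 (by decide)]; exact h.snd
  · rw [h1 8 (by decide)]; exact h.bit
  · rw [h1 9 (by decide)]; exact h.cross
  · rw [h1 10 (by decide)]; exact h.dart
  · rw [h2 2 (by decide)]; exact h.weight
  · rw [h2 3 (by decide)]; exact h.cost

/-- The array `4` holds the adjacency matrix of `T`. -/
def HasTree : Prop := ∀ u v : V, σ.nat 4 (ν u) (ν v) = if T.Adj u v then 1 else 0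

/-- The array `11` holds labels of the components of `T`. -/
def HasComp : Prop := ∀ u v : V, σ.nat 11 (ν u) 0 = σ.nat 11 (ν v) 0 ↔ T.Reachable u v

/-- The array `14` holds labels of the faces. -/
def HasFaces : Prop :=
  ∀ x y : Flag G, σ.nat 14 (code ν x) 0 = σ.nat 14 (code ν y) 0 ↔ E.cl T x = E.cl T y

/-- The array `15` holds the characteristic vector of `ends G T`. -/
def HasEnds : Prop :=
  ∀ a < 2 * (n * n), 1 ≤ σ.nat 15 a 0 ↔ ∃ x : Flag G, code ν x = a ∧ x ∈ ends G T

/-- The array `6` of real numbers holds the numbers of edge sides on the faces. -/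
def HasDeg : Prop := ∀ x : Flag G, σ.real 6 (code ν x) 0 = E.deg T x

/-- The array `4` of real numbers holds the weights of the chains of parallel edges. -/
def HasHair : Prop := ∀ x : Flag G, σ.real 4 (code ν x) 0 = E.hairWeight T z x

/-- The array `18` holds the characteristic vector of the middle edges. -/
def HasMiddle : Prop :=
  ∀ a < 2 * (n * n), 1 ≤ σ.nat 18 a 0 ↔ ∃ x : Flag G, code ν x = a ∧ E.Middle T z x

/-- The array `5` of real numbers holds the weights of the classes of middle edges. -/
def HasPar : Prop := ∀ x : Flag G, σ.real 5 (code ν x) 0 = E.parWeight T z x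

section Agree

variable {ν E z κ T σ} {L L' : List ℕ} {τ : Store} (hag : Store.Agree L L' σ τ)

include hag

theorem HasTree.agree (h : HasTree ν T σ) (hL : 4 ∉ L) : HasTree ν T τ := by
  unfold HasTree; rw [hag.1 4 hL]; exact h

theorem HasComp.agree (h : HasComp ν T σ) (hL : 11 ∉ L) : HasComp ν T τ := by
  unfold HasComp; rw [hag.1 11 hL]; exact h

theorem HasFaces.agree (h : HasFaces ν E T σ) (hL : 14 ∉ L) : HasFaces ν E T τ := by
  unfold HasFaces; rw [hag.1 14 hL]; exact h

theorem HasEnds.agree (h : HasEnds (G := G) ν T σ) (hL : 15 ∉ L) : HasEnds (G := G) ν T τ := by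
  unfold HasEnds; rw [hag.1 15 hL]; exact h

theorem HasDeg.agree (h : HasDeg ν E T σ) (hL : 6 ∉ L') : HasDeg ν E T τ := by
  unfold HasDeg; rw [hag.2 6 hL]; exact h

theorem HasHair.agree (h : HasHair ν E z T σ) (hL : 4 ∉ L') : HasHair ν E z T τ := by
  unfold HasHair; rw [hag.2 4 hL]; exact h

theorem HasMiddle.agree (h : HasMiddle ν E z T σ) (hL : 18 ∉ L) : HasMiddle ν E z T τ := by
  unfold HasMiddle; rw [hag.1 18 hL]; exact h

theorem HasPar.agree (h : HasPar ν E z T σ) (hL : 5 ∉ L') : HasPar ν E z T τ := by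
  unfold HasPar; rw [hag.2 5 hL]; exact h

end Agree

/-- For tests that first check a bit stating that a number codes a suitable element and then a
condition on this element. -/
theorem and_iff_exists {α : Type*} {P t : Prop} {p q r : α → Prop} (hP : P ↔ ∃ x, p x ∧ r x)
    (ht : ∀ x, p x → r x → (t ↔ q x)) : P ∧ t ↔ ∃ x, p x ∧ r x ∧ q x := by
  constructor
  · rintro ⟨h1, h2⟩
    obtain ⟨x, hx, hr⟩ := hP.1 h1
    exact ⟨x, hx, hr, (ht x hx hr).1 h2⟩
  · rintro ⟨x, hx, hr, hq⟩
    exact ⟨hP.2 ⟨x, hx, hr⟩, (ht x hx hr).2 hq⟩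

/-! #### Components of the forest -/

/-- Compute the components of `T`. -/
def compCmd : Cmd := labels 0 11 (.pos (.get 4 (cell 20) (cell 21)))

theorem eqvGen_adj_iff {u v : V} : Relation.EqvGen T.Adj u v ↔ T.Reachable u v := by
  constructor
  · intro h
    induction h with
    | rel u v h => exact h.reachable
    | refl u => exact .refl u
    | symm u v _ ih => exact ih.symm
    | trans u v w _ _ ih1 ih2 => exact ih1.trans ih2
  · rintro ⟨p⟩
    induction p with
    | nil => exact .refl _
    | cons h _ ih => exact .trans _ _ _ (.rel _ _ h) ih

variable {ν E z κ T σ}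

theorem hasComp_run (h : Tables ν E z κ σ) (hT : HasTree ν T σ) :
    HasComp ν T (compCmd.run σ) := by
  intro u v
  rw [← eqvGen_adj_iff]
  refine run_labels (num_injective ν) (by decide) (by decide) (fun v => ?_)
    (fun τ hag h1 h2 => ?_) u v
  · rw [h.size]
    exact (ν v).2
  · rw [h.size] at h1 h2
    have hT' := hT.agree hag (by decide)
    obtain ⟨u, hu⟩ := ν.surjective ⟨_, h1⟩
    obtain ⟨v, hv⟩ := ν.surjective ⟨_, h2⟩
    have hu' : (ν u : ℕ) = τ.nat 20 0 0 := by rw [hu]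
    have hv' : (ν v : ℕ) = τ.nat 21 0 0 := by rw [hv]
    simp only [Test.holds_pos, NatExp.eval_get, eval_cell, ← hu', ← hv', hT' u v, num_inj]
    constructor
    · intro h'
      refine ⟨u, v, rfl, rfl, ?_⟩
      by_contra h''
      simp [h''] at h'
    · rintro ⟨u', v', rfl, rfl, h'⟩
      simp [h']

/-! #### Faces -/

/-- The flags with the numbers in the cells `20` and `21` have to be merged. -/
def mergeTest : Test :=
  .or (.and (.and (.pos (.vec 8 (cell 20))) (.not (.pos (.vec 8 (cell 21)))))
      (.and (.eq (.vec 6 (cell 21)) (.vec 6 (cell 20)))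
        (.eq (.vec 7 (cell 21)) (.get 2 (.vec 6 (cell 20)) (.vec 7 (cell 20))))))
  (.or (.and (.and (.eq (.vec 6 (cell 21)) (.vec 7 (cell 20)))
        (.eq (.vec 7 (cell 21)) (.vec 6 (cell 20))))
      (.or (.and (.pos (.get 3 (.vec 6 (cell 20)) (.vec 7 (cell 20))))
          (.eq (.vec 8 (cell 21)) (.vec 8 (cell 20))))
        (.and (.not (.pos (.get 3 (.vec 6 (cell 20)) (.vec 7 (cell 20)))))
          (.not (.eq (.vec 8 (cell 21)) (.vec 8 (cell 20)))))))
    (.and (.and (.not (.pos (.get 4 (.vec 6 (cell 20)) (.vec 7 (cell 20)))))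
        (.eq (.vec 11 (.vec 6 (cell 20))) (.vec 11 (.vec 7 (cell 20)))))
      (.and (.lt (.vec 6 (cell 20)) (.vec 7 (cell 20)))
        (.and (.pos (.vec 8 (cell 20))) (.eq (cell 21) (.vec 9 (cell 20)))))))

/-- Compute the faces. -/
def faceCmd : Cmd :=
  labels 5 14 (.and (.pos (.vec 10 (cell 20))) (.and (.pos (.vec 10 (cell 21))) mergeTest))

/-- A dart is determined by its ends, so merging becomes a condition on vertices and bits, in the
shape evaluated by `mergeTest`. -/
theorem merge_iff {x y : Flag G} : E.Merge T x y ↔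
    ((x.2 = true ∧ ¬ y.2 = true) ∧ y.1.fst = x.1.fst ∧ y.1.snd = (E.rot x.1).snd) ∨
    ((y.1.fst = x.1.snd ∧ y.1.snd = x.1.fst) ∧
      ((E.twisted x.1.edge = true ∧ y.2 = x.2) ∨ (¬ E.twisted x.1.edge = true ∧ ¬ y.2 = x.2))) ∨
    (¬ T.Adj x.1.fst x.1.snd ∧ T.Reachable x.1.fst x.1.snd) ∧ x.1.fst < x.1.snd ∧ x.2 = true ∧
      y = ThinForest.cross x := by
  rw [Embedding.Merge, ← or_assoc]
  refine or_congr ?_ Iff.rfl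
  constructor
  · rintro (⟨d⟩ | ⟨d, b⟩)
    · exact Or.inl ⟨by simp, E.corner_fst (d, true), rfl⟩
    · refine Or.inr ⟨⟨rfl, rfl⟩, ?_⟩
      cases E.twisted d.edge <;> cases b <;> simp
  · obtain ⟨d, b⟩ := x
    obtain ⟨d', b'⟩ := y
    rintro (⟨⟨h1, h2⟩, h3, h4⟩ | ⟨⟨h1, h2⟩, h3⟩)
    · have hd : d' = E.rot d :=
        dart_eq_iff.2 ⟨h3.trans (E.corner_fst (d, true)).symm, h4⟩
      simp only [Bool.not_eq_true] at h1 h2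
      subst hd h1 h2
      exact .corner d
    · have hd : d' = d.symm := dart_eq_iff.2 ⟨h1, h2⟩
      subst hd
      have hb : b' = if E.twisted d.edge then b else !b := by
        dsimp only at h3
        cases ht : E.twisted d.edge <;> cases b <;> cases b' <;> simp_all
      subst hb
      exact .side d b

theorem holds_mergeTest (h : Tables ν E z κ σ) (hT : HasTree ν T σ) (hC : HasComp ν T σ)
    {x y : Flag G} (hx : code ν x = σ.nat 20 0 0) (hy : code ν y = σ.nat 21 0 0) :
    mergeTest.Holds σ ↔ E.Merge T x y := by
  have hb : ∀ b : Bool, 1 ≤ b.toNat ↔ b = true := by decide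
  have hA : 1 ≤ (if T.Adj x.1.fst x.1.snd then 1 else 0) ↔ T.Adj x.1.fst x.1.snd := by
    split_ifs with h' <;> simp [h']
  simp only [merge_iff, mergeTest, Test.holds_or, Test.holds_and, Test.holds_eq, Test.holds_not,
    Test.holds_pos, Test.holds_lt, NatExp.eval_vec, NatExp.eval_get, eval_cell, ← hx, ← hy, h.fst,
    h.snd, h.bit, h.cross, h.rot, h.twisted, hT _ _, hC _ _, num_inj, num_lt, hb, toNat_inj,
    (code_injective ν).eq_iff, hA]

theorem hasFaces_run (h : Tables ν E z κ σ) (hT : HasTree ν T σ) (hC : HasComp ν T σ) :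
    HasFaces ν E T (faceCmd.run σ) := by
  intro x y
  have hcl : E.cl T x = E.cl T y ↔ Relation.EqvGen (E.Merge T) x y :=
    ⟨Quot.eqvGen_exact, Quot.eqvGen_sound⟩
  rw [hcl]
  refine run_labels (code_injective ν) (by decide) (by decide) (fun x => ?_)
    (fun τ hag h1 h2 => ?_) x y
  · rw [h.count]
    exact code_lt ν x
  · rw [h.count] at h1 h2
    have h' := h.agree hag (by decide) (by decide)
    have hT' := hT.agree hag (by decide)
    have hC' := hC.agree hag (by decide)
    simp only [Test.holds_and, Test.holds_pos, NatExp.eval_vec, eval_cell, h'.dart _ h1,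
      h'.dart _ h2]
    constructor
    · rintro ⟨⟨x, hx⟩, ⟨y, hy⟩, hm⟩
      exact ⟨x, y, hx, hy, (holds_mergeTest h' hT' hC' hx hy).1 hm⟩
    · rintro ⟨x, y, hx, hy, hm⟩
      exact ⟨⟨x, hx⟩, ⟨y, hy⟩, (holds_mergeTest h' hT' hC' hx hy).2 hm⟩

/-! #### Edge sides between different components -/

/-- Compute the set of edge sides. -/
def endsCmd : Cmd :=
  fill 15 5 (.and (.pos (.vec 10 (cell 20))) (.and (.lt (.vec 6 (cell 20)) (.vec 7 (cell 20)))
    (.not (.eq (.vec 11 (.vec 6 (cell 20))) (.vec 11 (.vec 7 (cell 20)))))))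

theorem hasEnds_run (h : Tables ν E z κ σ) (hC : HasComp ν T σ) :
    HasEnds (G := G) ν T (endsCmd.run σ) := by
  have hcount := h.count
  intro a ha
  refine run_fill (p := fun a => ∃ x : Flag G, code ν x = a ∧ x ∈ ends G T) (by decide)
    (fun τ hag h1 => ?_) a (by rwa [hcount])
  rw [hcount] at h1
  have h' := h.agree hag (by decide) (by decide)
  have hC' := hC.agree hag (by decide)
  simp only [Test.holds_and, Test.holds_pos, NatExp.eval_vec, eval_cell, h'.dart _ h1,
    Test.holds_lt, Test.holds_not, Test.holds_eq]
  constructor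
  · rintro ⟨⟨x, hx⟩, h2, h3⟩
    rw [← hx, h'.fst, h'.snd, num_lt] at h2
    rw [← hx, h'.fst, h'.snd, hC' _ _] at h3
    exact ⟨x, hx, mem_ends.2 ⟨h2, h3⟩⟩
  · rintro ⟨x, hx, hE⟩
    rw [← hx, h'.fst, h'.snd, num_lt, hC' _ _]
    exact ⟨⟨x, rfl⟩, mem_ends.1 hE⟩

/-- Compute the numbers of edge sides on the faces. -/
def degCmd : Cmd :=
  loop 24 5 (sumAt 6 (cell 24) 5 (.and (.pos (.vec 15 (cell 20)))
    (.eq (.vec 14 (cell 20)) (.vec 14 (cell 24)))) .one)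

theorem hasDeg_run (h : Tables ν E z κ σ) (hF : HasFaces ν E T σ)
    (hE : HasEnds (G := G) ν T σ) : HasDeg ν E T (degCmd.run σ) := by
  have hcount := h.count
  refine run_rows (L := [20, 24, 29]) (L' := [6]) (fun x => by rw [hcount]; exact code_lt ν x)
    (by decide) (by decide) (by decide) (fun x τ hag hx => ?_) (fun τ hag j hj => ?_)
  · have hi : ∀ τ' : Store, Store.Agree [20, 29] [6] τ τ' → (cell 24).eval τ' = code ν x :=
      fun τ' hag' => by rw [eval_cell, hag'.1 24 (by decide), hx]
    have h1 := h.agree hag (by decide) (by decide)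
    have hF1 := hF.agree hag (by decide)
    have hE1 := hE.agree hag (by decide)
    rw [run_sumAt (code_injective ν) (α := Flag G) (j := code ν x)
      (q := fun y => y ∈ ends G T ∧ E.cl T y = E.cl T x) (g := fun _ => 1)
      (fun x => by rw [h1.count]; exact code_lt ν x) hi ?_ (fun _ _ _ _ _ => rfl)]
    · rw [Finset.sum_const, nsmul_one, Embedding.deg]
      congr 2
      ext y
      rw [mem_filter, mem_filter]
      simp only [mem_univ, true_and]
    · intro τ' hag' hlt
      rw [h1.count] at hlt
      have hF' := hF1.agree hag' (by decide)
      have hE' := hE1.agree hag' (by decide)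
      refine and_iff_exists (hE' _ hlt) fun y hy _ => ?_
      rw [Test.holds_eq, NatExp.eval_vec, NatExp.eval_vec, hi τ' hag', eval_cell, ← hy]
      exact hF' y x
  · exact real_run_sumAt_of_ne (fun τ' hag' => by rw [eval_cell, hag'.1 24 (by decide)]) hj

/-! #### Chains of parallel edges -/

/-- The flags with the numbers in the cells `20` and `21` are consecutive in the chain of the
flag with the number in the cell `24`. -/
def hairTest : Test :=
  .or (.and (.eq (.vec 14 (cell 20)) (.vec 14 (cell 21)))
      (.and (.realLE (.vec 6 (cell 20)) (.add .one .one))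
        (.realLE (.add .one .one) (.vec 6 (cell 20)))))
    (.and (.eq (cell 21) (.vec 9 (cell 20)))
      (.not (.and (.eq (.vec 6 (cell 20)) (.vec 6 (cell 24)))
        (.eq (.vec 7 (cell 20)) (.vec 7 (cell 24))))))

/-- Compute the weights of the chains of parallel edges. -/
def hairCmd : Cmd :=
  loop 24 5 (seq
    (labels 5 17 (.and (.pos (.vec 15 (cell 20))) (.and (.pos (.vec 15 (cell 21))) hairTest)))
    (sumAt 4 (cell 24) 5 (.and (.pos (.vec 15 (cell 20)))
      (.eq (.vec 17 (cell 24)) (.vec 17 (cell 20)))) (.vec 2 (cell 20))))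

theorem holds_hairTest (h : Tables ν E z κ σ) (hF : HasFaces ν E T σ) (hD : HasDeg ν E T σ)
    {x y s : Flag G} (hx : code ν x = σ.nat 20 0 0) (hy : code ν y = σ.nat 21 0 0)
    (hs : code ν s = σ.nat 24 0 0) : hairTest.Holds σ ↔
      (E.cl T x = E.cl T y ∧ E.deg T x = 2) ∨ (y = ThinForest.cross x ∧ x.1 ≠ s.1) := by
  -- Degrees are stored as sums of real ones, so equality with two is tested by two comparisons with
  -- `1 + 1`.
  have hdeg : ((E.deg T x : ℝ) ≤ 1 + 1 ∧ (1 + 1 : ℝ) ≤ E.deg T x) ↔ E.deg T x = 2 := by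
    rw [← le_antisymm_iff, one_add_one_eq_two]
    norm_cast
  simp only [hairTest, Test.holds_or, Test.holds_and, Test.holds_eq, Test.holds_not,
    Test.holds_realLE, NatExp.eval_vec, RealExp.eval_vec, RealExp.eval_add, RealExp.eval_one,
    eval_cell, ← hx, ← hy, ← hs, h.fst, h.snd, h.cross, hF _ _, hD _, hdeg, num_inj,
    (code_injective ν).eq_iff, ne_eq, dart_eq_iff]

/-- The steps of a hair depend on the edge that must not be crossed. Therefore the classes are
labelled anew for every starting flag before the weights of its class are summed. -/
theorem hasHair_run (h : Tables ν E z κ σ) (hF : HasFaces ν E T σ)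
    (hE : HasEnds (G := G) ν T σ) (hD : HasDeg ν E T σ) : HasHair ν E z T (hairCmd.run σ) := by
  have hcount := h.count
  refine run_rows (L := [17, 20, 21, 22, 24, 25, 26, 29]) (L' := [4])
    (fun x => by rw [hcount]; exact code_lt ν x)
    (by decide) (by decide) (by decide) (fun x τ hag hx => ?_) (fun τ hag j hj => ?_)
  · rw [run_seq]
    have h1 := h.agree hag (by decide) (by decide)
    have hF1 := hF.agree hag (by decide)
    have hE1 := hE.agree hag (by decide)
    have hD1 := hD.agree hag (by decide)
    set ρ := (labels 5 17 (.and (.pos (.vec 15 (cell 20)))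
      (.and (.pos (.vec 15 (cell 21))) hairTest))).run τ with hρ
    have hagρ : Store.Agree [17, 20, 21, 22, 25, 26, 29] [] τ ρ :=
      (agree_run _ _).mono (by decide) (by decide)
    have h2 := h1.agree hagρ (by decide) (by decide)
    have hE2 := hE1.agree hagρ (by decide)
    have hlab : ∀ y y' : Flag G, ρ.nat 17 (code ν y) 0 = ρ.nat 17 (code ν y') 0 ↔
        Relation.EqvGen (E.HairStep T x.1) y y' := by
      refine run_labels (code_injective ν) (by decide) (by decide) (fun x => ?_)
        (fun τ' hag' hlt1 hlt2 => ?_)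
      · rw [h1.count]
        exact code_lt ν x
      · rw [h1.count] at hlt1 hlt2
        have h' := h1.agree hag' (by decide) (by decide)
        have hF' := hF1.agree hag' (by decide)
        have hE' := hE1.agree hag' (by decide)
        have hD' := hD1.agree hag' (by decide)
        have hx' : code ν x = τ'.nat 24 0 0 := by rw [hag'.1 24 (by decide), hx]
        simp only [Test.holds_and, Test.holds_pos, NatExp.eval_vec, eval_cell, hE' _ hlt1,
          hE' _ hlt2]
        constructor
        · rintro ⟨⟨y, hy, hy'⟩, ⟨y', hz, hz'⟩, hm⟩
          exact ⟨y, y', hy, hz, hy', hz', (holds_hairTest h' hF' hD' hy hz hx').1 hm⟩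
        · rintro ⟨y, y', hy, hz, hy', hz', hm⟩
          exact ⟨⟨y, hy, hy'⟩, ⟨y', hz, hz'⟩, (holds_hairTest h' hF' hD' hy hz hx').2 hm⟩
    have hi : ∀ τ' : Store, Store.Agree [20, 29] [4] ρ τ' → (cell 24).eval τ' = code ν x :=
      fun τ' hag' => by rw [eval_cell, hag'.1 24 (by decide), hagρ.1 24 (by decide), hx]
    rw [run_sumAt (code_injective ν) (α := Flag G) (j := code ν x)
      (q := fun y => y ∈ ends G T ∧ Relation.EqvGen (E.HairStep T x.1) x y)
      (g := fun y => z y.1.edge)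
      (fun x => by rw [h2.count]; exact code_lt ν x) hi ?_ ?_]
    · rw [Embedding.hairWeight]
      refine Finset.sum_congr ?_ fun _ _ => rfl
      ext y
      rw [Embedding.hair, mem_filter, mem_filter]
      simp only [mem_univ, true_and]
    · intro τ' hag' hlt
      rw [h2.count] at hlt
      have hE' := hE2.agree hag' (by decide)
      refine and_iff_exists (hE' _ hlt) fun y hy _ => ?_
      rw [Test.holds_eq, NatExp.eval_vec, NatExp.eval_vec, hi τ' hag', eval_cell, ← hy,
        hag'.1 17 (by decide)]
      exact hlab x y
    · intro τ' hag' y _ hy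
      rw [RealExp.eval_vec, eval_cell, ← hy]
      exact (h2.agree hag' (by decide) (by decide)).weight y
  · rw [run_seq, real_run_sumAt_of_ne (fun τ' hag' => by rw [eval_cell, hag'.1 24 (by decide)])]
    · exact congrFun (congrFun (real_run_of_notMem _ τ (by decide)) j) 0
    · rwa [nat_run_of_notMem _ τ (by decide)]

/-! #### Middle edges -/

/-- Twelve times a real number. -/
def RealExp.twelve (e : RealExp) : RealExp :=
  .add (.add (.add (.add e e) e) (.add (.add e e) e)) (.add (.add (.add e e) e) (.add (.add e e) e))

@[simp] theorem RealExp.eval_twelve (σ : Store) (e : RealExp) :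
    e.twelve.eval σ = 12 * e.eval σ := by
  simp only [RealExp.twelve, RealExp.eval_add]
  ring

/-- Compute the set of middle edges. -/
def middleCmd : Cmd :=
  fill 18 5 (.and (.pos (.vec 15 (cell 20)))
    (.and (.realLE .one (RealExp.twelve (.add (.vec 4 (cell 20)) (.vec 4 (cell 20)))))
      (.realLE .one (RealExp.twelve
        (.add (.vec 4 (.vec 9 (cell 20))) (.vec 4 (.vec 9 (cell 20))))))))

theorem hasMiddle_run (h : Tables ν E z κ σ) (hE : HasEnds (G := G) ν T σ)
    (hH : HasHair ν E z T σ) : HasMiddle ν E z T (middleCmd.run σ) := by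
  have hcount := h.count
  intro a ha
  refine run_fill (p := fun a => ∃ x : Flag G, code ν x = a ∧ E.Middle T z x) (by decide)
    (fun τ hag h1 => ?_) a (by rwa [hcount])
  rw [hcount] at h1
  have h' := h.agree hag (by decide) (by decide)
  have hE' := hE.agree hag (by decide)
  have hH' := hH.agree hag (by decide)
  refine and_iff_exists (hE' _ h1) fun x hx _ => ?_
  simp only [Test.holds_and, Test.holds_realLE, RealExp.eval_one, RealExp.eval_twelve,
    RealExp.eval_add, RealExp.eval_vec, NatExp.eval_vec, eval_cell, ← hx, h'.cross, hH' _]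
  -- The program computes `12 * (w + w)`, and the definition of a middle edge uses `24 * w`.
  rw [← two_mul, ← two_mul, ← mul_assoc, ← mul_assoc]
  norm_num

/-- The edges of the flags with the numbers in the cells `24` and `20` join the same
components. -/
def parTest : Test :=
  .or (.and (.eq (.vec 11 (.vec 6 (cell 24))) (.vec 11 (.vec 6 (cell 20))))
      (.eq (.vec 11 (.vec 7 (cell 24))) (.vec 11 (.vec 7 (cell 20)))))
    (.and (.eq (.vec 11 (.vec 6 (cell 24))) (.vec 11 (.vec 7 (cell 20))))
      (.eq (.vec 11 (.vec 7 (cell 24))) (.vec 11 (.vec 6 (cell 20)))))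

/-- Compute the weights of the classes of middle edges. -/
def parCmd : Cmd :=
  loop 24 5 (sumAt 5 (cell 24) 5 (.and (.pos (.vec 18 (cell 20))) parTest) (.vec 2 (cell 20)))

theorem hasPar_run (h : Tables ν E z κ σ) (hC : HasComp ν T σ) (hM : HasMiddle ν E z T σ) :
    HasPar ν E z T (parCmd.run σ) := by
  have hcount := h.count
  refine run_rows (L := [20, 24, 29]) (L' := [5]) (fun x => by rw [hcount]; exact code_lt ν x)
    (by decide) (by decide) (by decide) (fun x τ hag hx => ?_) (fun τ hag j hj => ?_)
  · have hi : ∀ τ' : Store, Store.Agree [20, 29] [5] τ τ' → (cell 24).eval τ' = code ν x :=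
      fun τ' hag' => by rw [eval_cell, hag'.1 24 (by decide), hx]
    have h1 := h.agree hag (by decide) (by decide)
    have hC1 := hC.agree hag (by decide)
    have hM1 := hM.agree hag (by decide)
    rw [run_sumAt (code_injective ν) (α := Flag G) (j := code ν x)
      (q := fun y => E.Middle T z y ∧ Par T x y) (g := fun y => z y.1.edge)
      (fun x => by rw [h1.count]; exact code_lt ν x) hi ?_ ?_]
    · rw [Embedding.parWeight]
    · intro τ' hag' hlt
      rw [h1.count] at hlt
      have h' := h1.agree hag' (by decide) (by decide)
      have hC' := hC1.agree hag' (by decide)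
      have hM' := hM1.agree hag' (by decide)
      refine and_iff_exists (hM' _ hlt) fun y hy _ => ?_
      simp only [parTest, Test.holds_or, Test.holds_and, Test.holds_eq, NatExp.eval_vec,
        hi τ' hag', eval_cell, ← hy, h'.fst, h'.snd, hC' _ _, Par]
    · intro τ' hag' y _ hy
      rw [RealExp.eval_vec, eval_cell, ← hy]
      exact (h1.agree hag' (by decide) (by decide)).weight y
  · exact real_run_sumAt_of_ne (fun τ' hag' => by rw [eval_cell, hag'.1 24 (by decide)]) hj

/-! #### A round -/

/-- Find a cheapest candidate. -/
def bestCmd : Cmd :=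
  cheapest 3 5 (.and (.pos (.vec 18 (cell 20))) (.realLE .one (RealExp.twelve (.vec 5 (cell 20)))))

/-- Add the edge that was found to the forest. -/
def addCmd : Cmd :=
  ite (.pos (cell 27))
    (seq (setNat 4 (.vec 6 (cell 28)) (.vec 7 (cell 28)) (.lit 1))
      (setNat 4 (.vec 7 (cell 28)) (.vec 6 (cell 28)) (.lit 1))) skip

/-- A round of the algorithm. -/
def roundCmd : Cmd :=
  seq compCmd (seq faceCmd (seq endsCmd (seq degCmd (seq hairCmd (seq middleCmd (seq parCmd
    (seq bestCmd addCmd)))))))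

theorem bestCmd_spec (h : Tables ν E z κ σ) (hM : HasMiddle ν E z T σ) (hP : HasPar ν E z T σ) :
    ((bestCmd.run σ).nat 27 0 0 = 0 ∧ ∀ x, ¬ E.Candidate T z x) ∨
    ((bestCmd.run σ).nat 27 0 0 = 1 ∧ ∃ x, E.Candidate T z x ∧
      (∀ y, E.Candidate T z y → κ x.1.edge ≤ κ y.1.edge) ∧
      (bestCmd.run σ).nat 28 0 0 = code ν x) := by
  refine run_cheapest (code_injective ν) (α := Flag G) (κ := fun x => κ x.1.edge) (by decide)
    (fun x => ?_) (fun τ hag hlt => ?_) h.cost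
  · rw [h.count]
    exact code_lt ν x
  · rw [h.count] at hlt
    have hM' := hM.agree hag (by decide)
    have hP' := hP.agree hag (by decide)
    refine and_iff_exists (hM' _ hlt) fun x hx _ => ?_
    simp only [Test.holds_realLE, RealExp.eval_one, RealExp.eval_twelve, RealExp.eval_vec,
      eval_cell, ← hx, hP' _]

theorem hasTree_addCmd (h : Tables ν E z κ σ) (hT : HasTree ν T σ) {x : Flag G}
    (h1 : σ.nat 27 0 0 = 1) (h2 : σ.nat 28 0 0 = code ν x) :
    HasTree ν (addEdge T x) (addCmd.run σ) := by
  intro u v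
  rw [addCmd, run_ite_pos (by simp [h1])]
  have e : ((setNat 4 (.vec 6 (cell 28)) (.vec 7 (cell 28)) (.lit 1)).run σ) =
      σ.setNat 4 (ν x.1.fst) (ν x.1.snd) 1 := by
    simp only [run_setNat, NatExp.eval_vec, eval_cell, h2, h.fst, h.snd, NatExp.eval_lit]
  rw [run_seq, e, run_setNat]
  simp only [NatExp.eval_vec, eval_cell, Store.nat_setNat_of_ne _ (show 6 ≠ 4 by norm_num),
    Store.nat_setNat_of_ne _ (show 7 ≠ 4 by norm_num),
    Store.nat_setNat_of_ne _ (show 28 ≠ 4 by norm_num), h2, h.fst, h.snd, NatExp.eval_lit,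
    Store.nat_setNat, num_inj, hT u v, addEdge, SimpleGraph.sup_adj, SimpleGraph.edge_adj]
  have hne := x.1.fst_ne_snd
  by_cases ha : u = x.1.snd ∧ v = x.1.fst
  · obtain ⟨rfl, rfl⟩ := ha
    simp [hne.symm]
  · by_cases hb : u = x.1.fst ∧ v = x.1.snd
    · obtain ⟨rfl, rfl⟩ := hb
      simp [hne]
    · rw [if_neg ha, if_neg hb]
      congr 1
      simp only [eq_iff_iff]
      constructor
      · exact Or.inl
      · rintro (h | ⟨h | h, -⟩)
        · exact h
        · exact absurd h hb
        · exact absurd h ha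

/-- Each stage establishes its own array and leaves alone the arrays that later stages still read;
the latter is a decidable statement about lists of array names. -/
theorem roundCmd_spec (h : Tables ν E z κ σ) (hT : HasTree ν T σ) :
    Tables ν E z κ (roundCmd.run σ) ∧
      ∃ T', E.Round z κ T T' ∧ HasTree ν T' (roundCmd.run σ) := by
  refine ⟨h.agree (agree_run _ _) (by decide) (by decide), ?_⟩
  simp only [roundCmd, run_seq]
  have hC := hasComp_run h hT
  replace h := h.agree (agree_run compCmd σ) (by decide) (by decide)
  replace hT := hT.agree (agree_run compCmd σ) (by decide)
  generalize compCmd.run σ = τ at *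
  have hF := hasFaces_run h hT hC
  replace h := h.agree (agree_run faceCmd τ) (by decide) (by decide)
  replace hT := hT.agree (agree_run faceCmd τ) (by decide)
  replace hC := hC.agree (agree_run faceCmd τ) (by decide)
  generalize faceCmd.run τ = τ at *
  have hE := hasEnds_run h hC
  replace h := h.agree (agree_run endsCmd τ) (by decide) (by decide)
  replace hT := hT.agree (agree_run endsCmd τ) (by decide)
  replace hC := hC.agree (agree_run endsCmd τ) (by decide)
  replace hF := hF.agree (agree_run endsCmd τ) (by decide)
  generalize endsCmd.run τ = τ at *
  have hD := hasDeg_run h hF hE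
  replace h := h.agree (agree_run degCmd τ) (by decide) (by decide)
  replace hT := hT.agree (agree_run degCmd τ) (by decide)
  replace hC := hC.agree (agree_run degCmd τ) (by decide)
  replace hF := hF.agree (agree_run degCmd τ) (by decide)
  replace hE := hE.agree (agree_run degCmd τ) (by decide)
  generalize degCmd.run τ = τ at *
  have hH := hasHair_run h hF hE hD
  replace h := h.agree (agree_run hairCmd τ) (by decide) (by decide)
  replace hT := hT.agree (agree_run hairCmd τ) (by decide)
  replace hC := hC.agree (agree_run hairCmd τ) (by decide)
  replace hE := hE.agree (agree_run hairCmd τ) (by decide)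
  generalize hairCmd.run τ = τ at *
  have hM := hasMiddle_run h hE hH
  replace h := h.agree (agree_run middleCmd τ) (by decide) (by decide)
  replace hT := hT.agree (agree_run middleCmd τ) (by decide)
  replace hC := hC.agree (agree_run middleCmd τ) (by decide)
  generalize middleCmd.run τ = τ at *
  have hP := hasPar_run h hC hM
  replace h := h.agree (agree_run parCmd τ) (by decide) (by decide)
  replace hT := hT.agree (agree_run parCmd τ) (by decide)
  replace hM := hM.agree (agree_run parCmd τ) (by decide)
  generalize parCmd.run τ = τ at *
  have hB := bestCmd_spec h hM hP
  replace h := h.agree (agree_run bestCmd τ) (by decide) (by decide)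
  replace hT := hT.agree (agree_run bestCmd τ) (by decide)
  generalize bestCmd.run τ = τ at *
  rcases hB with ⟨h1, h2⟩ | ⟨h1, x, h2, h3, h4⟩
  · refine ⟨T, Or.inr ⟨h2, rfl⟩, ?_⟩
    rw [addCmd, run_ite_neg (by simp [h1])]
    exact hT.agree (agree_run skip τ) (by decide)
  · exact ⟨addEdge T x, Or.inl ⟨x, h2, h3, rfl⟩, hasTree_addCmd h hT h1 h4⟩

/-- All rounds of the algorithm. -/
def roundsCmd : Cmd := loop 23 0 roundCmd

theorem roundsCmd_spec (h : Tables ν E z κ σ) (hT : HasTree ν ⊥ σ) :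
    ∃ F : ℕ → SimpleGraph V, F 0 = ⊥ ∧ (∀ i < n, E.Round z κ (F i) (F (i + 1))) ∧
      HasTree ν (F n) (roundsCmd.run σ) := by
  have hsize := h.size
  have key := run_loop_agree (k := 23) (b := 0) (σ := σ) (P := roundCmd)
    (L := (loop 23 0 roundCmd).natWrites) (L' := roundCmd.realWrites) (by decide)
    (fun _ h => h) (fun _ h => h)
    (fun m τ => Tables ν E z κ τ ∧ ∃ F : ℕ → SimpleGraph V, F 0 = ⊥ ∧
      (∀ i < m, E.Round z κ (F i) (F (i + 1))) ∧ HasTree ν (F m) τ) ?_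
    ⟨h, fun _ => ⊥, rfl, by simp, hT⟩ ?_
  · rw [hsize] at key
    exact key.2
  · rintro m τ w ⟨h1, F, h2, h3, h4⟩
    have hag : Store.Agree [23] [] τ (τ.setNat 23 0 0 w) :=
      (Store.Agree.refl _ _ _).setNat (by simp) _ _ _
    exact ⟨h1.agree hag (by decide) (by decide), F, h2, h3, h4.agree hag (by decide)⟩
  · rintro m hm τ hag hk ⟨h1, F, h2, h3, h4⟩
    obtain ⟨g1, T', g2, g3⟩ := roundCmd_spec h1 h4
    -- The sequence of forests is kept up to `m` and continued by the result of the new round.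
    refine ⟨g1, fun i => if i ≤ m then F i else T', by simpa using h2, fun i hi => ?_, ?_⟩
    · rcases Nat.lt_succ_iff_lt_or_eq.1 hi with h5 | rfl
      · simpa [h5.le, Nat.succ_le_of_lt h5] using h3 i h5
      · simpa using g2
    · simpa using g3

end Encoding

end ThinForest

namespace ThinForest

/-! ### The tables of flags computed from the input. -/

section Setup

open Classical Finset Cmd

/-- Note whether the pair of the cells `20` and `21` is an edge. -/
def dartCmd (b : ℕ) : Cmd :=
  ite (.and (.not (.eq (cell 20) (cell 21)))
      (.or (.pos (.get 1 (cell 20) (cell 21))) (.pos (.get 1 (cell 21) (cell 20)))))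
    (setNat 10 (.add (cell 5) (.lit b)) (.lit 0) (.lit 1))
    (setNat 10 (.add (cell 5) (.lit b)) (.lit 0) (.lit 0))

/-- Compute the cost of the edge between the vertices in the cells `20` and `21`. -/
def costCmd (b : ℕ) : Cmd :=
  ite (.pos (.get 1 (cell 20) (cell 21)))
    (ite (.and (.pos (.get 1 (cell 21) (cell 20)))
        (.realLE (.get 0 (cell 21) (cell 20)) (.get 0 (cell 20) (cell 21))))
      (setReal 3 (.add (cell 5) (.lit b)) (.lit 0) (.get 0 (cell 21) (cell 20)))
      (setReal 3 (.add (cell 5) (.lit b)) (.lit 0) (.get 0 (cell 20) (cell 21))))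
    (setReal 3 (.add (cell 5) (.lit b)) (.lit 0) (.get 0 (cell 21) (cell 20)))

/-- Write the row of a flag into the tables. -/
def rowCmd (b : ℕ) : Cmd :=
  seq (costCmd b) (seq (dartCmd b)
    (seq (setNat 6 (.add (cell 5) (.lit b)) (.lit 0) (cell 20))
    (seq (setNat 7 (.add (cell 5) (.lit b)) (.lit 0) (cell 21))
    (seq (setNat 8 (.add (cell 5) (.lit b)) (.lit 0) (.lit b))
    (seq (setNat 9 (.add (cell 5) (.lit b)) (.lit 0) (.add (cell 5) (.lit (1 - b))))
      (setReal 2 (.add (cell 5) (.lit b)) (.lit 0)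
        (.add (.get 1 (cell 20) (cell 21)) (.get 1 (cell 21) (cell 20)))))))))

/-- Write the tables that describe the flags. -/
def setupCmd : Cmd :=
  seq (setNat 5 (.lit 0) (.lit 0) (.lit 0)) (loop 20 0 (loop 21 0
    (seq (rowCmd 0) (seq (rowCmd 1)
      (setNat 5 (.lit 0) (.lit 0) (.add (cell 5) (.lit 2)))))))

theorem run_dartCmd (b : ℕ) (σ : Store) : (dartCmd b).run σ =
    σ.setNat 10 (σ.nat 5 0 0 + b) 0 (if σ.nat 20 0 0 ≠ σ.nat 21 0 0 ∧
      (1 ≤ σ.nat 1 (σ.nat 20 0 0) (σ.nat 21 0 0) ∨ 1 ≤ σ.nat 1 (σ.nat 21 0 0) (σ.nat 20 0 0))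
      then 1 else 0) := by
  rw [dartCmd, run_ite]
  simp only [Test.holds_and, Test.holds_not, Test.holds_or, Test.holds_eq, Test.holds_pos,
    NatExp.eval_get, eval_cell, run_setNat, NatExp.eval_add, NatExp.eval_lit, ne_eq]
  split_ifs <;> rfl

/-- The cost of the edge between the vertices in the cells `20` and `21`. -/
noncomputable def costValue (σ : Store) : ℝ :=
  if 1 ≤ σ.nat 1 (σ.nat 20 0 0) (σ.nat 21 0 0) then
    (if 1 ≤ σ.nat 1 (σ.nat 21 0 0) (σ.nat 20 0 0) ∧
      σ.real 0 (σ.nat 21 0 0) (σ.nat 20 0 0) ≤ σ.real 0 (σ.nat 20 0 0) (σ.nat 21 0 0) then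
      σ.real 0 (σ.nat 21 0 0) (σ.nat 20 0 0) else σ.real 0 (σ.nat 20 0 0) (σ.nat 21 0 0))
  else σ.real 0 (σ.nat 21 0 0) (σ.nat 20 0 0)

theorem run_costCmd (b : ℕ) (σ : Store) : (costCmd b).run σ =
    σ.setReal 3 (σ.nat 5 0 0 + b) 0 (costValue σ) := by
  rw [costCmd, run_ite, run_ite, costValue]
  simp only [Test.holds_and, Test.holds_realLE, Test.holds_pos, NatExp.eval_get,
    RealExp.eval_get, eval_cell, run_setReal, NatExp.eval_add, NatExp.eval_lit]
  split_ifs <;> rfl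

variable {n : ℕ} {D : Digraph (Fin n)} {E : Embedding (underlying D)} {c x : Fin n → Fin n → ℝ}

/-- The row `i` of the tables is correct. -/
def RowCorrect (D : Digraph (Fin n)) (c x : Fin n → Fin n → ℝ) (σ : Store) (i : ℕ) : Prop :=
  (∀ y : Flag (underlying D), code (OrderIso.refl _) y = i →
    σ.nat 6 i 0 = y.1.fst ∧ σ.nat 7 i 0 = y.1.snd ∧ σ.nat 8 i 0 = y.2.toNat ∧
    σ.nat 9 i 0 = code (OrderIso.refl _) (cross y) ∧
    σ.real 2 i 0 = symmetrization D x y.1.edge ∧ σ.real 3 i 0 = edgeCost D c y.1.edge) ∧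
  (1 ≤ σ.nat 10 i 0 ↔ ∃ y : Flag (underlying D), code (OrderIso.refl _) y = i)

theorem RowCorrect.congr {σ τ : Store} {i : ℕ} (h : RowCorrect D c x σ i)
    (h1 : ∀ a ∈ [6, 7, 8, 9, 10], τ.nat a i 0 = σ.nat a i 0)
    (h2 : ∀ a ∈ [2, 3], τ.real a i 0 = σ.real a i 0) : RowCorrect D c x τ i := by
  unfold RowCorrect
  rw [h1 6 (by simp), h1 7 (by simp), h1 8 (by simp), h1 9 (by simp), h1 10 (by simp),
    h2 2 (by simp), h2 3 (by simp)]
  exact h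

/-- The number `i` determines `u`, `v` and the side, so at most one flag has to be checked; it
exists exactly if `u` and `v` are adjacent. -/
theorem rowCorrect_of {σ : Store} {i : ℕ} (u v : Fin n) (b : Bool)
    (hi : i = 2 * (n * u + v) + b.toNat) (h6 : σ.nat 6 i 0 = u) (h7 : σ.nat 7 i 0 = v)
    (h8 : σ.nat 8 i 0 = b.toNat) (h9 : σ.nat 9 i 0 = 2 * (n * u + v) + (!b).toNat)
    (h10 : 1 ≤ σ.nat 10 i 0 ↔ (underlying D).Adj u v)
    (hz : σ.real 2 i 0 = symmetrization D x s(u, v))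
    (hc : (underlying D).Adj u v → σ.real 3 i 0 = edgeCost D c s(u, v)) :
    RowCorrect D c x σ i := by
  constructor
  · intro y hy
    obtain ⟨⟨⟨u', v'⟩, h⟩, b'⟩ := y
    have hb := Bool.toNat_le b
    have hb' := Bool.toNat_le b'
    have hy' : 2 * (n * (u' : ℕ) + v') + b'.toNat = 2 * (n * u + v) + b.toNat := by
      rw [← hi, ← hy]
      rfl
    obtain ⟨e1, e2⟩ := mul_add_inj v'.2 v.2
      (show n * (u' : ℕ) + v' = n * u + v by omega)
    obtain rfl := Fin.ext e1
    obtain rfl := Fin.ext e2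
    obtain rfl := toNat_inj.1 (show b'.toNat = b.toNat by omega)
    exact ⟨h6, h7, h8, h9, hz, hc h⟩
  · rw [h10]
    constructor
    · intro h
      exact ⟨(⟨(u, v), h⟩, b), hi.symm⟩
    · rintro ⟨⟨⟨⟨u', v'⟩, h⟩, b'⟩, hy⟩
      have hb := Bool.toNat_le b
      have hb' := Bool.toNat_le b'
      have hy' : 2 * (n * (u' : ℕ) + v') + b'.toNat = 2 * (n * u + v) + b.toNat := by
        rw [← hi, ← hy]
        rfl
      obtain ⟨e1, e2⟩ := mul_add_inj v'.2 v.2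
        (show n * (u' : ℕ) + v' = n * u + v by omega)
      obtain rfl := Fin.ext e1
      obtain rfl := Fin.ext e2
      exact h

/-- Missing arcs are stored with value zero, so the sum of the two entries is the symmetrization for
every pair. The stored cost is compared with `edgeCost` only for edges. -/
theorem rowCmd_spec {σ τ : Store} (hσ : σ = input D E c x)
    (h1 : τ.nat 1 = σ.nat 1) (h2 : ∀ a < 2, τ.real a = σ.real a) {u v : Fin n}
    (hu : τ.nat 20 0 0 = u) (hv : τ.nat 21 0 0 = v) (hM : τ.nat 5 0 0 = 2 * (n * u + v))
    (b : Bool) : RowCorrect D c x ((rowCmd b.toNat).run τ) (2 * (n * u + v) + b.toNat) ∧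
      ∀ i ≠ 2 * (n * (u : ℕ) + v) + b.toNat, RowCorrect D c x τ i →
        RowCorrect D c x ((rowCmd b.toNat).run τ) i := by
  have hadj : ∀ u v : Fin n, 1 ≤ τ.nat 1 u v ↔ D.Adj u v := by
    intro u v
    rw [h1, hσ]
    by_cases h : D.Adj u v <;> simp [input, h]
  have hc : ∀ u v : Fin n, τ.real 0 u v = onArc D c u v := by
    intro u v
    rw [h2 0 (by norm_num), hσ]
    simp [input]
  have hx : ∀ u v : Fin n, τ.real 1 u v = onArc D x u v := by
    intro u v
    rw [h2 1 (by norm_num), hσ]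
    simp [input]
  have hcost : (underlying D).Adj u v → costValue τ = edgeCost D c s(u, v) := by
    intro h
    have h' := (underlying_adj.1 h).2
    simp only [costValue, hu, hv, hadj, hc, edgeCost, Sym2.lift_mk]
    by_cases a1 : D.Adj u v <;> by_cases a2 : D.Adj v u
    · simp only [a1, a2, onArc, if_true, true_and]
      split_ifs with h3
      · exact (min_eq_right h3).symm
      · exact (min_eq_left (not_le.1 h3).le).symm
    · simp [a1, a2, onArc]
    · simp [a1, a2, onArc]
    · simp [a1, a2] at h'
  simp only [rowCmd, run_seq, run_dartCmd, run_costCmd, run_setNat, run_setReal, NatExp.eval_add,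
    NatExp.eval_lit, eval_cell, RealExp.eval_add, RealExp.eval_get]
  constructor
  · refine rowCorrect_of u v b rfl ?_ ?_ ?_ ?_ ?_ ?_ ?_
    · simp [Store.setNat, Store.setReal, hu, hM]
    · simp [Store.setNat, Store.setReal, hv, hM]
    · simp [Store.setNat, Store.setReal, hM]
    · cases b <;> simp [Store.setNat, Store.setReal, hM]
    · simp [Store.setNat, Store.setReal, hM, hu, hv, hadj, underlying_adj, Fin.val_inj]
      split_ifs with h <;> simp [h]
    · simp [Store.setNat, Store.setReal, hM, hu, hv, hx, symmetrization_mk]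
    · intro h
      rw [← hcost h]
      simp [Store.setNat, Store.setReal, hM]
  · intro i hi h
    have hi' : i ≠ 2 * (n * (u : ℕ) + v) + b.toNat := hi
    refine h.congr ?_ ?_ <;> simp [Store.setNat, Store.setReal, hM, hi']

/-- The cell of the array `5` counts the rows written so far. It ends at `2n²` and serves as the
bound of the loops over flags from then on. -/
theorem setupCmd_spec : Tables (OrderIso.refl _) E (symmetrization D x) (edgeCost D c)
    (setupCmd.run (input D E c x)) := by
  set σ := input D E c x with hσ
  have hn : σ.nat 0 0 0 = n := by simp [hσ, input]
  have hn' : ∀ w, (σ.setNat 5 0 0 w).nat 0 0 0 = n := fun w => by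
    rw [Store.nat_setNat_of_ne _ (by norm_num), hn]
  set body : Cmd := seq (rowCmd 0) (seq (rowCmd 1)
      (setNat 5 (.lit 0) (.lit 0) (.add (cell 5) (.lit 2)))) with hbody
  have hag0 : Store.Agree [5, 6, 7, 8, 9, 10, 20, 21] [2, 3] σ (σ.setNat 5 0 0 0) :=
    (Store.Agree.refl _ _ _).setNat (by simp) _ _ _
  have hset : ∀ τ : Store, ∀ a w i, a ∉ [6, 7, 8, 9, 10] → RowCorrect D c x τ i →
      RowCorrect D c x (τ.setNat a 0 0 w) i := by
    intro τ a w i ha h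
    refine h.congr (fun a' ha' => ?_) (fun _ _ => rfl)
    rw [Store.nat_setNat_of_ne]
    rintro rfl
    exact ha ha'
  have hinner : ∀ τ : Store, Store.Agree [5, 6, 7, 8, 9, 10, 20, 21] [2, 3] σ τ →
      ∀ u : Fin n, τ.nat 20 0 0 = u → τ.nat 5 0 0 = 2 * (n * u) →
      (∀ i < 2 * (n * (u : ℕ)), RowCorrect D c x τ i) →
      ((loop 21 0 body).run τ).nat 5 0 0 = 2 * (n * (u + 1)) ∧
      ∀ i < 2 * (n * ((u : ℕ) + 1)), RowCorrect D c x ((loop 21 0 body).run τ) i := by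
    intro τ hag u hu h5 hrows
    have key := run_loop_agree (k := 21) (b := 0) (σ := τ) (P := body)
      (L := [5, 6, 7, 8, 9, 10, 21]) (L' := [2, 3]) (by decide) (by decide) (by decide)
      (fun m ρ => ρ.nat 5 0 0 = 2 * (n * u + m) ∧
        ∀ i < 2 * (n * (u : ℕ) + m), RowCorrect D c x ρ i)
      (fun m ρ w h => ⟨by rw [Store.nat_setNat_of_ne _ (by norm_num), h.1],
        fun i hi => hset _ _ _ _ (by simp) (h.2 i hi)⟩) ⟨h5, hrows⟩ ?_
    · rw [hag.1 0 (by decide), hn] at key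
      rw [mul_add, mul_one]
      exact key
    · intro m hm ρ hag' hk ⟨g1, g2⟩
      rw [hag.1 0 (by decide), hn] at hm
      have hagρ : Store.Agree [5, 6, 7, 8, 9, 10, 20, 21] [2, 3] σ ρ :=
        hag.trans (hag'.mono (by decide) (by decide))
      obtain ⟨v, rfl⟩ : ∃ v : Fin n, (v : ℕ) = m := ⟨⟨m, hm⟩, rfl⟩
      have hu' : ρ.nat 20 0 0 = u := by rw [hag'.1 20 (by decide), hu]
      have r0 := rowCmd_spec (E := E) hσ (hagρ.1 1 (by decide))
        (fun a ha => hagρ.2 a (by interval_cases a <;> decide)) hu' hk g1 false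
      set ρ1 := (rowCmd 0).run ρ with hρ1
      have ha1 : Store.Agree [6, 7, 8, 9, 10] [2, 3] ρ ρ1 :=
        (agree_run (rowCmd 0) ρ).mono (by decide) (by decide)
      have hagρ1 : Store.Agree [5, 6, 7, 8, 9, 10, 20, 21] [2, 3] σ ρ1 :=
        hagρ.trans (ha1.mono (by decide) (by decide))
      have g1' : ρ1.nat 5 0 0 = 2 * (n * u + v) := by rw [ha1.1 5 (by decide), g1]
      have r1 := rowCmd_spec (E := E) hσ (hagρ1.1 1 (by decide))
        (fun a ha => hagρ1.2 a (by interval_cases a <;> decide))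
        (by rw [ha1.1 20 (by decide), hu'])
        (by rw [ha1.1 21 (by decide), hk]) g1' true
      set ρ2 := (rowCmd 1).run ρ1 with hρ2
      have ha2 : Store.Agree [6, 7, 8, 9, 10] [2, 3] ρ1 ρ2 :=
        (agree_run (rowCmd 1) ρ1).mono (by decide) (by decide)
      have g1'' : ρ2.nat 5 0 0 = 2 * (n * u + v) := by rw [ha2.1 5 (by decide), g1']
      have hrun : body.run ρ = ρ2.setNat 5 0 0 (2 * (n * u + v) + 2) := by
        rw [hbody, run_seq, run_seq, run_setNat, ← hρ1, ← hρ2]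
        simp only [NatExp.eval_lit, NatExp.eval_add, eval_cell, g1'']
      rw [hrun]
      refine ⟨by rw [Store.nat_setNat_self]; ring, fun i hi => hset _ _ _ _ (by simp) ?_⟩
      have r0' : RowCorrect D c x ρ1 (2 * (n * u + v)) := r0.1
      have r1' : RowCorrect D c x ρ2 (2 * (n * u + v) + 1) := r1.1
      by_cases h1 : i = 2 * (n * u + v) + 1
      · rw [h1]
        exact r1'
      · refine r1.2 i h1 ?_
        by_cases h0 : i = 2 * (n * u + v)
        · rw [h0]
          exact r0'
        · exact r0.2 i h0 (g2 i (by omega))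
  have key := run_loop_agree (k := 20) (b := 0) (σ := σ.setNat 5 0 0 0) (P := loop 21 0 body)
    (L := [5, 6, 7, 8, 9, 10, 20, 21]) (L' := [2, 3]) (by decide) (by decide) (by decide)
    (fun m ρ => ρ.nat 5 0 0 = 2 * (n * m) ∧ ∀ i < 2 * (n * m), RowCorrect D c x ρ i)
    (fun m ρ w h => ⟨by rw [Store.nat_setNat_of_ne _ (by norm_num), h.1],
        fun i hi => hset _ _ _ _ (by simp) (h.2 i hi)⟩) (by simp) ?_
  · rw [hn' 0] at key
    have hag : Store.Agree [5, 6, 7, 8, 9, 10, 20, 21] [2, 3] σ (setupCmd.run σ) :=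
      (agree_run setupCmd σ).mono (by decide) (by decide)
    change (setupCmd.run σ).nat 5 0 0 = _ ∧ ∀ i < _, RowCorrect D c x (setupCmd.run σ) i at key
    have hrow := fun y : Flag (underlying D) =>
      (key.2 _ (code_lt (OrderIso.refl _) y)).1 y rfl
    constructor
    · rw [hag.1 0 (by decide), hn]
    · exact key.1
    · intro d
      rw [hag.1 2 (by decide), hσ]
      have h : (underlying D).Adj d.fst d.snd := d.adj
      simp [input, h]
    · intro d
      rw [hag.1 3 (by decide), hσ]
      have h : (underlying D).Adj d.fst d.snd := d.adj
      have e : d.edge = s(d.fst, d.snd) := rfl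
      rw [e]
      cases ht : E.twisted s(d.fst, d.snd) <;> simp [input, h, ht]
    · exact fun y => (hrow y).1
    · exact fun y => (hrow y).2.1
    · exact fun y => (hrow y).2.2.1
    · exact fun y => (hrow y).2.2.2.1
    · exact fun i hi => (key.2 i hi).2
    · exact fun y => (hrow y).2.2.2.2.1
    · exact fun y => (hrow y).2.2.2.2.2
  · intro m hm ρ hag hk ⟨g1, g2⟩
    rw [hn' 0] at hm
    exact hinner ρ (hag0.trans hag) ⟨m, hm⟩ hk g1 g2

theorem hasTree_bot_setupCmd : HasTree (OrderIso.refl (Fin n)) ⊥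
    (setupCmd.run (input D E c x)) := by
  intro u v
  rw [(agree_run setupCmd _).1 4 (by decide)]
  simp [input]

end Setup

end ThinForest

/-! ### The complete program and the theorem. -/

namespace ThinForest

/-- The program that computes a thin forest. -/
def program : Prog := .seq setupCmd.compile roundsCmd.compile

/-- A bound for the number of steps. -/
noncomputable def programTime : Polynomial ℕ :=
  1 + setupCmd.time + roundsCmd.time.comp (Polynomial.X + 2 * (Polynomial.X * Polynomial.X))

theorem iterate_step_nil (σ : Store) (t : ℕ) : step^[t] ([], σ) = ([], σ) :=
  Function.iterate_fixed rfl t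

/-- The setup still changes the array `5`, so only the array `0` may bound its loops; in the rounds
both arrays are fixed. The number `n + 2n²` exceeds both bounds, which explains the composition in
`programTime`. -/
theorem after_program {n : ℕ} {D : Digraph (Fin n)} {E : Embedding (underlying D)}
    {c x : Fin n → Fin n → ℝ} {t : ℕ} (ht : programTime.eval n ≤ t) :
    after program (input D E c x) t =
      ([], roundsCmd.run (setupCmd.run (input D E c x))) := by
  have h := setupCmd_spec (D := D) (E := E) (c := c) (x := x)
  obtain ⟨t1, h1, e1⟩ := Cmd.exists_iterate_step (S := [0]) setupCmd (by decide)
    (input D E c x) n (by simp [input]) [roundsCmd.compile]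
  obtain ⟨t2, h2, e2⟩ := Cmd.exists_iterate_step (S := [0, 5]) roundsCmd (by decide)
    (setupCmd.run (input D E c x)) (n + 2 * (n * n)) (by
      intro a ha
      simp only [List.mem_cons, List.not_mem_nil, or_false] at ha
      rcases ha with rfl | rfl
      · rw [h.size]
        omega
      · rw [h.count]
        omega) []
  have hp : programTime.eval n =
      1 + setupCmd.time.eval n + roundsCmd.time.eval (n + 2 * (n * n)) := by
    simp [programTime]
  obtain ⟨k, rfl⟩ : ∃ k, t = k + (t2 + (t1 + 1)) :=
    ⟨t - (t2 + (t1 + 1)), by omega⟩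
  rw [after, Function.iterate_add_apply, Function.iterate_add_apply, Function.iterate_add_apply,
    Function.iterate_one, program, Cmd.iterate_step_seq, e1, e2, iterate_step_nil]

end ThinForest

theorem mainTheorem6 :
    ∃ (P : ThinForest.Prog) (p q : Polynomial ℕ) (α s : ℝ), 0 < α ∧ 0 < s ∧
      ∀ (n : ℕ) (D : Digraph (Fin n)) (c : Fin n → Fin n → ℝ)
        (E : ThinForest.Embedding (ThinForest.underlying D)) (x : Fin n → Fin n → ℝ),
        (∀ u v, D.Adj u v → 0 ≤ c u v) →
        ThinForest.HeldKarpFeasible D x →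
        -- within polynomially many steps the program halts with a thin spanning forest
        (∃ (σ : ThinForest.Store) (T : SimpleGraph (Fin n)),
          ThinForest.after P (ThinForest.input D E c x) (p.eval n) = ([], σ) ∧
          σ.Represents T ∧
          T ≤ ThinForest.underlying D ∧
          T.IsAcyclic ∧
          (Nat.card T.ConnectedComponent : ℤ) ≤ max 1 E.eulerGenus ∧
          ThinForest.IsThin D c x α s (ThinForest.edges T)) ∧
        -- on rational data all numbers that occur keep a polynomial encoding length
        (∀ m B : ℕ, 0 < m → m ≤ B →
          (ThinForest.input D E c x).SizeAtMost m B →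
          ∀ t : ℕ, (ThinForest.after P (ThinForest.input D E c x) t).2.SizeAtMost m
            (B * 2 ^ (q.eval n))) := by
  refine ⟨ThinForest.program, ThinForest.programTime,
    Polynomial.C ThinForest.program.len * ThinForest.programTime, 96, 24, by norm_num,
    by norm_num, fun n D c E x hc hx => ⟨?_, fun m B hm hmB hsize t => ?_⟩⟩
  · obtain ⟨F, h0, hF, hT⟩ := ThinForest.roundsCmd_spec
      (ThinForest.setupCmd_spec (D := D) (E := E) (c := c) (x := x))
      ThinForest.hasTree_bot_setupCmd
    have h := ThinForest.thin_of_rounds hc hx E h0 (by rwa [Fintype.card_fin])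
    rw [Fintype.card_fin] at h
    refine ⟨_, F n, ThinForest.after_program le_rfl, fun u v => ?_, h⟩
    convert hT u v <;> rfl
  · set p := ThinForest.programTime.eval n with hp
    have key : ∀ t ≤ p, (ThinForest.after ThinForest.program (ThinForest.input D E c x) t).2.SizeAtMost
        m (B * 2 ^ ((Polynomial.C ThinForest.program.len * ThinForest.programTime).eval n)) := by
      intro t ht
      refine (ThinForest.after_sizeAtMost _ hsize (by omega) hmB t).mono ?_
      rw [Polynomial.eval_mul, Polynomial.eval_C]
      exact Nat.mul_le_mul_left _ (Nat.pow_le_pow_right (by norm_num)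
        (Nat.mul_le_mul_left _ ht))
    -- After `p` steps the machine has halted and the memory no longer changes, so later times
    -- reduce to time `p`.
    rcases le_total t p with h | h
    · exact key t h
    · rw [ThinForest.after_program h, ← ThinForest.after_program (le_refl p)]
      exact key p le_rfl
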